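/- Let $k$ be an algebraically closed field of characteristic $0$. Let $0<a<r$ be coprime integers with Hirzebruch–Jung continued fraction $$\frac ra=[c_\ell,c_{\ell-1},\dots,c_1]=c_\ell-\cfrac{1}{c_{\ell-1}-\cfrac{1}{\cdots-\cfrac1{c_1}}},\qquad c_1,\dots,c_\ell\in\mathbb Z_{\ge2}.$$ Put $(\beta_{\ell+1},\alpha_{\ell+1})=(0,r)$, $(\beta_\ell,\alpha_\ell)=(1,a)$ and $(\beta_{i-1},\alpha_{i-1})=c_i(\beta_i,\alpha_i)-(\beta_{i+1},\alpha_{i+1})$ for $1\le i\le\ell$. Let $N=\mathbb Z^2+\mathbb Z\cdot\frac1r(1,a)$ and $M=\operatorname{Hom}(N,\mathbb Z)$. Let $X$ be the smooth toric surface over $k$ (the minimal resolution of the quotient of $\mathbb A^2_k$ by the cyclic group of type $\frac1r(1,a)$) whose fan in $N\otimes\mathbb Q$ has the rays $\tau_0,\dots,\tau_{\ell+1}$ with primitive generators $\frac1r(\beta_i,\alpha_i)$, and the maximal cones spanned by $\tau_j,\tau_{j+1}$ for $0\le j\le\ell$. Write $\Sigma(1)$ for its set of rays, $k[x_0,\dots,x_{\ell+1}]$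 for its Cox ring, and $D_1,\dots,D_\ell\cong\mathbb P^1$ for the torus-invariant curves of $\tau_1,\dots,\tau_\ell$. Let $L_0=\mathcal O_X$ and let $L_1,\dots,L_\ell$ be line bundles on $X$ with $\deg(L_i|_{D_j})=\delta_{ij}$ for $1\le i,j\le\ell$; write $\underline{\mathscr L}=(\mathcal O_X,L_1,\dots,L_\ell)$. The quiver of sections $Q$ has the vertex set $Q_0=\{0,\dots,\ell\}$. Its arrows from $i$ to $j$ are the irreducible torus-invariant sections $s$ of $L_j\otimes L_i^{-1}$, up to scalars: $s$ is not an identity map, and $s$ is not a composite $L_i\to L_v\to L_j$, for any $v\in Q_0$, of two torus-invariant sections other than identity maps. Let $\operatorname{div}(a)\in\mathbb N^{\Sigma(1)}$ be the divisor of zeroes of the section defining the arrow $a\in Q_1$, and let $\operatorname{inc}(a)=\chi_{\mathrm h(a)}-\chi_{\mathrm t(a)}\in\mathbb Z^{Q_0}$, where $\chi_i$ are the standard basis vectors and $\mathrm h(a),\mathrm t(a)$ are the head and the tail of $a$. Grade $k[y_a:a\in Q_1]$ by giving $y_a$ the weight $\operatorname{inc}(a)$; let $T_Q$ be the torus whose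 character group is $\mathrm{Wt}(Q)=\{\theta\in\mathbb Z^{Q_0}:\sum_i\theta_i=0\}$, acting on $\mathbb A^{Q_1}_k=\operatorname{Spec}k[y_a:a\in Q_1]$ accordingly; and put $\vartheta=(-\ell,1,\dots,1)$. The multigraded linear series is $$|\underline{\mathscr L}|=\mathbb A^{Q_1}_k/\!\!/_\vartheta T_Q=\operatorname{Proj}\bigoplus_{j\ge0}k[y_a:a\in Q_1]_{j\vartheta}.$$ For $i\in Q_0$, the tautological line bundle $\mathscr W_i$ on $|\underline{\mathscr L}|$ is the descent of the trivial line bundle on the $\vartheta$-semistable locus with weight $\chi_i-\chi_0$: its sections over an open set are the functions of weight $\chi_i-\chi_0$ on the preimage. Let $$I_Q=\bigl(y^u-y^v:\ u,v\in\mathbb N^{Q_1},\ \operatorname{inc}(u)=\operatorname{inc}(v),\ \operatorname{div}(u)=\operatorname{div}(v)\bigr),\qquad \mathbb V(I_Q)/\!\!/_\vartheta T_Q=\operatorname{Proj}\bigoplus_{j\ge0}\bigl(k[y_a:a\in Q_1]/I_Q\bigr)_{j\vartheta},$$ where $\operatorname{inc}$ and $\operatorname{div}$ are extended additively to $\mathbb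 N^{Q_1}$. Then the morphism $(\Phi_Q)^*:\mathbb A^{\Sigma(1)}_k\to\mathbb A^{Q_1}_k$ given by $\Phi_Q(y_a)=x^{\operatorname{div}(a)}$ maps the open set whose Cox quotient is $X$ into the $\vartheta$-semistable locus, and it descends to a unique morphism of quotients $\varphi:X\to|\underline{\mathscr L}|$. This $\varphi$ is a closed immersion with image $\mathbb V(I_Q)/\!\!/_\vartheta T_Q$; that is, $\varphi$ is the composite of an isomorphism $X\cong\mathbb V(I_Q)/\!\!/_\vartheta T_Q$ and the morphism $\mathbb V(I_Q)/\!\!/_\vartheta T_Q\to|\underline{\mathscr L}|$ induced by $\mathbb V(I_Q)\subseteq\mathbb A^{Q_1}_k$. Moreover $\varphi^*(\mathscr W_i)\cong L_i$ for $0\le i\le\ell$. -/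

import Mathlib

universe u

open CategoryTheory CategoryTheory.Limits AlgebraicGeometry TopologicalSpace

noncomputable section

namespace SpecialMcKay

/-- A smooth fan in the lattice dual to `M`. The rays are indexed by `ι`, and `ray i` is the pairing
with the primitive generator of the `i`-th ray; a cone is given by the set of its rays. -/
structure SmoothFan (M : Type) [AddCommGroup M] (ι : Type) [DecidableEq ι] where
  ray : ι → M →+ ℤ
  cones : Set (Finset ι)
  zero_mem : ∅ ∈ cones
  face_mem : ∀ S ∈ cones, ∀ T ⊆ S, T ∈ cones
  smooth : ∀ S ∈ cones, ∀ i ∈ S, ∃ m : M, ray i m = 1 ∧ ∀ j ∈ S, j ≠ i → ray j m = 0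

namespace SmoothFan

variable {M : Type} [AddCommGroup M] {ι : Type} [DecidableEq ι] (F : SmoothFan M ι)

/-- The semigroup `σ_S^∨ ∩ M`. -/
def dualMonoid (S : Finset ι) : AddSubmonoid M where
  carrier := {m | ∀ i ∈ S, 0 ≤ F.ray i m}
  zero_mem' := by simp
  add_mem' := fun {m n} hm hn i hi => by
    rw [map_add]; exact add_nonneg (hm i hi) (hn i hi)

lemma dualMonoid_anti {S T : Finset ι} (h : S ⊆ T) : F.dualMonoid T ≤ F.dualMonoid S :=
  fun _ hm i hi => hm i (h hi)

variable (k : Type u) [Field k]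

/-- The coordinate ring `k[σ_S^∨ ∩ M]`. -/
abbrev chartRing (S : Finset ι) : Type u := AddMonoidAlgebra k (F.dualMonoid S)

/-- The inclusion `k[σ_T^∨ ∩ M] ⊆ k[σ_S^∨ ∩ M]` for a face `S ⊆ T`. -/
def faceMap {S T : Finset ι} (h : S ⊆ T) : F.chartRing k T →+* F.chartRing k S :=
  AddMonoidAlgebra.mapDomainRingHom k (AddSubmonoid.inclusion (F.dualMonoid_anti h))

lemma faceMap_single {S T : Finset ι} (h : S ⊆ T) (m : F.dualMonoid T) (x : k) :
    F.faceMap k h (AddMonoidAlgebra.single m x) =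
      AddMonoidAlgebra.single (AddSubmonoid.inclusion (F.dualMonoid_anti h) m) x := by
  simp [faceMap]

lemma faceMap_refl (S : Finset ι) : F.faceMap k (Finset.Subset.refl S) = RingHom.id _ := by
  refine RingHom.ext fun f => ?_
  induction f using AddMonoidAlgebra.induction_linear with
  | zero => simp
  | add f g hf hg => rw [map_add, map_add, hf, hg]
  | single m x => exact F.faceMap_single k _ m x

lemma faceMap_comp {S T R : Finset ι} (h : S ⊆ T) (h' : T ⊆ R) :
    (F.faceMap k h).comp (F.faceMap k h') = F.faceMap k (h.trans h') := by
  refine RingHom.ext fun f => ?_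
  induction f using AddMonoidAlgebra.induction_linear with
  | zero => simp
  | add f g hf hg => rw [map_add, map_add, hf, hg]
  | single m x =>
    rw [RingHom.comp_apply, faceMap_single, faceMap_single, faceMap_single]
    rfl

/-- The diagram of affine charts, indexed by the cones ordered by inclusion of faces. -/
def charts : F.cones ⥤ Scheme.{u} where
  obj S := Spec (CommRingCat.of (F.chartRing k S.1))
  map {S T} h := Spec.map (CommRingCat.ofHom (F.faceMap k (leOfHom h)))
  map_id S := by
    rw [← Spec.map_id]
    exact congrArg (fun f => Spec.map (CommRingCat.ofHom f)) (F.faceMap_refl k S.1)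
  map_comp {S T R} f g := by
    rw [← Spec.map_comp]
    exact congrArg (fun f => Spec.map (CommRingCat.ofHom f))
      (F.faceMap_comp k (leOfHom f) (leOfHom g)).symm

variable {F} in
lemma exists_face_element {S T : Finset ι} (hT : T ∈ F.cones) (h : S ⊆ T) :
    ∃ m : M, (∀ i ∈ S, F.ray i m = 0) ∧ ∀ i ∈ T, i ∉ S → F.ray i m = 1 := by
  classical
  choose! e he he' using F.smooth T hT
  refine ⟨∑ i ∈ T \ S, e i, fun i hi => ?_, fun i hi hi' => ?_⟩
  · rw [map_sum]
    refine Finset.sum_eq_zero fun j hj => he' j (Finset.mem_sdiff.1 hj).1 i (h hi) ?_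
    rintro rfl; exact (Finset.mem_sdiff.1 hj).2 hi
  · rw [map_sum, Finset.sum_eq_single i]
    · exact he i hi
    · intro j hj hji
      exact he' j (Finset.mem_sdiff.1 hj).1 i hi hji.symm
    · intro hn; exact absurd (Finset.mem_sdiff.2 ⟨hi, hi'⟩) hn

lemma faceMap_injective {S T : Finset ι} (h : S ⊆ T) :
    Function.Injective (F.faceMap k h) :=
  AddMonoidAlgebra.mapDomain_injective (AddSubmonoid.inclusion_injective _)

variable {F} in
lemma isLocalization_faceMap {S T : Finset ι} (h : S ⊆ T)
    {m : F.dualMonoid T} (hm0 : ∀ i ∈ S, F.ray i (m : M) = 0)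
    (hm1 : ∀ i ∈ T, i ∉ S → F.ray i (m : M) = 1) :
    letI := (F.faceMap k h).toAlgebra
    IsLocalization.Away (AddMonoidAlgebra.single m (1 : k)) (F.chartRing k S) := by
  let := (F.faceMap k h).toAlgebra
  have hpow : ∀ n : ℕ, (algebraMap (F.chartRing k T) (F.chartRing k S))
      (AddMonoidAlgebra.single m (1 : k)) ^ n = AddMonoidAlgebra.single
        (n • AddSubmonoid.inclusion (F.dualMonoid_anti h) m) (1 : k) := by
    intro n
    rw [RingHom.algebraMap_toAlgebra, faceMap_single, AddMonoidAlgebra.single_pow, one_pow]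
  refine IsLocalization.Away.mk _ ?_ ?_ ?_
  · refine IsUnit.of_mul_eq_one (AddMonoidAlgebra.single (⟨-(m : M), ?_⟩ : F.dualMonoid S) (1 : k)) ?_
    · intro i hi; rw [map_neg, hm0 i hi]; simp
    · rw [RingHom.algebraMap_toAlgebra, faceMap_single, AddMonoidAlgebra.single_mul_single,
        AddMonoidAlgebra.one_def]
      congr 1
      · ext; simp
      · simp
  · intro f
    induction f using AddMonoidAlgebra.induction_linear with
    | zero => exact ⟨0, 0, by simp⟩
    | add f g hf hg =>
      obtain ⟨n, a, ha⟩ := hf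
      obtain ⟨n', b, hb⟩ := hg
      refine ⟨n + n', a * (AddMonoidAlgebra.single m (1 : k)) ^ n' +
        b * (AddMonoidAlgebra.single m (1 : k)) ^ n, ?_⟩
      rw [map_add, map_mul, map_mul, ← ha, ← hb, map_pow, map_pow]
      ring
    | single u x =>
      refine ⟨∑ i ∈ T, (F.ray i (u : M)).natAbs, AddMonoidAlgebra.single
        (⟨(u : M) + (∑ i ∈ T, (F.ray i (u : M)).natAbs) • (m : M), ?_⟩ : F.dualMonoid T) x, ?_⟩
      · intro i hi
        rw [map_add, map_nsmul]
        by_cases hS : i ∈ S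
        · rw [hm0 i hS]; simpa using u.2 i hS
        · rw [hm1 i hi hS]
          have := Finset.single_le_sum (f := fun i => (F.ray i (u : M)).natAbs)
            (fun _ _ => Nat.zero_le _) hi
          simp only [nsmul_eq_mul, mul_one]
          have h2 : ((F.ray i (u : M)).natAbs : ℤ) ≤
            ((∑ i ∈ T, (F.ray i (u : M)).natAbs : ℕ) : ℤ) := by exact_mod_cast this
          have h3 : -(F.ray i (u : M)) ≤ ((F.ray i (u : M)).natAbs : ℤ) := by omega
          linarith
      · rw [hpow, RingHom.algebraMap_toAlgebra, faceMap_single, AddMonoidAlgebra.single_mul_single]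
        congr 1
        simp
  · intro a b hab
    exact ⟨0, by rw [faceMap_injective F k h hab]⟩

variable {F} in
lemma exists_faceElement' {S T : Finset ι} (hT : T ∈ F.cones) (h : S ⊆ T) :
    ∃ m : F.dualMonoid T, (∀ i ∈ S, F.ray i (m : M) = 0) ∧
      ∀ i ∈ T, i ∉ S → F.ray i (m : M) = 1 := by
  obtain ⟨m, hm0, hm1⟩ := exists_face_element hT h
  refine ⟨⟨m, fun i hi => ?_⟩, hm0, hm1⟩
  by_cases hS : i ∈ S
  · rw [hm0 i hS]
  · rw [hm1 i hi hS]; norm_num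

instance charts_isOpenImmersion {S T : F.cones} (h : S ⟶ T) :
    IsOpenImmersion ((F.charts k).map h) := by
  obtain ⟨m, hm0, hm1⟩ := exists_faceElement' T.2 (leOfHom h)
  let := (F.faceMap k (leOfHom h)).toAlgebra
  have := isLocalization_faceMap k (leOfHom h) hm0 hm1
  exact IsOpenImmersion.of_isLocalization (S := F.chartRing k S.1)
    (AddMonoidAlgebra.single m (1 : k))

variable {F} in
lemma range_faceMap {S T : Finset ι} (h : S ⊆ T)
    {m : F.dualMonoid T} (hm0 : ∀ i ∈ S, F.ray i (m : M) = 0)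
    (hm1 : ∀ i ∈ T, i ∉ S → F.ray i (m : M) = 1) (x : PrimeSpectrum (F.chartRing k T)) :
    x ∈ Set.range (PrimeSpectrum.comap (F.faceMap k h)) ↔
      AddMonoidAlgebra.single m (1 : k) ∉ x.asIdeal := by
  let := (F.faceMap k h).toAlgebra
  have := isLocalization_faceMap k h hm0 hm1
  have := PrimeSpectrum.localization_away_comap_range (F.chartRing k S)
    (AddMonoidAlgebra.single m (1 : k))
  rw [RingHom.algebraMap_toAlgebra] at this
  rw [this]; rfl

instance charts_isLocallyDirected : ((F.charts k) ⋙ Scheme.forget).IsLocallyDirected where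
  cond {S T R} f g x y hxy := by
    have hS : S.1 ⊆ R.1 := leOfHom f
    have hT : T.1 ⊆ R.1 := leOfHom g
    obtain ⟨m, hm0, hm1⟩ := exists_faceElement' R.2 hS
    obtain ⟨n, hn0, hn1⟩ := exists_faceElement' R.2 hT
    obtain ⟨p, hp0, hp1⟩ := exists_faceElement' R.2 (Finset.inter_subset_left.trans hS : S.1 ∩ T.1 ⊆ R.1)
    let P : F.cones := ⟨S.1 ∩ T.1, F.face_mem _ S.2 _ Finset.inter_subset_left⟩
    let fS : P ⟶ S := homOfLE Finset.inter_subset_left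
    let fT : P ⟶ T := homOfLE Finset.inter_subset_right
    let z : PrimeSpectrum (F.chartRing k R.1) := ((F.charts k).map f) x
    have hzS : AddMonoidAlgebra.single m (1 : k) ∉ z.asIdeal :=
      (range_faceMap k hS hm0 hm1 z).1 ⟨x, rfl⟩
    have hzT : AddMonoidAlgebra.single n (1 : k) ∉ z.asIdeal :=
      (range_faceMap k hT hn0 hn1 z).1 ⟨y, hxy.symm⟩
    have hzP : AddMonoidAlgebra.single p (1 : k) ∉ z.asIdeal := by
      intro hp
      have hle : (m : M) + n - p ∈ F.dualMonoid R.1 := by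
        intro i hi
        rw [map_sub, map_add]
        by_cases h1 : i ∈ S.1 <;> by_cases h2 : i ∈ T.1
        · rw [hm0 i h1, hn0 i h2, hp0 i (Finset.mem_inter.2 ⟨h1, h2⟩)]; norm_num
        · rw [hm0 i h1, hn1 i hi h2, hp1 i hi (by simp [h2])]; norm_num
        · rw [hm1 i hi h1, hn0 i h2, hp1 i hi (by simp [h1])]; norm_num
        · rw [hm1 i hi h1, hn1 i hi h2, hp1 i hi (by simp [h1])]; norm_num
      have hmul : AddMonoidAlgebra.single m (1 : k) * AddMonoidAlgebra.single n (1 : k) =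
          AddMonoidAlgebra.single p (1 : k) *
            AddMonoidAlgebra.single (⟨(m : M) + n - p, hle⟩ : F.dualMonoid R.1) (1 : k) := by
        rw [AddMonoidAlgebra.single_mul_single, AddMonoidAlgebra.single_mul_single]
        congr 1
        ext; simp
      have : AddMonoidAlgebra.single m (1 : k) * AddMonoidAlgebra.single n (1 : k) ∈ z.asIdeal := by
        rw [hmul]; exact Ideal.mul_mem_right _ _ hp
      exact (z.2.mem_or_mem this).elim hzS hzT
    obtain ⟨w, hw⟩ := (range_faceMap k (Finset.inter_subset_left.trans hS) hp0 hp1 z).2 hzP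
    let w' : (F.charts k).obj P := w
    refine ⟨P, fS, fT, w', ?_, ?_⟩
    · apply ((F.charts k).map f).isOpenEmbedding.injective
      have key : (F.charts k).map (fS ≫ f) w' = (F.charts k).map f x := hw
      rw [Functor.map_comp, Scheme.Hom.comp_apply] at key
      exact key
    · apply ((F.charts k).map g).isOpenEmbedding.injective
      have key : (F.charts k).map (fT ≫ g) w' = (F.charts k).map g y := hw.trans hxy
      rw [Functor.map_comp, Scheme.Hom.comp_apply] at key
      exact key

/-- The toric variety of the fan, glued from its affine charts. -/
def toricVariety : Scheme.{u} := colimit (F.charts k)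

/-- The open immersion of the chart of a cone. -/
def chartι (S : F.cones) : (F.charts k).obj S ⟶ F.toricVariety k :=
  colimit.ι (F.charts k) S

lemma map_chartι {S T : F.cones} (h : S ⟶ T) :
    (F.charts k).map h ≫ F.chartι k T = F.chartι k S :=
  colimit.w (F.charts k) h

instance chartι_isOpenImmersion (S : F.cones) : IsOpenImmersion (F.chartι k S) :=
  inferInstanceAs (IsOpenImmersion (colimit.ι (F.charts k) S))

end SmoothFan


/-- The morphism that restricts to `g i` on the open sets `U i` of a cover. -/
def glueOpens {X Y : Scheme.{u}} {ι : Type u} (U : ι → X.Opens) (hU : IsOpenCover U)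
    (g : ∀ i, (U i).toScheme ⟶ Y)
    (h : ∀ i j, X.homOfLE (inf_le_left : U i ⊓ U j ≤ U i) ≫ g i =
      X.homOfLE (inf_le_right : U i ⊓ U j ≤ U j) ≫ g j) : X ⟶ Y :=
  (X.openCoverOfIsOpenCover U hU).glueMorphisms g fun i j => by
    have e := isPullback_opens_inf (U i) (U j)
    have h1 : e.isoPullback.hom ≫ pullback.fst (U i).ι (U j).ι = X.homOfLE inf_le_left :=
      e.isoPullback_hom_fst
    have h2 : e.isoPullback.hom ≫ pullback.snd (U i).ι (U j).ι = X.homOfLE inf_le_right :=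
      e.isoPullback_hom_snd
    have h3 : pullback.fst (U i).ι (U j).ι ≫ g i = pullback.snd (U i).ι (U j).ι ≫ g j := by
      rw [← cancel_epi e.isoPullback.hom, ← Category.assoc, ← Category.assoc, h1, h2, h i j]
    exact h3

section ToProj

variable {A σ : Type u} [CommRing A] [SetLike σ A] [AddSubgroupClass σ A] (𝒜 : ℕ → σ)
  [GradedRing 𝒜] {X : Scheme.{u}} (f : A →+* Γ(X, ⊤))

/-- The morphism `D(f s) ⟶ D₊(s) ⊆ Proj 𝒜` for `s` homogeneous of positive degree. -/
def toProjLocal {d : ℕ} {s : A} (hd : 0 < d) (hs : s ∈ 𝒜 d) :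
    (X.basicOpen (f s)).toScheme ⟶ Proj 𝒜 :=
  Proj.toBasicOpenOfGlobalSections 𝒜 f rfl hd hs ≫ (Proj.basicOpen 𝒜 s).ι

lemma toProjLocal_compatible {d e : ℕ} {s t : A} (hd : 0 < d) (hs : s ∈ 𝒜 d) (he : 0 < e)
    (ht : t ∈ 𝒜 e) :
    X.homOfLE (inf_le_left : X.basicOpen (f s) ⊓ X.basicOpen (f t) ≤ _) ≫ toProjLocal 𝒜 f hd hs =
      X.homOfLE inf_le_right ≫ toProjLocal 𝒜 f he ht := by
  have h1 := Proj.homOfLE_toBasicOpenOfGlobalSections_ι 𝒜 f (H := rfl) (h0d := hd) (hd := hs)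
    (H' := rfl) (h0d' := Nat.add_pos_left hd e) (hd' := SetLike.mul_mem_graded hs ht)
    (s := t) rfl rfl ht
  have h2 := Proj.homOfLE_toBasicOpenOfGlobalSections_ι 𝒜 f (H := rfl) (h0d := he) (hd := ht)
    (H' := rfl) (h0d' := Nat.add_pos_left hd e) (hd' := SetLike.mul_mem_graded hs ht)
    (s := s) (mul_comm t s) (add_comm e d) hs
  have e : X.basicOpen (f (s * t)) = X.basicOpen (f s) ⊓ X.basicOpen (f t) := by
    rw [map_mul, Scheme.basicOpen_mul]
  rw [← cancel_epi (X.isoOfEq e).hom, Scheme.isoOfEq_hom, ← Category.assoc, ← Category.assoc,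
    Scheme.homOfLE_homOfLE, Scheme.homOfLE_homOfLE]
  exact h1.trans h2.symm

/-- For a ring homomorphism `f` from a graded ring `A` to the functions on `X`, such that `X` is
covered by the sets `D(f t)` with `t` homogeneous of positive degree: the morphism `X ⟶ Proj 𝒜`
that is the canonical one `D(f t) ⟶ D₊(t)` on each of them. -/
def toProj (hf : ∀ x : X, ∃ d, 0 < d ∧ ∃ t ∈ 𝒜 d, x ∈ X.basicOpen (f t)) : X ⟶ Proj 𝒜 :=
  glueOpens (fun i : {ds : ℕ × A // 0 < ds.1 ∧ ds.2 ∈ 𝒜 ds.1} => X.basicOpen (f i.1.2)) (by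
      rw [IsOpenCover, eq_top_iff]
      intro x _
      obtain ⟨d, hd, t, ht, hx⟩ := hf x
      exact Opens.mem_iSup.2 ⟨⟨(d, t), hd, ht⟩, hx⟩)
    (fun i => toProjLocal 𝒜 f i.2.1 i.2.2)
    (fun i j => toProjLocal_compatible 𝒜 f i.2.1 i.2.2 j.2.1 j.2.2)

end ToProj

/-! ### GIT quotients as Proj of a ring of semi-invariants -/

section GIT

open Polynomial

variable {k : Type u} [Field k] {R : Type u} [CommRing R] [Algebra k R]
  (𝒮 : ℕ → Submodule k R) [SetLike.GradedMonoid 𝒮]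

/-- For `𝒮 j` the space of functions of weight `j • ϑ` in `R`, the ring `⨁_j 𝒮 j`, realized as the
subring `⨁_j 𝒮 j · X^j` of `R[X]`. -/
def sectionRing : Subalgebra k R[X] where
  carrier := {p | ∀ j, p.coeff j ∈ 𝒮 j}
  add_mem' hp hq j := by rw [coeff_add]; exact add_mem (hp j) (hq j)
  mul_mem' {p q} hp hq j := by
    rw [coeff_mul]
    refine Submodule.sum_mem _ fun x hx => ?_
    rw [← Finset.HasAntidiagonal.mem_antidiagonal.1 hx]
    exact SetLike.mul_mem_graded (hp _) (hq _)
  algebraMap_mem' c j := by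
    rw [Polynomial.algebraMap_apply, coeff_C]
    split_ifs with h
    · subst h
      rw [Algebra.algebraMap_eq_smul_one]
      exact Submodule.smul_mem _ _ SetLike.GradedOne.one_mem
    · exact zero_mem _

/-- The piece `𝒮 j · X^j` of degree `j`. -/
def sectionGrading (j : ℕ) : Submodule k (sectionRing 𝒮) where
  carrier := {p | ∀ i, i ≠ j → p.1.coeff i = 0}
  add_mem' hp hq i hi := by
    change (_ + _ : R[X]).coeff i = 0
    rw [coeff_add, hp i hi, hq i hi, add_zero]
  zero_mem' i _ := coeff_zero i
  smul_mem' c p hp i hi := by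
    change (c • p.1 : R[X]).coeff i = 0
    rw [coeff_smul, hp i hi, smul_zero]

/-- The element `s · X^j`. -/
def sectionRing.monomial (j : ℕ) (s : 𝒮 j) : sectionRing 𝒮 :=
  ⟨Polynomial.monomial j s.1, fun i => by
    rw [coeff_monomial]
    split_ifs with h
    · exact h ▸ s.2
    · exact zero_mem _⟩

lemma sectionRing.monomial_mem (j : ℕ) (s : 𝒮 j) :
    sectionRing.monomial 𝒮 j s ∈ sectionGrading 𝒮 j := fun i hi => by
  change (Polynomial.monomial j s.1).coeff i = 0
  rw [coeff_monomial, if_neg hi.symm]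

instance sectionGrading.gradedMonoid : SetLike.GradedMonoid (sectionGrading 𝒮) where
  one_mem i hi := by
    change (1 : R[X]).coeff i = 0
    rw [coeff_one, if_neg hi]
  mul_mem {a b p q} hp hq i hi := by
    change (p.1 * q.1 : R[X]).coeff i = 0
    rw [coeff_mul]
    refine Finset.sum_eq_zero fun x hx => ?_
    by_cases h1 : x.1 = a
    · have h2 : x.2 ≠ b := by
        rintro rfl; exact hi (by rw [← h1, ← Finset.HasAntidiagonal.mem_antidiagonal.1 hx])
      rw [hq _ h2, mul_zero]
    · rw [hp _ h1, zero_mul]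

lemma sectionGrading.coeff_coe (x : DirectSum ℕ fun j => sectionGrading 𝒮 j) (j : ℕ) :
    (DirectSum.coeAddMonoidHom (sectionGrading 𝒮) x).1.coeff j = (x j).1.1.coeff j := by
  induction x using DirectSum.induction_on with
  | zero => simp
  | of i p =>
    rw [DirectSum.coeAddMonoidHom_of]
    by_cases h : i = j
    · subst h; rw [DirectSum.of_eq_same]
    · rw [DirectSum.of_eq_of_ne _ _ _ (Ne.symm h), p.2 j (Ne.symm h)]; simp
  | add x y hx hy =>
    rw [map_add, DirectSum.add_apply]
    change (_ + _ : R[X]).coeff j = (_ + _ : R[X]).coeff j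
    rw [coeff_add, coeff_add, hx, hy]

lemma sectionGrading.coe_injective :
    Function.Injective (DirectSum.coeAddMonoidHom (sectionGrading 𝒮)) := by
  intro x y hxy
  refine DFinsupp.ext fun j => Subtype.ext (Subtype.ext (Polynomial.ext fun i => ?_))
  by_cases hi : i = j
  · subst hi
    exact (coeff_coe 𝒮 x i).symm.trans ((congrArg (fun p => p.1.coeff i) hxy).trans
      (coeff_coe 𝒮 y i))
  · exact ((x j).2 i hi).trans ((y j).2 i hi).symm

/-- The decomposition of a polynomial into its monomials. -/
def sectionGrading.decomposeFun (p : sectionRing 𝒮) : DirectSum ℕ fun j => sectionGrading 𝒮 j :=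
  ∑ j ∈ p.1.support, DirectSum.of (fun j => sectionGrading 𝒮 j) j
    ⟨sectionRing.monomial 𝒮 j ⟨p.1.coeff j, p.2 j⟩, sectionRing.monomial_mem 𝒮 j _⟩

lemma sectionGrading.coe_decomposeFun (p : sectionRing 𝒮) :
    DirectSum.coeAddMonoidHom (sectionGrading 𝒮) (decomposeFun 𝒮 p) = p := by
  rw [decomposeFun, map_sum]
  simp only [DirectSum.coeAddMonoidHom_of]
  apply Subtype.ext
  rw [AddSubmonoidClass.coe_finsetSum]
  exact p.1.as_sum_support.symm

instance sectionGrading.decomposition : DirectSum.Decomposition (sectionGrading 𝒮) where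
  decompose' := decomposeFun 𝒮
  left_inv := coe_decomposeFun 𝒮
  right_inv _ := coe_injective 𝒮 (coe_decomposeFun 𝒮 _)

instance sectionGrading.gradedRing : GradedRing (sectionGrading 𝒮) where

/-- The GIT quotient `Spec R //_ϑ T = Proj (⨁_j 𝒮 j)`, where `𝒮 j` is the space of functions of
weight `j • ϑ`. -/
def gitQuotient : Scheme.{u} := Proj (sectionGrading 𝒮)

/-- The semistable locus of `Spec R`: the union of the `D(s)`, `s` of weight `j • ϑ` with `j > 0`. -/
def semistableLocus : (Spec (CommRingCat.of R)).Opens :=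
  ⨆ s : Σ' (j : ℕ) (s : R), 0 < j ∧ s ∈ 𝒮 j, PrimeSpectrum.basicOpen s.2.1

/-- The natural map `⨁_j 𝒮 j ⟶ R`. -/
def evalOne : sectionRing 𝒮 →+* R := (Polynomial.evalRingHom 1).comp (sectionRing 𝒮).val.toRingHom

/-- The elements of `⨁_j 𝒮 j` as functions on the semistable locus. -/
def gitFun : sectionRing 𝒮 →+* Γ((semistableLocus 𝒮).toScheme, ⊤) :=
  ((semistableLocus 𝒮).ι.appTop.hom.comp (Scheme.ΓSpecIso (CommRingCat.of R)).inv.hom).comp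
    (evalOne 𝒮)

lemma gitFun_cover (x : (semistableLocus 𝒮).toScheme) : ∃ d, 0 < d ∧ ∃ t ∈ sectionGrading 𝒮 d,
    x ∈ (semistableLocus 𝒮).toScheme.basicOpen (gitFun 𝒮 t) := by
  have hx : x.1 ∈ semistableLocus 𝒮 := x.2
  obtain ⟨⟨j, s, hj, hsj⟩, hs⟩ := Opens.mem_iSup.1 hx
  refine ⟨j, hj, sectionRing.monomial 𝒮 j ⟨s, hsj⟩, sectionRing.monomial_mem 𝒮 j _, ?_⟩
  have h1 : evalOne 𝒮 (sectionRing.monomial 𝒮 j ⟨s, hsj⟩) = s := by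
    change Polynomial.eval 1 (Polynomial.monomial j s) = s
    simp
  have h2 : gitFun 𝒮 (sectionRing.monomial 𝒮 j ⟨s, hsj⟩) = (semistableLocus 𝒮).ι.appTop.hom
      ((Scheme.ΓSpecIso (CommRingCat.of R)).inv.hom s) :=
    congrArg (fun z => (semistableLocus 𝒮).ι.appTop.hom
      ((Scheme.ΓSpecIso (CommRingCat.of R)).inv.hom z)) h1
  have h3 : (Scheme.ΓSpecIso (CommRingCat.of R)).hom
      ((Scheme.ΓSpecIso (CommRingCat.of R)).inv.hom s) = s := by simp
  rw [h2, ← Scheme.preimage_basicOpen_top]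
  change x.1 ∈ (Spec (CommRingCat.of R)).basicOpen ((Scheme.ΓSpecIso (CommRingCat.of R)).inv.hom s)
  rw [basicOpen_eq_of_affine', h3]
  exact hs

/-- The quotient map from the semistable locus to the GIT quotient. -/
def gitMap : (semistableLocus 𝒮).toScheme ⟶ gitQuotient 𝒮 :=
  toProj (sectionGrading 𝒮) (gitFun 𝒮) (gitFun_cover 𝒮)

variable (I : Ideal R)

/-- The images of the pieces `𝒮 j` in `R ⧸ I`. -/
def quotPieces (j : ℕ) : Submodule k (R ⧸ I) := (𝒮 j).map (Ideal.Quotient.mkₐ k I).toLinearMap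

instance quotPieces.gradedMonoid : SetLike.GradedMonoid (quotPieces 𝒮 I) where
  one_mem := ⟨1, SetLike.GradedOne.one_mem, map_one (Ideal.Quotient.mk I)⟩
  mul_mem := by
    rintro i j _ _ ⟨a, ha, rfl⟩ ⟨b, hb, rfl⟩
    exact ⟨a * b, SetLike.mul_mem_graded ha hb, map_mul (Ideal.Quotient.mk I) a b⟩

/-- Restriction of functions to the closed subscheme of `I`, as a map `⨁_j 𝒮 j ⟶ ⨁_j (R ⧸ I)_j`. -/
def restrictSections : sectionGrading 𝒮 →+*ᵍ sectionGrading (quotPieces 𝒮 I) where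
  toFun p := ⟨p.1.map (Ideal.Quotient.mk I), fun j => by
    rw [coeff_map]; exact ⟨p.1.coeff j, p.2 j, rfl⟩⟩
  map_one' := Subtype.ext (Polynomial.map_one _)
  map_zero' := Subtype.ext (Polynomial.map_zero _)
  map_mul' p q := Subtype.ext (Polynomial.map_mul _)
  map_add' p q := Subtype.ext (Polynomial.map_add _)
  map_mem {j p} hp i hi := by
    change (p.1.map (Ideal.Quotient.mk I)).coeff i = 0
    rw [coeff_map, hp i hi, map_zero]

lemma restrictSections_irrelevant :
    HomogeneousIdeal.irrelevant (sectionGrading (quotPieces 𝒮 I)) ≤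
      (HomogeneousIdeal.irrelevant (sectionGrading 𝒮)).map (restrictSections 𝒮 I) := by
  rw [HomogeneousIdeal.irrelevant_le]
  intro j hj p hp
  obtain ⟨s, hs, hsp⟩ := p.2 j
  have hps : p = restrictSections 𝒮 I (sectionRing.monomial 𝒮 j ⟨s, hs⟩) := by
    apply Subtype.ext
    change p.1 = (Polynomial.monomial j s).map (Ideal.Quotient.mk I)
    rw [Polynomial.map_monomial]
    ext i
    rw [coeff_monomial]
    split_ifs with h
    · subst h; exact hsp.symm
    · exact hp i (Ne.symm h)
  rw [hps]
  exact Ideal.mem_map_of_mem _ (HomogeneousIdeal.mem_irrelevant_of_mem _ hj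
    (sectionRing.monomial_mem 𝒮 j _))

/-- The morphism `𝕍(I) //_ϑ T ⟶ Spec R //_ϑ T` induced by the inclusion `𝕍(I) ⊆ Spec R`. -/
def gitClosed : gitQuotient (quotPieces 𝒮 I) ⟶ gitQuotient 𝒮 :=
  Proj.map (restrictSections 𝒮 I) (restrictSections_irrelevant 𝒮 I)

end GIT


/-! ### Subsheaves generated by local sections -/

section GeneratedSubsheaf

variable {X : Scheme.{u}} (N : X.Modules) (G : ∀ U : X.Opens, Set Γ(N, U))

/-- The span of the restrictions to `U` of the sections in `G V`, for `V ⊇ U`. -/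
def localSpan (U : X.Opens) : Submodule Γ(X, U) Γ(N, U) :=
  Submodule.span Γ(X, U) {s | ∃ (V : X.Opens) (h : U ≤ V), ∃ t ∈ G V,
    s = N.presheaf.map (homOfLE h).op t}

lemma localSpan_map {U V : X.Opens} (h : V ≤ U) {s : Γ(N, U)} (hs : s ∈ localSpan N G U) :
    N.presheaf.map (homOfLE h).op s ∈ localSpan N G V := by
  induction hs using Submodule.span_induction with
  | mem s hs =>
    obtain ⟨W, hW, t, ht, rfl⟩ := hs
    refine Submodule.subset_span ⟨W, h.trans hW, t, ht, ?_⟩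
    rw [← ConcreteCategory.comp_apply, ← Functor.map_comp]
    rfl
  | zero => rw [map_zero]; exact zero_mem _
  | add s t _ _ hs ht => rw [map_add]; exact add_mem hs ht
  | smul r s _ hs =>
    rw [Scheme.Modules.map_smul]
    exact Submodule.smul_mem _ _ hs

/-- The sections over `U` that belong locally to the span of the given sections. -/
def generatedSections (U : X.Opens) : Submodule Γ(X, U) Γ(N, U) where
  carrier := {s | ∀ x ∈ U, ∃ (V : X.Opens) (h : V ≤ U), x ∈ V ∧
    N.presheaf.map (homOfLE h).op s ∈ localSpan N G V}
  zero_mem' _ hx := ⟨U, le_rfl, hx, by rw [map_zero]; exact zero_mem _⟩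
  add_mem' {s t} hs ht x hx := by
    obtain ⟨V, hV, hxV, hs⟩ := hs x hx
    obtain ⟨W, hW, hxW, ht⟩ := ht x hx
    refine ⟨V ⊓ W, inf_le_left.trans hV, ⟨hxV, hxW⟩, ?_⟩
    rw [map_add]
    refine add_mem ?_ ?_
    · have := localSpan_map N G (inf_le_left : V ⊓ W ≤ V) hs
      rwa [← ConcreteCategory.comp_apply, ← Functor.map_comp] at this
    · have := localSpan_map N G (inf_le_right : V ⊓ W ≤ W) ht
      rwa [← ConcreteCategory.comp_apply, ← Functor.map_comp] at this
  smul_mem' r s hs x hx := by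
    obtain ⟨V, hV, hxV, hs⟩ := hs x hx
    refine ⟨V, hV, hxV, ?_⟩
    rw [Scheme.Modules.map_smul]
    exact Submodule.smul_mem _ _ hs

lemma generatedSections_map {U V : X.Opens} (i : V ⟶ U) {s : Γ(N, U)}
    (hs : s ∈ generatedSections N G U) : N.presheaf.map i.op s ∈ generatedSections N G V := by
  intro x hx
  obtain ⟨W, hW, hxW, hs⟩ := hs x (leOfHom i hx)
  refine ⟨V ⊓ W, inf_le_left, ⟨hx, hxW⟩, ?_⟩
  have := localSpan_map N G (inf_le_right : V ⊓ W ≤ W) hs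
  rw [← ConcreteCategory.comp_apply, ← Functor.map_comp] at this ⊢
  exact this

/-- The sections in `generatedSections` as a sub-presheaf of modules. -/
def generatedSubpresheaf : PresheafOfModules.Submodule N.val where
  obj U := generatedSections N G U.unop
  map f _ hs := generatedSections_map N G f.unop hs

lemma generatedSubpresheaf_isSheaf :
    TopCat.Presheaf.IsSheaf (X := X.toTopCat)
    (generatedSubpresheaf N G).toPresheafOfModules.presheaf := by
  rw [TopCat.Presheaf.isSheaf_iff_isSheafUniqueGluing]
  intro ι U sf hsf
  let sf' : ∀ i, Γ(N, U i) := fun i => (sf i).1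
  have hsf' : TopCat.Presheaf.IsCompatible N.presheaf U sf' := fun i j =>
    congrArg Subtype.val (hsf i j)
  obtain ⟨s, hs, hu⟩ := TopCat.Sheaf.existsUnique_gluing ⟨N.presheaf, N.isSheaf⟩ U sf' hsf'
  have hmem : s ∈ generatedSections N G (iSup U) := by
    intro x hx
    obtain ⟨i, hi⟩ := Opens.mem_iSup.1 hx
    obtain ⟨V, hV, hxV, h⟩ := (sf i).2 x hi
    refine ⟨V, hV.trans (le_iSup U i), hxV, ?_⟩
    have h1 : N.presheaf.map (Opens.leSupr U i).op s = sf' i := hs i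
    have h2 : N.presheaf.map (homOfLE hV).op (sf' i) ∈ localSpan N G V := h
    rw [← h1, ← ConcreteCategory.comp_apply, ← Functor.map_comp] at h2
    exact h2
  refine ⟨⟨s, hmem⟩, fun i => Subtype.ext (hs i), fun t ht => Subtype.ext ?_⟩
  exact hu t.1 fun i => congrArg Subtype.val (ht i)

/-- The subsheaf of `𝒪_X`-modules of `N` generated by the local sections in the sets `G U`. -/
def generatedSubsheaf : X.Modules :=
  SheafOfModules.mk (generatedSubpresheaf N G).toPresheafOfModules (generatedSubpresheaf_isSheaf N G)

end GeneratedSubsheaf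

/-- Restriction of an element of `R` to a function on an open subset of `Spec R`. -/
def restrictFun {R : Type u} [CommRing R] (U : (Spec (CommRingCat.of R)).Opens) :
    R →+* Γ(Spec (CommRingCat.of R), U) :=
  ((Spec (CommRingCat.of R)).presheaf.map (homOfLE le_top).op).hom.comp
    (Scheme.ΓSpecIso (CommRingCat.of R)).inv.hom

/-- The sheaf of `𝒪_Z`-modules `f_* 𝒪_Y`. -/
def functionsAlong {Y Z : Scheme.{u}} (f : Y ⟶ Z) : Z.Modules :=
  (Scheme.Modules.pushforward f).obj (SheafOfModules.unit Y.ringCatSheaf)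

/-- A function on `f⁻¹(U)` as a section of `f_* 𝒪_Y` over `U`. -/
def sectionAlong {Y Z : Scheme.{u}} (f : Y ⟶ Z) (U : Z.Opens) (s : Γ(Y, f ⁻¹ᵁ U)) :
    Γ(functionsAlong f, U) := s

/-! ### Divisors and the Cox construction -/

namespace SmoothFan

variable {M : Type} [AddCommGroup M] {ι : Type} [DecidableEq ι] (F : SmoothFan M ι)
  (k : Type u) [Field k]

/-- The character `χ^m` is a generator of `𝒪(D)` on the chart of the cone `S`, where `D` is the
torus-invariant divisor with coefficients `D i`: the divisor of `χ^m` is `-D` there. -/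
def IsLocalGenerator (D : ι → ℤ) (S : Finset ι) (m : M) : Prop :=
  ∀ i ∈ S, F.ray i m = -D i

/-- The open immersion of the torus `Spec k[M]`. -/
def torusι : Spec (CommRingCat.of (F.chartRing k ∅)) ⟶ F.toricVariety k :=
  F.chartι k ⟨∅, F.zero_mem⟩

/-- The character `χ^m` as a function on an open subset of the torus. -/
def character (m : M) (U : (Spec (CommRingCat.of (F.chartRing k ∅))).Opens) :
    Γ(Spec (CommRingCat.of (F.chartRing k ∅)), U) :=
  restrictFun U (AddMonoidAlgebra.single
    (⟨m, fun _ h => absurd h (Finset.notMem_empty _)⟩ : F.dualMonoid ∅) 1)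

/-- The line bundle `𝒪(D)` of a torus-invariant divisor with coefficients `D i`: the subsheaf of the
functions on the torus that is generated, on the chart of each cone `S`, by the character that
generates `𝒪(D)` there. -/
def lineBundle (D : ι → ℤ) : (F.toricVariety k).Modules :=
  generatedSubsheaf (functionsAlong (F.torusι k)) fun U =>
    {s | ∃ S : F.cones, U ≤ (F.chartι k S).opensRange ∧ ∃ m : M, F.IsLocalGenerator D S.1 m ∧
      s = sectionAlong (F.torusι k) U (F.character k m _)}

/-- The fan in `ℤ^{Σ(1)}` with the same combinatorics, whose rays are the coordinate rays. Its toric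
variety is the open subset of the affine space of the Cox ring where the quotient is formed. -/
def coxFan : SmoothFan (ι → ℤ) ι where
  ray i := Pi.evalAddMonoidHom (fun _ => ℤ) i
  cones := F.cones
  zero_mem := F.zero_mem
  face_mem := F.face_mem
  smooth S _ i _ := ⟨Pi.single i 1, by simp, fun j _ hji => by simp [hji]⟩

/-- The inclusion `M ⟶ ℤ^{Σ(1)}`, `m ↦ div(χ^m)`, on the semigroups of a cone. -/
def coxExponent (S : Finset ι) : F.dualMonoid S →+ F.coxFan.dualMonoid S where
  toFun m := ⟨fun i => F.ray i m, m.2⟩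
  map_zero' := by ext; simp
  map_add' m n := by ext; simp

lemma coxExponent_faceMap {S T : Finset ι} (h : S ⊆ T) :
    (F.coxFan.faceMap k h).comp (AddMonoidAlgebra.mapDomainRingHom k (F.coxExponent T)) =
      (AddMonoidAlgebra.mapDomainRingHom k (F.coxExponent S)).comp (F.faceMap k h) := by
  refine RingHom.ext fun f => ?_
  induction f using AddMonoidAlgebra.induction_linear with
  | zero => simp
  | add f g hf hg => rw [map_add, map_add, hf, hg]
  | single m x =>
    simp only [RingHom.comp_apply, faceMap_single, AddMonoidAlgebra.mapDomainRingHom_apply,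
      AddMonoidAlgebra.mapDomain_single]
    rfl

/-- The morphism of charts induced by `coxExponent`. -/
def coxChartHom (S : F.coxFan.cones) :
    (F.coxFan.charts k).obj S ⟶ (F.charts k).obj ⟨S.1, S.2⟩ :=
  Spec.map (CommRingCat.ofHom (AddMonoidAlgebra.mapDomainRingHom k (F.coxExponent S.1)))

/-- The quotient map `𝔸^{Σ(1)} ∖ V(B) ⟶ X` on the chart of a cone. -/
def coxChart (S : F.coxFan.cones) : (F.coxFan.charts k).obj S ⟶ F.toricVariety k :=
  F.coxChartHom k S ≫ F.chartι k ⟨S.1, S.2⟩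

lemma coxChart_naturality {S T : F.coxFan.cones} (h : S ⟶ T) :
    (F.coxFan.charts k).map h ≫ F.coxChart k T = F.coxChart k S := by
  have e : (F.coxFan.charts k).map h ≫ F.coxChartHom k T =
      F.coxChartHom k S ≫ (F.charts k).map (X := ⟨S.1, S.2⟩) (Y := ⟨T.1, T.2⟩)
        (homOfLE (leOfHom h)) := by
    refine (Spec.map_comp _ _).symm.trans (Eq.trans ?_ (Spec.map_comp _ _))
    exact congrArg (fun f => Spec.map (CommRingCat.ofHom f)) (F.coxExponent_faceMap k (leOfHom h))
  rw [coxChart, coxChart, ← Category.assoc, e, Category.assoc, map_chartι]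

/-- The quotient map `𝔸^{Σ(1)} ∖ V(B) ⟶ X` of the Cox construction. -/
def coxQuotient : F.coxFan.toricVariety k ⟶ F.toricVariety k :=
  colimit.desc (F.coxFan.charts k)
    { pt := F.toricVariety k
      ι :=
        { app := F.coxChart k
          naturality := fun _ _ h => (F.coxChart_naturality k h).trans (Category.comp_id _).symm } }

/-- The inclusion `k[x_i : i ∈ Σ(1)] ⟶ k[S^∨ ∩ ℤ^{Σ(1)}]`. -/
def coxInclusion (S : Finset ι) : MvPolynomial ι k →+* F.coxFan.chartRing k S :=
  MvPolynomial.eval₂Hom (algebraMap k (F.coxFan.chartRing k S)) fun i =>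
    AddMonoidAlgebra.single (⟨Pi.single i 1, fun j _ => by
      change (0 : ℤ) ≤ Pi.single (M := fun _ => ℤ) i 1 j
      by_cases h : j = i
      · subst h; simp
      · simp [h]⟩ : F.coxFan.dualMonoid S) 1

lemma faceMap_coxInclusion {S T : Finset ι} (h : S ⊆ T) :
    (F.coxFan.faceMap k h).comp (F.coxInclusion k T) = F.coxInclusion k S := by
  refine MvPolynomial.ringHom_ext (fun c => ?_) fun i => ?_
  · simp only [coxInclusion, RingHom.comp_apply, MvPolynomial.coe_eval₂Hom,
      MvPolynomial.eval₂_C, AddMonoidAlgebra.coe_algebraMap, Function.comp_apply]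
    exact F.coxFan.faceMap_single k h _ _
  · simp only [coxInclusion, RingHom.comp_apply, MvPolynomial.coe_eval₂Hom,
      MvPolynomial.eval₂_X]
    exact F.coxFan.faceMap_single k h _ _

/-- The inclusion `𝔸^{Σ(1)} ∖ V(B) ⟶ 𝔸^{Σ(1)}`. -/
def coxToAffine : F.coxFan.toricVariety k ⟶ Spec (CommRingCat.of (MvPolynomial ι k)) :=
  colimit.desc (F.coxFan.charts k)
    { pt := Spec (CommRingCat.of (MvPolynomial ι k))
      ι :=
        { app := fun S => Spec.map (CommRingCat.ofHom (F.coxInclusion k S.1))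
          naturality := fun _ _ h => by
            refine (Spec.map_comp _ _).symm.trans (Eq.trans ?_ (Category.comp_id _).symm)
            exact congrArg (fun f => Spec.map (CommRingCat.ofHom f))
              (F.faceMap_coxInclusion k (leOfHom h)) } }

end SmoothFan
/-! ### Hirzebruch-Jung continued fractions and the toric surface -/

/-- The Hirzebruch-Jung continued fraction `[b₁, …, bₙ] = b₁ - 1 / (b₂ - 1 / (⋯ - 1 / bₙ))`. -/
def hjFraction : List ℚ → ℚ
  | [] => 0
  | [b] => b
  | b :: b' :: l => b - 1 / hjFraction (b' :: l)

/-- The type `1/r(1,a)` of a cyclic quotient singularity of dimension two, `0 < a < r` and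
`gcd(a, r) = 1`, together with the entries `c 1, …, c ℓ ≥ 2` of its Hirzebruch-Jung continued
fraction `r / a = [c ℓ, …, c 1]`. -/
structure CyclicType where
  r : ℕ
  a : ℕ
  a_pos : 0 < a
  a_lt : a < r
  coprime : Nat.Coprime a r
  ℓ : ℕ
  c : ℕ → ℕ
  two_le_c : ∀ i, 1 ≤ i → i ≤ ℓ → 2 ≤ c i
  fraction : (r : ℚ) / a = hjFraction ((List.range ℓ).map fun j => (c (ℓ - j) : ℚ))

namespace CyclicType

variable (τ : CyclicType)

/-- The pairs `(β_i, α_i)`, listed from the last one: `pairFromTop n = (β_{ℓ+1-n}, α_{ℓ+1-n})`.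
They satisfy `(β_{ℓ+1}, α_{ℓ+1}) = (0, r)`, `(β_ℓ, α_ℓ) = (1, a)` and
`(β_{i-1}, α_{i-1}) = c_i (β_i, α_i) - (β_{i+1}, α_{i+1})`. -/
def pairFromTop : ℕ → ℤ × ℤ
  | 0 => (0, τ.r)
  | 1 => (1, τ.a)
  | n + 2 => (τ.c (τ.ℓ - n) : ℤ) • pairFromTop (n + 1) - pairFromTop n

/-- The integer `β_i` for `0 ≤ i ≤ ℓ + 1`. -/
def β (i : ℕ) : ℤ := (τ.pairFromTop (τ.ℓ + 1 - i)).1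

/-- The integer `α_i` for `0 ≤ i ≤ ℓ + 1`. -/
def α (i : ℕ) : ℤ := (τ.pairFromTop (τ.ℓ + 1 - i)).2

/-- The lattice `M` of exponents `(u, w)` of the Laurent monomials `x^u y^w` invariant under the
cyclic group of type `1/r(1,a)`; it is dual to `N = ℤ² + ℤ · (1/r)(1, a)`. -/
def M : AddSubgroup (ℤ × ℤ) where
  carrier := {m | (τ.r : ℤ) ∣ m.1 + τ.a * m.2}
  zero_mem' := by simp
  add_mem' {m n} hm hn := by
    have h := dvd_add hm hn
    change (τ.r : ℤ) ∣ (m.1 + n.1) + τ.a * (m.2 + n.2)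
    rwa [show (m.1 + n.1) + τ.a * (m.2 + n.2) = m.1 + τ.a * m.2 + (n.1 + τ.a * n.2) by ring]
  neg_mem' {m} hm := by
    have h := (dvd_neg (α := ℤ)).2 hm
    change (τ.r : ℤ) ∣ -m.1 + τ.a * -m.2
    rwa [show -m.1 + τ.a * -m.2 = -(m.1 + τ.a * m.2) by ring]

lemma r_pos : (0 : ℤ) < τ.r := by exact_mod_cast τ.a_pos.trans τ.a_lt

lemma dvd_pairFromTop (n : ℕ) :
    (τ.r : ℤ) ∣ (τ.pairFromTop n).2 - τ.a * (τ.pairFromTop n).1 := by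
  induction n using Nat.twoStepInduction with
  | zero => simp [pairFromTop]
  | one => simp [pairFromTop]
  | more n h0 h1 =>
    have h := dvd_sub (h1.mul_left (τ.c (τ.ℓ - n) : ℤ)) h0
    simp only [pairFromTop, Prod.snd_sub, Prod.fst_sub, Prod.smul_snd, Prod.smul_fst, smul_eq_mul]
    refine h.trans (dvd_of_eq ?_)
    ring

lemma det_pairFromTop (n : ℕ) :
    (τ.pairFromTop (n + 1)).1 * (τ.pairFromTop n).2 -
      (τ.pairFromTop n).1 * (τ.pairFromTop (n + 1)).2 = τ.r := by
  induction n with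
  | zero => simp [pairFromTop]
  | succ n ih =>
    rw [← ih]
    simp only [pairFromTop, Prod.snd_sub, Prod.fst_sub, Prod.smul_snd, Prod.smul_fst, smul_eq_mul]
    ring

lemma dvd_pairing (i : ℕ) (m : τ.M) : (τ.r : ℤ) ∣ τ.β i * m.1.1 + τ.α i * m.1.2 := by
  have h1 := (τ.dvd_pairFromTop (τ.ℓ + 1 - i)).mul_right m.1.2
  have h2 : (τ.r : ℤ) ∣ τ.β i * (m.1.1 + τ.a * m.1.2) := Dvd.dvd.mul_left m.2 _
  refine (dvd_add h1 h2).trans (dvd_of_eq ?_)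
  unfold β α
  ring

/-- Pairing with the primitive generator `(1/r)(β_i, α_i) ∈ N` of the ray `τ_i`. -/
def rayPairing (i : ℕ) : τ.M →+ ℤ where
  toFun m := (τ.β i * m.1.1 + τ.α i * m.1.2) / τ.r
  map_zero' := by simp
  map_add' m n := by
    rw [← Int.add_ediv_of_dvd_left (τ.dvd_pairing i m)]
    congr 1
    change τ.β i * (m.1.1 + n.1.1) + τ.α i * (m.1.2 + n.1.2) = _
    ring

lemma rayPairing_eq {i : ℕ} {m : τ.M} {d : ℤ} (h : τ.β i * m.1.1 + τ.α i * m.1.2 = d * τ.r) :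
    τ.rayPairing i m = d := by
  change (τ.β i * m.1.1 + τ.α i * m.1.2) / (τ.r : ℤ) = d
  rw [h, Int.mul_ediv_cancel _ τ.r_pos.ne']

lemma det_eq {i : ℕ} (hi : i ≤ τ.ℓ) : τ.β i * τ.α (i + 1) - τ.β (i + 1) * τ.α i = τ.r := by
  have := τ.det_pairFromTop (τ.ℓ - i)
  have e1 : τ.ℓ + 1 - i = τ.ℓ - i + 1 := by omega
  have e2 : τ.ℓ + 1 - (i + 1) = τ.ℓ - i := by omega
  rw [β, α, β, α, e1, e2]
  exact this

/-- The element `(α_i, -β_i)` of `M`, i.e. the invariant Laurent monomial `x^{α_i} / y^{β_i}`. -/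
def ratio (i : ℕ) : τ.M :=
  ⟨(τ.α i, -τ.β i), by
    refine (τ.dvd_pairFromTop (τ.ℓ + 1 - i)).trans (dvd_of_eq ?_)
    change _ = τ.α i + τ.a * -τ.β i
    unfold β α
    ring⟩

/-- The maximal cone `σ_j`, spanned by the rays `τ_j` and `τ_{j+1}`. -/
def maxCone (j : Fin (τ.ℓ + 1)) : Finset (Fin (τ.ℓ + 2)) := {j.castSucc, j.succ}

/-- The fan with rays `τ_0, …, τ_{ℓ+1}` and maximal cones `σ_0, …, σ_ℓ`. -/
def fan : SmoothFan τ.M (Fin (τ.ℓ + 2)) where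
  ray i := τ.rayPairing i
  cones := {S | ∃ j, S ⊆ τ.maxCone j}
  zero_mem := ⟨0, Finset.empty_subset _⟩
  face_mem := fun _ ⟨j, hj⟩ _ hT => ⟨j, hT.trans hj⟩
  smooth := by
    rintro S ⟨j, hj⟩ i hi
    have hdet := τ.det_eq (Nat.lt_succ_iff.1 j.2)
    have hmem : ∀ i ∈ S, i = j.castSucc ∨ i = j.succ := fun i hi => by
      simpa [maxCone] using hj hi
    rcases hmem i hi with rfl | rfl
    · refine ⟨τ.ratio (j + 1), τ.rayPairing_eq ?_, fun i' hi' hne => ?_⟩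
      · simp only [ratio, Fin.val_castSucc]
        linear_combination hdet
      · rcases hmem i' hi' with rfl | rfl
        · exact absurd rfl hne
        · refine τ.rayPairing_eq ?_
          simp only [ratio, Fin.val_succ]
          ring
    · refine ⟨-τ.ratio j, τ.rayPairing_eq ?_, fun i' hi' hne => ?_⟩
      · simp only [ratio, Fin.val_succ, AddSubgroup.coe_neg, Prod.fst_neg, Prod.snd_neg]
        linear_combination hdet
      · rcases hmem i' hi' with rfl | rfl
        · refine τ.rayPairing_eq ?_
          simp only [ratio, Fin.val_castSucc, AddSubgroup.coe_neg, Prod.fst_neg, Prod.snd_neg]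
          ring
        · exact absurd rfl hne

/-- The line bundle `𝒪(D)`, restricted to the exceptional curve `D_{j+1} ≅ ℙ¹`, `0 ≤ j < ℓ`, has
degree `d`. The curve is covered by the two charts of `σ_j` and `σ_{j+1}` and has homogeneous
coordinates `[x^{α_{j+1}} : y^{β_{j+1}}]`; a line bundle on it has degree `d` if the quotient of
its local generators is the `d`-th power of the quotient of the coordinates. -/
def HasDegree (D : Fin (τ.ℓ + 2) → ℤ) (j : Fin τ.ℓ) (d : ℤ) : Prop :=
  ∀ m m' : τ.M, τ.fan.IsLocalGenerator D (τ.maxCone j.castSucc) m →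
    τ.fan.IsLocalGenerator D (τ.maxCone j.succ) m' → m' - m = d • τ.ratio (j + 1)

end CyclicType

/-! ### Sheaves on a quotient -/

section GITModule

variable {k : Type u} [Field k] {R : Type u} [CommRing R] [Algebra k R]
  (𝒮 : ℕ → Submodule k R) [SetLike.GradedMonoid 𝒮] (𝒯 : ℕ → Submodule k R)

/-- An element of `R` as a function on an open subset of the semistable locus. -/
def semistableFun (U : (semistableLocus 𝒮).toScheme.Opens) :
    R →+* Γ((semistableLocus 𝒮).toScheme, U) :=
  (((semistableLocus 𝒮).toScheme.presheaf.map (homOfLE le_top).op).hom.comp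
    (semistableLocus 𝒮).ι.appTop.hom).comp (Scheme.ΓSpecIso (CommRingCat.of R)).inv.hom

/-- The sheaf on `gitQuotient 𝒮` to which the trivial line bundle, with the linearization given by
a character `χ` of the torus, descends. Here `𝒮 n` is the space of functions of weight `n • ϑ` and
`𝒯 n` the space of functions of weight `χ + n • ϑ`, so that the sections over `U` are the functions
of weight `χ` on the preimage of `U`: locally these are fractions `g / f` with `g ∈ 𝒯 n` and
`f ∈ 𝒮 n` invertible. -/
def gitModule : (gitQuotient 𝒮).Modules :=
  generatedSubsheaf (functionsAlong (gitMap 𝒮)) fun U =>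
    {s | ∃ s' : Γ((semistableLocus 𝒮).toScheme, gitMap 𝒮 ⁻¹ᵁ U), s = sectionAlong (gitMap 𝒮) U s' ∧
      ∃ n, ∃ f ∈ 𝒮 n, ∃ g ∈ 𝒯 n, IsUnit (semistableFun 𝒮 (gitMap 𝒮 ⁻¹ᵁ U) f) ∧
        semistableFun 𝒮 (gitMap 𝒮 ⁻¹ᵁ U) f * s' = semistableFun 𝒮 (gitMap 𝒮 ⁻¹ᵁ U) g}

end GITModule

/-! ### Quivers of sections and multigraded linear series -/

namespace SmoothFan

variable {M : Type} [AddCommGroup M] {ι : Type} [DecidableEq ι] (F : SmoothFan M ι)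

/-- `n` is the divisor of zeroes of a torus-invariant section of `𝒪(E - D)`, that is, of a
character `χ^m` with `div(χ^m) + E - D = n` effective. -/
def IsSection (D E : ι → ℤ) (n : ι → ℕ) : Prop :=
  ∃ m : M, ∀ i, (n i : ℤ) = F.ray i m + E i - D i

variable {l : ℕ} (L : Fin (l + 1) → ι → ℤ)

/-- `n` is the divisor of an irreducible torus-invariant section of `𝒪(L j) ⊗ 𝒪(L i)⁻¹`: it is not
an identity map, and it is not the composite of two torus-invariant sections
`𝒪(L i) ⟶ 𝒪(L v) ⟶ 𝒪(L j)` other than identity maps. -/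
structure IsIrreducibleSection (i j : Fin (l + 1)) (n : ι → ℕ) : Prop where
  isSection : F.IsSection (L i) (L j) n
  ne_zero : n ≠ 0
  eq_zero_or_eq_zero : ∀ (v : Fin (l + 1)) (n₁ n₂ : ι → ℕ), F.IsSection (L i) (L v) n₁ →
    F.IsSection (L v) (L j) n₂ → n₁ + n₂ = n → n₁ = 0 ∨ n₂ = 0

/-- The arrows of the quiver of sections of the line bundles `𝒪(L 0), …, 𝒪(L l)`; the vertices are
the elements of `Fin (l + 1)`. -/
structure Arrow where
  tail : Fin (l + 1)
  head : Fin (l + 1)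
  div : ι → ℕ
  irreducible : F.IsIrreducibleSection L tail head div

/-- The incidence `χ_{head a} - χ_{tail a}`, the weight of the variable `y_a`. -/
def inc (a : F.Arrow L) : Fin (l + 1) → ℤ :=
  Pi.single a.head 1 - Pi.single a.tail 1

/-- The weight `ϑ = (-l, 1, …, 1)`. -/
def theta (l : ℕ) (i : Fin (l + 1)) : ℤ := if i = 0 then -l else 1

variable (k : Type u) [Field k]

/-- The graded piece of `k[y_a : a ∈ Q₁]` of weight `w`. -/
def weightPiece (w : Fin (l + 1) → ℤ) : Submodule k (MvPolynomial (F.Arrow L) k) :=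
  MvPolynomial.weightedHomogeneousSubmodule k (F.inc L) w

/-- The graded pieces of `k[y_a : a ∈ Q₁]` of weights `0, ϑ, 2ϑ, …`. -/
def thetaPieces (j : ℕ) : Submodule k (MvPolynomial (F.Arrow L) k) :=
  F.weightPiece L k (j • theta l)

instance thetaPieces_gradedMonoid : SetLike.GradedMonoid (F.thetaPieces L k) where
  one_mem := by
    rw [thetaPieces, zero_smul]
    exact MvPolynomial.isWeightedHomogeneous_one k _
  mul_mem {i j p q} hp hq := by
    rw [thetaPieces, add_smul]
    exact MvPolynomial.IsWeightedHomogeneous.mul hp hq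

/-- The multigraded linear series `|L| = 𝔸^{Q₁} //_ϑ T_Q`. -/
def linearSeries : Scheme.{u} := gitQuotient (F.thetaPieces L k)

/-- The tautological line bundle `W_i` on `|L|`: the descent of the trivial bundle of
weight `χ_i - χ_0`. -/
def tautologicalBundle (i : Fin (l + 1)) : (F.linearSeries L k).Modules :=
  gitModule (F.thetaPieces L k) fun n =>
    F.weightPiece L k (Pi.single i 1 - Pi.single 0 1 + n • theta l)

/-- The toric ideal `I_Q`, spanned by the `y^u - y^v` with `inc(u) = inc(v)` and
`div(u) = div(v)`. -/
def toricIdeal : Ideal (MvPolynomial (F.Arrow L) k) :=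
  Ideal.span {p | ∃ u v : F.Arrow L →₀ ℕ,
    (u.sum fun a n => n • F.inc L a) = (v.sum fun a n => n • F.inc L a) ∧
    (u.sum fun a n => n • a.div) = (v.sum fun a n => n • a.div) ∧
    p = MvPolynomial.monomial u 1 - MvPolynomial.monomial v 1}

/-- The quotient `𝕍(I_Q) //_ϑ T_Q = Proj ⨁_j (k[y_a : a ∈ Q₁] / I_Q)_{jϑ}`. -/
def toricImage : Scheme.{u} := gitQuotient (quotPieces (F.thetaPieces L k) (F.toricIdeal L k))

/-- The morphism `𝕍(I_Q) //_ϑ T_Q ⟶ 𝔸^{Q₁} //_ϑ T_Q` induced by `𝕍(I_Q) ⊆ 𝔸^{Q₁}`. -/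
def toricImageι : F.toricImage L k ⟶ F.linearSeries L k :=
  gitClosed (F.thetaPieces L k) (F.toricIdeal L k)

/-- The ring homomorphism `Φ_Q : k[y_a : a ∈ Q₁] ⟶ k[x_i : i ∈ Σ(1)]`, `y_a ↦ x^{div(a)}`. -/
def labelMap [Fintype ι] : MvPolynomial (F.Arrow L) k →+* MvPolynomial ι k :=
  (MvPolynomial.aeval fun a : F.Arrow L =>
    ∏ i, (MvPolynomial.X i : MvPolynomial ι k) ^ a.div i).toRingHom

/-- `φ : X ⟶ |L|` is the descent of `(Φ_Q)^* : 𝔸^{Σ(1)} ⟶ 𝔸^{Q₁}`: the latter maps the open set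
`𝔸^{Σ(1)} ∖ V(B)`, whose quotient is `X`, to the semistable locus of `𝔸^{Q₁}`, whose quotient
is `|L|`, and `φ` is the induced morphism of the quotients. -/
def IsDescent [Fintype ι] (φ : F.toricVariety k ⟶ F.linearSeries L k) : Prop :=
  ∃ Φ : F.coxFan.toricVariety k ⟶ (semistableLocus (F.thetaPieces L k)).toScheme,
    Φ ≫ (semistableLocus (F.thetaPieces L k)).ι =
      F.coxToAffine k ≫ Spec.map (CommRingCat.ofHom (F.labelMap L k)) ∧
    Φ ≫ gitMap (F.thetaPieces L k) = F.coxQuotient k ≫ φ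

end SmoothFan

end SpecialMcKay

end

/-! On the chart of a maximal cone σ_j each L_i is generated by one torus-invariant section. Every
section is a composite of arrows, so this one is the label of a path from 0 to i. The product over i
of these path monomials, the tree of σ_j, has weight ϑ = Σ (χ_i − χ_0), and its divisor is supported
exactly on the rays outside σ_j. These facts and two factorization properties form the structure
`ChartData`. Everything geometric is derived from it for an arbitrary smooth fan, and
`CyclicType.chartData` provides it for the surface.

The isomorphism X ≅ 𝕍(I_Q)//T is local on the target. Trivializing the L_i by local generators turns
y^u into a character of the chart. Another trivialization rescales degree n by the n-th power of a
unit, which does not affect maps to Proj (`specToProj_twist`), so the chart maps glue. On D₊(tree)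
the map is an isomorphism of coordinate rings (`bijective_awayLift`). It is injective because in
fixed weight the character determines the divisor, hence the class modulo I_Q. It is surjective
because every regular character of the chart is a semi-invariant divided by a power of the tree.
Each chart is the whole preimage of its D₊(tree) (`range_chartι`), and these open sets cover because
some power of every semi-invariant monomial of positive degree is divisible by a tree modulo I_Q
(`iSup_imageOpen`). The map 𝕍(I_Q)//T → |L| is a closed immersion, being induced by a degreewise
surjection.

The same rescaling shows that the result is the descent of Φ_Q^*. The Cox quotient has a section
over each maximal chart, which gives uniqueness (`cancel_coxQuotient`). For φ^* W_i ≅ L_i, the path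
monomials are local frames of W_i and pull back to local frames of L_i; `LocalFrames` then verifies
the universal property of the pullback.

For the surface, the continued fraction makes α increase from 0 and β decrease to 0, which fixes the
signs of all pairings of rays with the monomials x^{α_i}/y^{β_i}. Crossing D_l changes the local
generator of L_l by such a monomial, and no other curve changes it (`exists_eq_order`). The
generators of ⊗L_i on the σ_j are thus the successive corners of a Newton polygon. Locating the
x-exponent of a monomial between two adjacent corners gives the divisibility by a tree
(`exists_corner_decomposition`). -/

noncomputable section

namespace SpecialMcKay

/-! ### Ring-valued points of Proj -/

section SpecToProj

open HomogeneousLocalization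

variable {A σ : Type u} [CommRing A] [SetLike σ A] [AddSubgroupClass σ A] (𝒜 : ℕ → σ)
  [GradedRing 𝒜] {B C : Type u} [CommRing B] [CommRing C]

/-- The extension of `f` to the degree zero part of `A_t`, if `f t` is a unit. -/
def awayLift (f : A →+* B) {t : A} (hu : IsUnit (f t)) : Away 𝒜 t →+* B :=
  (Localization.awayLift f t hu).comp (algebraMap (Away 𝒜 t) (Localization.Away t))

/-- This identity characterizes `awayLift` (see `awayLift_ext`), so that maps out of the degree zero
localization are compared without denominators. -/
lemma pow_mul_awayLift_mk (f : A →+* B) {t : A} (hu : IsUnit (f t)) {d : ℕ} (ht : t ∈ 𝒜 d)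
    (n : ℕ) (x : A) (hx : x ∈ 𝒜 (n • d)) :
    f t ^ n * awayLift 𝒜 f hu (Away.mk 𝒜 ht n x hx) = f x := by
  have h : algebraMap A (Localization.Away t) t ^ n * (Away.mk 𝒜 ht n x hx).val =
      algebraMap A (Localization.Away t) x := by
    rw [Away.val_mk, Localization.mk_eq_mk', ← map_pow]
    exact IsLocalization.mk'_spec' _ x (⟨t ^ n, n, rfl⟩ : Submonoid.powers t)
  have h2 := congrArg (Localization.awayLift f t hu) h
  rw [map_mul, map_pow] at h2
  simpa [awayLift, Localization.awayLift, IsLocalization.Away.lift_eq] using h2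

lemma awayLift_ext {f : A →+* B} {t : A} {hu : IsUnit (f t)} {d : ℕ} (ht : t ∈ 𝒜 d)
    {g : Away 𝒜 t →+* B}
    (h : ∀ n x (hx : x ∈ 𝒜 (n • d)), f t ^ n * g (Away.mk 𝒜 ht n x hx) = f x) :
    g = awayLift 𝒜 f hu := by
  ext z
  obtain ⟨n, x, hx, rfl⟩ := Away.mk_surjective 𝒜 ht z
  exact (hu.pow n).mul_left_cancel ((h n x hx).trans (pow_mul_awayLift_mk 𝒜 f hu ht n x hx).symm)

lemma awayLift_comp_awayMap (f : A →+* B) {t s : A} (hu : IsUnit (f t))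
    (hus : IsUnit (f (t * s))) {d e : ℕ} (ht : t ∈ 𝒜 d) (hs : s ∈ 𝒜 e) :
    (awayLift 𝒜 f hus).comp (awayMap 𝒜 hs rfl) = awayLift 𝒜 f hu := by
  refine awayLift_ext 𝒜 ht fun n x hx => ?_
  rw [RingHom.comp_apply, awayMap_mk]
  have h := pow_mul_awayLift_mk 𝒜 f hus (SetLike.mul_mem_graded ht hs) n (x * s ^ n) (by
    rw [smul_add]; exact SetLike.mul_mem_graded hx (SetLike.pow_mem_graded n hs))
  have hs' : IsUnit (f s ^ n) := by
    rw [map_mul] at hus; exact (isUnit_of_mul_isUnit_right hus).pow n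
  rw [map_mul, mul_pow, map_mul, map_pow] at h
  refine hs'.mul_left_cancel ?_
  rw [← mul_assoc, mul_comm (f s ^ n) (f t ^ n), h, mul_comm]

/-- The morphism `Spec B ⟶ D₊(t) ⊆ Proj 𝒜` given by a ring homomorphism `f : A ⟶ B` such
that `f t` is a unit. -/
def specToProj (f : A →+* B) {t : A} {d : ℕ} (hd : 0 < d) (ht : t ∈ 𝒜 d) (hu : IsUnit (f t)) :
    Spec (CommRingCat.of B) ⟶ Proj 𝒜 :=
  Spec.map (CommRingCat.ofHom (awayLift 𝒜 f hu)) ≫ Proj.awayι 𝒜 t ht hd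

lemma specToProj_mul (f : A →+* B) {t s : A} {d e : ℕ} (hd : 0 < d) (ht : t ∈ 𝒜 d)
    (hu : IsUnit (f t)) (hs : s ∈ 𝒜 e) (hus : IsUnit (f (t * s))) :
    specToProj 𝒜 f (hd.trans_le (d.le_add_right e)) (SetLike.mul_mem_graded ht hs) hus =
      specToProj 𝒜 f hd ht hu := by
  rw [specToProj, specToProj, ← awayLift_comp_awayMap 𝒜 f hu hus ht hs, CommRingCat.ofHom_comp,
    Spec.map_comp, Category.assoc, Proj.SpecMap_awayMap_awayι]

lemma specToProj_congr_elem (f : A →+* B) {t : A} {d : ℕ} {hd : 0 < d} {ht : t ∈ 𝒜 d}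
    {hu : IsUnit (f t)} {t' : A} {d' : ℕ} (h : t = t') (hd' : d = d') :
    specToProj 𝒜 f hd ht hu = specToProj 𝒜 f (hd' ▸ hd) (h ▸ hd' ▸ ht : t' ∈ 𝒜 d') (h ▸ hu) := by
  subst h hd'; rfl

/-- Both morphisms land in D₊(ts), where each agrees with the morphism built from the product. -/
lemma specToProj_independent (f : A →+* B) {t s : A} {d e : ℕ} (hd : 0 < d) (ht : t ∈ 𝒜 d)
    (hu : IsUnit (f t)) (he : 0 < e) (hs : s ∈ 𝒜 e) (hus : IsUnit (f s)) :
    specToProj 𝒜 f hd ht hu = specToProj 𝒜 f he hs hus := by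
  have h : IsUnit (f (t * s)) := by rw [map_mul]; exact hu.mul hus
  have h' : IsUnit (f (s * t)) := by rw [map_mul]; exact hus.mul hu
  rw [← specToProj_mul 𝒜 f hd ht hu hs h, ← specToProj_mul 𝒜 f he hs hus ht h']
  exact specToProj_congr_elem 𝒜 f (mul_comm t s) (add_comm d e)

/-- Rescaling `f` by `w ^ n` in degree `n` does not change the morphism to Proj. -/
lemma specToProj_twist {f g : A →+* B} (w : Bˣ) (hfg : ∀ n, ∀ x ∈ 𝒜 n, g x = (w : B) ^ n * f x)
    {t s : A} {d e : ℕ} (hd : 0 < d) (ht : t ∈ 𝒜 d) (hu : IsUnit (f t)) (he : 0 < e)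
    (hs : s ∈ 𝒜 e) (hus : IsUnit (g s)) :
    specToProj 𝒜 f hd ht hu = specToProj 𝒜 g he hs hus := by
  have hg : IsUnit (g t) := by rw [hfg d t ht]; exact (w.isUnit.pow d).mul hu
  rw [← specToProj_independent 𝒜 g hd ht hg he hs hus, specToProj, specToProj]
  congr 3
  -- The power of w cancels: t ^ n and x have the same degree n * d.
  refine awayLift_ext 𝒜 ht fun n x hx => ?_
  have h1 := pow_mul_awayLift_mk 𝒜 f hu ht n x hx
  rw [hfg _ x hx, hfg d t ht, ← h1]
  simp only [smul_eq_mul, mul_pow, ← pow_mul]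
  ring

lemma specMap_specToProj (f : A →+* B) {t : A} {d : ℕ} (hd : 0 < d) (ht : t ∈ 𝒜 d)
    (hu : IsUnit (f t)) (g : B →+* C) :
    Spec.map (CommRingCat.ofHom g) ≫ specToProj 𝒜 f hd ht hu =
      specToProj 𝒜 (g.comp f) hd ht (hu.map g) := by
  rw [specToProj, specToProj, ← Category.assoc, ← Spec.map_comp, ← CommRingCat.ofHom_comp]
  congr 3
  refine awayLift_ext 𝒜 ht fun n x hx => ?_
  rw [RingHom.comp_apply, RingHom.comp_apply, RingHom.comp_apply, ← map_pow, ← map_mul,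
    pow_mul_awayLift_mk]

lemma specToProj_map {A' σ' : Type u} [CommRing A'] [SetLike σ' A'] [AddSubgroupClass σ' A']
    {𝒜' : ℕ → σ'} [GradedRing 𝒜'] (ψ : 𝒜' →+*ᵍ 𝒜)
    (hψ : HomogeneousIdeal.irrelevant 𝒜 ≤ (HomogeneousIdeal.irrelevant 𝒜').map ψ)
    (f : A →+* B) {t : A'} {d : ℕ} (hd : 0 < d) (ht : t ∈ 𝒜' d) (ht' : ψ t ∈ 𝒜 d)
    (hu : IsUnit (f (ψ t))) (hu' : IsUnit (f.comp (ψ : A' →+* A) t)) :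
    specToProj 𝒜 f hd ht' hu ≫ Proj.map ψ hψ =
      specToProj 𝒜' (f.comp (ψ : A' →+* A)) hd ht hu' := by
  have h := Proj.awayι_comp_map ψ hψ hd t ht
  unfold specToProj
  refine (Category.assoc _ _ _).trans ((congrArg (Spec.map _ ≫ ·) h).trans ?_)
  rw [← Category.assoc, ← Spec.map_comp, ← CommRingCat.ofHom_comp]
  congr 3
  refine awayLift_ext 𝒜' ht fun n x hx => ?_
  have hm : Away.map ψ t (Away.mk 𝒜' ht n x hx) = Away.mk 𝒜 (ψ.2 ht) n (ψ x) (ψ.2 hx) :=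
    Away.map_mk ..
  change f (ψ t) ^ n * awayLift 𝒜 f hu (Away.map ψ t (Away.mk 𝒜' ht n x hx)) = f (ψ x)
  rw [hm]
  exact pow_mul_awayLift_mk 𝒜 f hu (ψ.2 ht) n (ψ x) (ψ.2 hx)

lemma specToProj_preimage_basicOpen (f : A →+* B) {t s : A} {d e : ℕ} (hd : 0 < d) (ht : t ∈ 𝒜 d)
    (hu : IsUnit (f t)) (he : 0 < e) (hs : s ∈ 𝒜 e) :
    specToProj 𝒜 f hd ht hu ⁻¹ᵁ Proj.basicOpen 𝒜 s = PrimeSpectrum.basicOpen (f s) := by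
  rw [specToProj, Scheme.Hom.comp_preimage, Proj.awayι_preimage_basicOpen 𝒜 ht hd hs he]
  -- Inside D₊(t), the set D₊(s) is the nonvanishing locus of the degree zero fraction s ^ d / t ^
  -- e, whose image is f s ^ d up to a unit.
  have h := pow_mul_awayLift_mk 𝒜 f hu ht e (s ^ d)
    (by simpa [mul_comm] using SetLike.pow_mem_graded d hs)
  ext x
  change awayLift 𝒜 f hu (Away.mk 𝒜 ht e (s ^ d) _) ∉ x.asIdeal ↔ f s ∉ x.asIdeal
  have hx : f s ^ d ∉ x.asIdeal ↔ f s ∉ x.asIdeal := by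
    rw [not_iff_not]
    exact ⟨fun h => x.2.mem_of_pow_mem _ h, fun h => Ideal.pow_mem_of_mem _ h _ hd⟩
  rw [← hx, ← map_pow, ← h, not_iff_not, Ideal.unit_mul_mem_iff_mem _ (hu.pow e)]

lemma opensRange_specToProj_le (f : A →+* B) {t : A} {d : ℕ} (hd : 0 < d) (ht : t ∈ 𝒜 d)
    (hu : IsUnit (f t)) (x : Spec (CommRingCat.of B)) :
    specToProj 𝒜 f hd ht hu x ∈ Proj.basicOpen 𝒜 t := by
  rw [← Proj.opensRange_awayι 𝒜 t ht hd]
  exact ⟨Spec.map (CommRingCat.ofHom (awayLift 𝒜 f hu)) x, by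
    rw [specToProj, Scheme.Hom.comp_apply]⟩

lemma specToProj_isOpenImmersion (f : A →+* B) {t : A} {d : ℕ} (hd : 0 < d) (ht : t ∈ 𝒜 d)
    (hu : IsUnit (f t)) (hb : Function.Bijective (awayLift 𝒜 f hu)) :
    IsOpenImmersion (specToProj 𝒜 f hd ht hu) := by
  have : IsIso (CommRingCat.ofHom (awayLift 𝒜 f hu)) :=
    (ConcreteCategory.isIso_iff_bijective _).2 hb
  rw [specToProj]; infer_instance

lemma range_specToProj (f : A →+* B) {t : A} {d : ℕ} (hd : 0 < d) (ht : t ∈ 𝒜 d)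
    (hu : IsUnit (f t)) (hb : Function.Bijective (awayLift 𝒜 f hu)) :
    Set.range (specToProj 𝒜 f hd ht hu) = (Proj.basicOpen 𝒜 t : Set (Proj 𝒜)) := by
  have : IsIso (CommRingCat.ofHom (awayLift 𝒜 f hu)) :=
    (ConcreteCategory.isIso_iff_bijective _).2 hb
  rw [← Proj.opensRange_awayι 𝒜 t ht hd]
  exact congrArg (fun U : (Proj 𝒜).Opens => (U : Set (Proj 𝒜)))
    (Scheme.Hom.opensRange_comp_of_isIso (Spec.map (CommRingCat.ofHom (awayLift 𝒜 f hu)))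
      (Proj.awayι 𝒜 t ht hd))

end SpecToProj

/-! ### Affine points of a glued morphism to Proj -/

lemma ι_glueOpens {X Y : Scheme.{u}} {ι : Type u} (U : ι → X.Opens) (hU : IsOpenCover U)
    (g : ∀ i, (U i).toScheme ⟶ Y)
    (h : ∀ i j, X.homOfLE (inf_le_left : U i ⊓ U j ≤ U i) ≫ g i =
      X.homOfLE (inf_le_right : U i ⊓ U j ≤ U j) ≫ g j) (i : ι) :
    (U i).ι ≫ glueOpens U hU g h = g i :=
  Scheme.Cover.ι_glueMorphisms (X.openCoverOfIsOpenCover U hU) g _ i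

section ToProj

variable {A σ : Type u} [CommRing A] [SetLike σ A] [AddSubgroupClass σ A] (𝒜 : ℕ → σ)
  [GradedRing 𝒜] {X : Scheme.{u}} (f : A →+* Γ(X, ⊤))

lemma ι_toProj (hf : ∀ x : X, ∃ d, 0 < d ∧ ∃ t ∈ 𝒜 d, x ∈ X.basicOpen (f t)) {d : ℕ} {t : A}
    (hd : 0 < d) (ht : t ∈ 𝒜 d) :
    (X.basicOpen (f t)).ι ≫ toProj 𝒜 f hf = toProjLocal 𝒜 f hd ht :=
  ι_glueOpens _ _ _ _ (⟨(d, t), hd, ht⟩ : {ds : ℕ × A // 0 < ds.1 ∧ ds.2 ∈ 𝒜 ds.1})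

/-- The function on `Spec B` that is the pullback of a global function on `X`. -/
def pullbackFun {B : Type u} [CommRing B] (g : Spec (CommRingCat.of B) ⟶ X) : Γ(X, ⊤) →+* B :=
  (Scheme.ΓSpecIso (CommRingCat.of B)).hom.hom.comp g.appTop.hom

lemma toSpecΓ_pullbackFun {B : Type u} [CommRing B] (g : Spec (CommRingCat.of B) ⟶ X) :
    g ≫ X.toSpecΓ = Spec.map (CommRingCat.ofHom (pullbackFun g)) := by
  have h : CommRingCat.ofHom (pullbackFun g) =
      g.appTop ≫ (Scheme.ΓSpecIso (CommRingCat.of B)).hom := rfl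
  rw [h, Spec.map_comp, Scheme.toSpecΓ_naturality, SpecMap_ΓSpecIso_hom]

/-- A single homogeneous t with invertible pullback suffices: g then factors through D(f t), where
the glued morphism is the canonical one. -/
lemma comp_toProj (hf : ∀ x : X, ∃ d, 0 < d ∧ ∃ t ∈ 𝒜 d, x ∈ X.basicOpen (f t)) {d : ℕ} {t : A}
    (hd : 0 < d) (ht : t ∈ 𝒜 d) {B : Type u} [CommRing B] (g : Spec (CommRingCat.of B) ⟶ X)
    (hu : IsUnit ((pullbackFun g).comp f t)) :
    g ≫ toProj 𝒜 f hf = specToProj 𝒜 ((pullbackFun g).comp f) hd ht hu := by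
  have hg : Set.range g ⊆ Set.range (X.basicOpen (f t)).ι := by
    rw [Scheme.Opens.range_ι]
    rintro _ ⟨x, rfl⟩
    rw [← Scheme.toSpecΓ_preimage_basicOpen]
    change X.toSpecΓ (g x) ∈ PrimeSpectrum.basicOpen (f t)
    rw [← Scheme.Hom.comp_apply, toSpecΓ_pullbackFun]
    intro hx
    exact x.2.ne_top (Ideal.eq_top_of_isUnit_mem _ hx hu)
  -- The factorization of g through D(f t), read in the spectrum of the localization, may be tested
  -- after the monomorphism to Spec Γ(X, ⊤).
  have h : IsOpenImmersion.lift (X.basicOpen (f t)).ι g hg ≫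
      (X.isoOfEq (X.toSpecΓ_preimage_basicOpen (f t))).inv ≫
      X.toSpecΓ ∣_ (PrimeSpectrum.basicOpen (f t)) ≫ (basicOpenIsoSpecAway (f t)).hom =
      Spec.map (CommRingCat.ofHom (Localization.awayLift (pullbackFun g) (f t) hu)) := by
    rw [← cancel_mono (Spec.map (CommRingCat.ofHom (algebraMap Γ(X, ⊤)
      (Localization.Away (f t))))), ← Spec.map_comp, ← CommRingCat.ofHom_comp]
    have hm := morphismRestrict_ι X.toSpecΓ
      (show (Spec Γ(X, ⊤)).Opens from PrimeSpectrum.basicOpen (f t))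
    have hi := Scheme.isoOfEq_inv_ι X (X.toSpecΓ_preimage_basicOpen (f t))
    simp only [Category.assoc, basicOpenIsoSpecAway_hom_SpecMap]
    refine (congrArg (fun z => IsOpenImmersion.lift (X.basicOpen (f t)).ι g hg ≫
      (X.isoOfEq (X.toSpecΓ_preimage_basicOpen (f t))).inv ≫ z) hm).trans ?_
    refine (congrArg (IsOpenImmersion.lift (X.basicOpen (f t)).ι g hg ≫ ·)
      ((Category.assoc _ _ _).symm.trans (congrArg (· ≫ X.toSpecΓ) hi))).trans ?_
    refine (IsOpenImmersion.lift_fac_assoc _ _ _ _).trans ?_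
    rw [toSpecΓ_pullbackFun]
    congr 2
    ext x
    simp [Localization.awayLift]
  have h2 : g ≫ toProj 𝒜 f hf =
      IsOpenImmersion.lift (X.basicOpen (f t)).ι g hg ≫ toProjLocal 𝒜 f hd ht := by
    rw [← ι_toProj 𝒜 f hf hd ht, IsOpenImmersion.lift_fac_assoc]
  rw [h2, toProjLocal, Proj.toBasicOpenOfGlobalSections, specToProj]
  simp only [Category.assoc, Proj.basicOpenIsoSpec_inv_ι]
  simp only [← Category.assoc]
  congr 1
  simp only [Category.assoc]
  rw [reassoc_of% h, ← Spec.map_comp, ← CommRingCat.ofHom_comp]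
  congr 2
  refine awayLift_ext 𝒜 ht fun n x hx => ?_
  have hv : algebraMap A (Localization.Away t) t ^ n *
      (HomogeneousLocalization.Away.mk 𝒜 ht n x hx).val = algebraMap A (Localization.Away t) x := by
    rw [HomogeneousLocalization.Away.val_mk, Localization.mk_eq_mk', ← map_pow]
    exact IsLocalization.mk'_spec' _ x (⟨t ^ n, n, rfl⟩ : Submonoid.powers t)
  have h3 := congrArg (fun z => Localization.awayLift (pullbackFun g) (f t) hu
    (IsLocalization.map (M := .powers t) (T := .powers (f t)) (Localization.Away (f t)) f
      (by rw [← Submonoid.map_le_iff_le_comap, Submonoid.map_powers]) z)) hv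
  simpa [Localization.awayLift] using h3

end ToProj


/-! ### Homogeneous elements of the ring of semi-invariants -/

section SectionRing

open Polynomial

variable {k : Type u} [Field k] {R : Type u} [CommRing R] [Algebra k R]
  (𝒮 : ℕ → Submodule k R) [SetLike.GradedMonoid 𝒮]

lemma evalOne_of_mem {n : ℕ} {x : sectionRing 𝒮} (hx : x ∈ sectionGrading 𝒮 n) :
    evalOne 𝒮 x = x.1.coeff n := by
  have h : x.1 = Polynomial.monomial n (x.1.coeff n) := by
    ext i
    rw [coeff_monomial]
    split_ifs with h
    · rw [h]
    · exact hx i (Ne.symm h)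
  change Polynomial.eval 1 x.1 = _
  rw [h]
  simp

lemma evalOne_mem {n : ℕ} {x : sectionRing 𝒮} (hx : x ∈ sectionGrading 𝒮 n) :
    evalOne 𝒮 x ∈ 𝒮 n := by
  rw [evalOne_of_mem 𝒮 hx]; exact x.2 n

lemma evalOne_monomial (n : ℕ) (s : 𝒮 n) : evalOne 𝒮 (sectionRing.monomial 𝒮 n s) = s := by
  change Polynomial.eval 1 (Polynomial.monomial n s.1) = s
  simp

lemma monomial_evalOne {n : ℕ} {x : sectionRing 𝒮} (hx : x ∈ sectionGrading 𝒮 n) :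
    sectionRing.monomial 𝒮 n ⟨evalOne 𝒮 x, evalOne_mem 𝒮 hx⟩ = x := by
  apply Subtype.ext
  ext i
  change (Polynomial.monomial n (evalOne 𝒮 x)).coeff i = _
  rw [coeff_monomial, evalOne_of_mem 𝒮 hx]
  split_ifs with h
  · rw [h]
  · exact (hx i (Ne.symm h)).symm

/-- The variable X only records the degree, so identities between elements of one degree may be
verified in R. -/
lemma eq_of_evalOne_eq {n : ℕ} {x y : sectionRing 𝒮} (hx : x ∈ sectionGrading 𝒮 n)
    (hy : y ∈ sectionGrading 𝒮 n) (h : evalOne 𝒮 x = evalOne 𝒮 y) : x = y := by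
  rw [← monomial_evalOne 𝒮 hx, ← monomial_evalOne 𝒮 hy]
  congr 2

lemma evalOne_restrictSections (I : Ideal R) (x : sectionRing 𝒮) :
    evalOne (quotPieces 𝒮 I) (restrictSections 𝒮 I x) = Ideal.Quotient.mk I (evalOne 𝒮 x) := by
  change Polynomial.eval 1 (x.1.map (Ideal.Quotient.mk I)) =
    Ideal.Quotient.mk I (Polynomial.eval 1 x.1)
  rw [Polynomial.eval_map, Polynomial.eval₂_at_one]

end SectionRing

/-! ### Monomials in the arrows as characters on a chart -/

namespace SmoothFan

variable {M : Type} [AddCommGroup M] {ι : Type} [DecidableEq ι] (F : SmoothFan M ι)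
  {l : ℕ} (L : Fin (l + 1) → ι → ℤ)

/-- The character of which the divisor of an arrow is the divisor of zeroes. -/
def arrowChar (a : F.Arrow L) : M := a.irreducible.isSection.choose

lemma div_eq_ray_arrowChar (a : F.Arrow L) (q : ι) :
    (a.div q : ℤ) = F.ray q (F.arrowChar L a) + L a.head q - L a.tail q :=
  a.irreducible.isSection.choose_spec q

/-- The weight `inc(u)` of the monomial `y^u`. -/
def totalInc : (F.Arrow L →₀ ℕ) →+ (Fin (l + 1) → ℤ) := Finsupp.weight (F.inc L)

/-- The divisor `div(u)` of the monomial `y^u`. -/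
def totalDiv : (F.Arrow L →₀ ℕ) →+ (ι → ℕ) := Finsupp.weight fun a : F.Arrow L => a.div

/-- The sum of the characters of the arrows in `y^u`. -/
def totalChar : (F.Arrow L →₀ ℕ) →+ M := Finsupp.weight (F.arrowChar L)

/-- Sum of div(a) = div(χ) + L_head − L_tail over the arrows of y^u: the correction terms collect
into the pairing of inc(u) with L. -/
lemma ray_totalChar (q : ι) (u : F.Arrow L →₀ ℕ) :
    F.ray q (F.totalChar L u) = F.totalDiv L u q - ∑ i, F.totalInc L u i * L i q := by
  induction u using Finsupp.induction_linear with
  | zero => simp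
  | add u v hu hv =>
    simp only [map_add, hu, hv, Pi.add_apply, add_mul, Finset.sum_add_distrib, Nat.cast_add]
    ring
  | single a n =>
    have h1 : F.totalChar L (Finsupp.single a n) = n • F.arrowChar L a := by
      simp [totalChar, Finsupp.weight_single]
    have h2 : F.totalDiv L (Finsupp.single a n) = n • a.div := by
      simp [totalDiv, Finsupp.weight_single]
    have h3 : F.totalInc L (Finsupp.single a n) = n • F.inc L a := by
      simp [totalInc, Finsupp.weight_single]
    have h4 : ∑ i, F.inc L a i * L i q = L a.head q - L a.tail q := by
      simp [inc, sub_mul, Finset.sum_sub_distrib, Pi.single_apply]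
    have h5 := F.div_eq_ray_arrowChar L a q
    rw [h1, h2, h3, map_nsmul]
    simp only [Pi.smul_apply, nsmul_eq_mul, mul_assoc, ← Finset.mul_sum, smul_eq_mul, Nat.cast_mul,
      h4, h5]
    ring

/-- The characters `g i` generate the sheaves `𝒪(L i)` on the chart of the cone `S`. -/
def AreLocalGenerators (S : Finset ι) (g : Fin (l + 1) → M) : Prop :=
  ∀ i, F.IsLocalGenerator (L i) S (g i)

variable {F L}

lemma AreLocalGenerators.mono {S T : Finset ι} {g : Fin (l + 1) → M}
    (hg : F.AreLocalGenerators L T g) (h : S ⊆ T) : F.AreLocalGenerators L S g :=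
  fun i q hq => hg i q (h hq)

/-- Along the rays of S the generator g i has order −L i, so the twist by the g i cancels exactly
the correction term of `ray_totalChar`. -/
lemma ray_totalChar_sub {S : Finset ι} {g : Fin (l + 1) → M} (hg : F.AreLocalGenerators L S g)
    (u : F.Arrow L →₀ ℕ) {q : ι} (hq : q ∈ S) :
    F.ray q (F.totalChar L u - ∑ i, F.totalInc L u i • g i) = F.totalDiv L u q := by
  rw [map_sub, ray_totalChar, map_sum]
  simp only [map_zsmul, fun i => hg i q hq, smul_eq_mul, mul_neg, Finset.sum_neg_distrib]
  ring

variable (F L) in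
/-- The exponent of the monomial `y^u` as a function on the chart of the cone `S`, trivialized by
the characters `g`. -/
def localExponent {S : Finset ι} {g : Fin (l + 1) → M} (hg : F.AreLocalGenerators L S g) :
    (F.Arrow L →₀ ℕ) →+ F.dualMonoid S where
  toFun u := ⟨F.totalChar L u - ∑ i, F.totalInc L u i • g i, fun q hq => by
    rw [ray_totalChar_sub hg u hq]; exact Int.natCast_nonneg _⟩
  map_zero' := by ext; simp
  map_add' u v := by
    ext
    simp only [map_add, Pi.add_apply, add_smul, Finset.sum_add_distrib, AddSubmonoid.coe_add]
    abel

lemma ray_localExponent {S : Finset ι} {g : Fin (l + 1) → M} (hg : F.AreLocalGenerators L S g)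
    (u : F.Arrow L →₀ ℕ) {q : ι} (hq : q ∈ S) :
    F.ray q (F.localExponent L hg u : M) = F.totalDiv L u q :=
  ray_totalChar_sub hg u hq

lemma coe_localExponent {S : Finset ι} {g : Fin (l + 1) → M} (hg : F.AreLocalGenerators L S g)
    (u : F.Arrow L →₀ ℕ) :
    (F.localExponent L hg u : M) = F.totalChar L u - ∑ i, F.totalInc L u i • g i := rfl

variable (k : Type u) [Field k]

variable (F L) in
/-- The ring homomorphism from `k[y_a : a ∈ Q₁]` to the functions on the chart of the cone `S`,
given by the labels of the arrows and the trivializations `g`. -/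
def chartHom {S : Finset ι} {g : Fin (l + 1) → M} (hg : F.AreLocalGenerators L S g) :
    MvPolynomial (F.Arrow L) k →+* F.chartRing k S :=
  AddMonoidAlgebra.mapDomainRingHom k (F.localExponent L hg)

lemma chartHom_monomial {S : Finset ι} {g : Fin (l + 1) → M} (hg : F.AreLocalGenerators L S g)
    (u : F.Arrow L →₀ ℕ) (c : k) :
    F.chartHom L k hg (MvPolynomial.monomial u c) =
      AddMonoidAlgebra.single (F.localExponent L hg u) c :=
  AddMonoidAlgebra.mapDomain_single ..

lemma mvPolynomial_hom_ext {σ : Type} {B : Type u} [CommRing B] {f g : MvPolynomial σ k →+* B}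
    (h : ∀ u c, f (MvPolynomial.monomial u c) = g (MvPolynomial.monomial u c)) : f = g := by
  ext p
  · exact h 0 _
  · exact h _ 1

lemma faceMap_comp_chartHom {S T : Finset ι} (h : S ⊆ T) {g : Fin (l + 1) → M}
    (hg : F.AreLocalGenerators L T g) :
    (F.faceMap k h).comp (F.chartHom L k hg) = F.chartHom L k (hg.mono h) := by
  refine mvPolynomial_hom_ext k fun u c => ?_
  rw [RingHom.comp_apply, chartHom_monomial, chartHom_monomial, faceMap_single]
  rfl

/-- A character without zeroes and poles on the chart of `S`, as a unit. -/
def unitChar {S : Finset ι} (m : M) (hm : ∀ q ∈ S, F.ray q m = 0) : (F.chartRing k S)ˣ where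
  val := AddMonoidAlgebra.single ⟨m, fun q hq => (hm q hq).ge⟩ 1
  inv := AddMonoidAlgebra.single ⟨-m, fun q hq => by rw [map_neg, hm q hq, neg_zero]⟩ 1
  val_inv := by
    rw [AddMonoidAlgebra.single_mul_single, AddMonoidAlgebra.one_def, mul_one]
    congr 1
    ext; simp
  inv_val := by
    rw [AddMonoidAlgebra.single_mul_single, AddMonoidAlgebra.one_def, mul_one]
    congr 1
    ext; simp

lemma isUnit_single {S : Finset ι} (m : F.dualMonoid S) (hm : ∀ q ∈ S, F.ray q (m : M) = 0) :
    IsUnit (AddMonoidAlgebra.single m (1 : k) : F.chartRing k S) :=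
  (unitChar k (m : M) hm).isUnit

lemma ray_sub_localGenerators {S : Finset ι} {g g' : Fin (l + 1) → M}
    (hg : F.AreLocalGenerators L S g) (hg' : F.AreLocalGenerators L S g')
    (w : Fin (l + 1) → ℤ) (q : ι) (hq : q ∈ S) : F.ray q (∑ i, w i • (g i - g' i)) = 0 := by
  rw [map_sum]
  refine Finset.sum_eq_zero fun i _ => ?_
  rw [map_zsmul, map_sub, hg i q hq, hg' i q hq, sub_self, smul_zero]

/-- A change of trivialization acts through the weight alone, by the character Σ w_i (g_i − g'_i),
which is invertible on the chart because both families generate the same sheaves. -/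
lemma chartHom_change {S : Finset ι} {g g' : Fin (l + 1) → M}
    (hg : F.AreLocalGenerators L S g) (hg' : F.AreLocalGenerators L S g')
    (w : Fin (l + 1) → ℤ) {p : MvPolynomial (F.Arrow L) k} (hp : p ∈ F.weightPiece L k w) :
    F.chartHom L k hg' p =
      unitChar k (∑ i, w i • (g i - g' i)) (ray_sub_localGenerators hg hg' w) *
        F.chartHom L k hg p := by
  rw [p.as_sum, map_sum, map_sum, Finset.mul_sum]
  refine Finset.sum_congr rfl fun u hu => ?_
  have hw : F.totalInc L u = w := hp (MvPolynomial.mem_support_iff.1 hu)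
  rw [chartHom_monomial, chartHom_monomial, unitChar, AddMonoidAlgebra.single_mul_single, one_mul]
  congr 1
  ext
  simp only [AddSubmonoid.coe_add, coe_localExponent, hw, smul_sub, Finset.sum_sub_distrib]
  abel

lemma unitChar_pow {S : Finset ι} (m : M) (hm : ∀ q ∈ S, F.ray q m = 0) (n : ℕ) (m' : M)
    (hm' : ∀ q ∈ S, F.ray q m' = 0) (h : n • m = m') :
    (unitChar k m hm : F.chartRing k S) ^ n = unitChar k m' hm' := by
  subst h
  simp only [unitChar, AddMonoidAlgebra.single_pow, one_pow]
  rfl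

/-- In degree n the factor is the n-th power of one fixed unit, which is the form required by
`specToProj_twist`. -/
lemma chartHom_change_theta {S : Finset ι} {g g' : Fin (l + 1) → M}
    (hg : F.AreLocalGenerators L S g) (hg' : F.AreLocalGenerators L S g')
    (n : ℕ) {p : MvPolynomial (F.Arrow L) k} (hp : p ∈ F.thetaPieces L k n) :
    F.chartHom L k hg' p =
      (unitChar k (∑ i, theta l i • (g i - g' i)) (ray_sub_localGenerators hg hg' _) :
        F.chartRing k S) ^ n * F.chartHom L k hg p := by
  rw [chartHom_change k hg hg' _ hp, unitChar_pow k _ _ n _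
    (ray_sub_localGenerators hg hg' (n • theta l))]
  rw [Finset.smul_sum]
  refine Finset.sum_congr rfl fun i _ => ?_
  rw [Pi.smul_apply, smul_assoc]

lemma monomial_mem_weightPiece (u : F.Arrow L →₀ ℕ) (c : k) {w : Fin (l + 1) → ℤ}
    (h : F.totalInc L u = w) : MvPolynomial.monomial u c ∈ F.weightPiece L k w :=
  MvPolynomial.isWeightedHomogeneous_monomial _ _ _ h

lemma monomial_sub_mem_toricIdeal {u v : F.Arrow L →₀ ℕ} (hi : F.totalInc L u = F.totalInc L v)
    (hd : F.totalDiv L u = F.totalDiv L v) (c : k) :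
    MvPolynomial.monomial u c - MvPolynomial.monomial v c ∈ F.toricIdeal L k := by
  have h : MvPolynomial.monomial u (1 : k) - MvPolynomial.monomial v 1 ∈ F.toricIdeal L k :=
    Ideal.subset_span ⟨u, v, hi, hd, rfl⟩
  have := Ideal.mul_mem_left _ (MvPolynomial.C c) h
  rwa [mul_sub, MvPolynomial.C_mul_monomial, MvPolynomial.C_mul_monomial, mul_one] at this

variable (F L) in
/-- If the monomials of `p` with the same image under `e` are congruent modulo the toric ideal and
`e` maps `p` to zero, then `p` lies in the toric ideal. -/
lemma mem_toricIdeal_of_mapDomain_eq_zero {E : Type*} [AddCommMonoid E]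
    (e : (F.Arrow L →₀ ℕ) → E) (p : MvPolynomial (F.Arrow L) k)
    (he : ∀ u ∈ p.support, ∀ v ∈ p.support, e u = e v →
      F.totalInc L u = F.totalInc L v ∧ F.totalDiv L u = F.totalDiv L v)
    (hp : ∑ u ∈ p.support, AddMonoidAlgebra.single (e u) (p.coeff u) =
      (0 : AddMonoidAlgebra k E)) :
    p ∈ F.toricIdeal L k := by
  classical
  -- One monomial of p is chosen in each fibre of e; the default value 0 concerns only points
  -- outside the image of the support.
  let rep : E → (F.Arrow L →₀ ℕ) := fun x =>
    if h : ∃ u ∈ p.support, e u = x then h.choose else 0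
  have hrep : ∀ u ∈ p.support, rep (e u) ∈ p.support ∧ e (rep (e u)) = e u := fun u hu => by
    have h : ∃ v ∈ p.support, e v = e u := ⟨u, hu, rfl⟩
    simp only [rep, dif_pos h]
    exact h.choose_spec
  -- Replacing every monomial by its representative factors through the vanishing sum over E.
  -- Subtracting this zero writes p as a combination of binomials y^u − y^{rep(e u)}.
  have hsum : ∑ u ∈ p.support, MvPolynomial.monomial (rep (e u)) (p.coeff u) = 0 := by
    have h := congrArg (fun x : AddMonoidAlgebra k E =>
      (Finsupp.liftAddHom fun y => (MvPolynomial.monomial (rep y)).toAddMonoidHom :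
        (E →₀ k) →+ MvPolynomial (F.Arrow L) k) x.coeff) hp
    simpa [map_sum] using h
  rw [p.as_sum, ← sub_zero (∑ u ∈ p.support, _), ← hsum, ← Finset.sum_sub_distrib]
  refine Ideal.sum_mem _ fun u hu => ?_
  obtain ⟨h1, h2⟩ := hrep u hu
  obtain ⟨h3, h4⟩ := he u hu _ h1 h2.symm
  exact monomial_sub_mem_toricIdeal k h3 h4 _

end SmoothFan


/-! ### Chart data and the isomorphism onto the toric image -/

namespace SmoothFan

/-- This is why a product of paths from 0, one to each vertex, is a semi-invariant of degree one. -/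
lemma sum_single_sub (l : ℕ) : (∑ i, (Pi.single i 1 - Pi.single 0 1 : Fin (l + 1) → ℤ)) = theta l := by
  ext q
  simp only [Finset.sum_apply, Pi.sub_apply, Finset.sum_sub_distrib, Pi.single_apply, theta,
    Finset.sum_ite_eq, Finset.mem_univ, if_true, Finset.sum_const, Finset.card_univ,
    Fintype.card_fin]
  split_ifs <;> simp

variable {M : Type} [AddCommGroup M] {ι : Type} [DecidableEq ι] (F : SmoothFan M ι)
  {l : ℕ} (L : Fin (l + 1) → ι → ℤ)

/-- Maximal cones of a fan together with generators of the sheaves `𝒪(L i)` on their charts that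
extend to global sections, presented by paths in the quiver of sections; these sections embed the
toric variety into the multigraded linear series. -/
structure ChartData (J : Type) where
  cone : J → Finset ι
  cone_mem : ∀ j, cone j ∈ F.cones
  exists_le : ∀ S ∈ F.cones, ∃ j, S ⊆ cone j
  ray_injective : ∀ j m, (∀ q ∈ cone j, F.ray q m = 0) → m = 0
  gen : J → Fin (l + 1) → M
  isGen : ∀ j, F.AreLocalGenerators L (cone j) (gen j)
  path : J → Fin (l + 1) → F.Arrow L →₀ ℕ
  inc_path : ∀ j i, F.totalInc L (path j i) = Pi.single i 1 - Pi.single 0 1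
  div_path : ∀ j i, ∀ q ∈ cone j, F.totalDiv L (path j i) q = 0
  -- Together with `div_path`: the product of the paths vanishes exactly along the rays outside the
  -- cone.
  mem_cone : ∀ j q, (∀ i, F.totalDiv L (path j i) q = 0) → q ∈ cone j
  -- Source of surjectivity on coordinate rings: only the orders along the cone are prescribed,
  -- since the tree is invertible on the chart.
  exists_ratio : ∀ j, ∀ m ∈ F.dualMonoid (cone j), ∃ n : ℕ, ∃ u,
    F.totalInc L u = n • theta l ∧ ∀ q ∈ cone j, (F.totalDiv L u q : ℤ) = F.ray q m
  -- Source of the covering by the sets D₊(tree): equal weights and divisors mean equality modulo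
  -- the toric ideal.
  exists_factor : ∀ n : ℕ, 0 < n → ∀ u, F.totalInc L u = n • theta l → ∃ N : ℕ, 0 < N ∧ ∃ j v,
    F.totalInc L (N • u) = F.totalInc L (∑ i, path j i + v) ∧
    F.totalDiv L (N • u) = F.totalDiv L (∑ i, path j i + v)

namespace ChartData

variable {F L} {J : Type} (P : F.ChartData L J) (k : Type u) [Field k]

/-- The product of the monomials of the paths, of weight `ϑ`. -/
def tree (j : J) : F.Arrow L →₀ ℕ := ∑ i, P.path j i

lemma inc_tree (j : J) : F.totalInc L (P.tree j) = theta l := by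
  rw [tree, map_sum]
  simp only [P.inc_path]
  exact sum_single_sub l

lemma div_tree (j : J) (q : ι) : F.totalDiv L (P.tree j) q = 0 ↔ q ∈ P.cone j := by
  rw [tree, map_sum, Finset.sum_apply, Finset.sum_eq_zero_iff]
  exact ⟨fun h => P.mem_cone j q fun i => h i (Finset.mem_univ _),
    fun h i _ => P.div_path j i q h⟩

/-- The monomial `c y^u` of weight `n • ϑ`, in degree `n` of the ring of semi-invariants. -/
def thetaMonomial (n : ℕ) (u : F.Arrow L →₀ ℕ) (c : k) (h : F.totalInc L u = n • theta l) :
    sectionRing (F.thetaPieces L k) :=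
  sectionRing.monomial (F.thetaPieces L k) n
    ⟨MvPolynomial.monomial u c, monomial_mem_weightPiece k u c h⟩

lemma thetaMonomial_mem (n : ℕ) (u : F.Arrow L →₀ ℕ) (c : k) (h : F.totalInc L u = n • theta l) :
    thetaMonomial k n u c h ∈ sectionGrading (F.thetaPieces L k) n :=
  sectionRing.monomial_mem (F.thetaPieces L k) n _

lemma evalOne_thetaMonomial (n : ℕ) (u : F.Arrow L →₀ ℕ) (c : k)
    (h : F.totalInc L u = n • theta l) :
    evalOne (F.thetaPieces L k) (thetaMonomial k n u c h) = MvPolynomial.monomial u c :=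
  evalOne_monomial ..

lemma inc_tree' (j : J) : F.totalInc L (P.tree j) = 1 • theta l :=
  (P.inc_tree j).trans (one_smul _ _).symm

/-- The monomial of the paths of a cone, as an element of degree one. -/
def treeSection (j : J) : sectionRing (F.thetaPieces L k) :=
  thetaMonomial k 1 (P.tree j) 1 (P.inc_tree' j)

lemma treeSection_mem (j : J) : P.treeSection k j ∈ sectionGrading (F.thetaPieces L k) 1 :=
  thetaMonomial_mem k _ _ _ _

lemma evalOne_treeSection (j : J) :
    evalOne (F.thetaPieces L k) (P.treeSection k j) = MvPolynomial.monomial (P.tree j) 1 :=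
  evalOne_monomial ..

lemma isUnit_chartHom_tree (j : J) {S : Finset ι} (hS : S ⊆ P.cone j) {g : Fin (l + 1) → M}
    (hg : F.AreLocalGenerators L S g) :
    IsUnit (F.chartHom L k hg (MvPolynomial.monomial (P.tree j) 1)) := by
  rw [chartHom_monomial]
  refine isUnit_single k _ fun q hq => ?_
  rw [ray_localExponent hg _ hq, (P.div_tree j q).2 (hS hq), Nat.cast_zero]

include P in
lemma totalChar_eq {u v : F.Arrow L →₀ ℕ} (hi : F.totalInc L u = F.totalInc L v)
    (hd : F.totalDiv L u = F.totalDiv L v) : F.totalChar L u = F.totalChar L v := by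
  obtain ⟨j, -⟩ := P.exists_le ∅ F.zero_mem
  rw [← sub_eq_zero]
  refine P.ray_injective j _ fun q _ => ?_
  rw [map_sub, ray_totalChar, ray_totalChar, hi, hd, sub_self]

include P in
lemma toricIdeal_le_ker {S : Finset ι} {g : Fin (l + 1) → M} (hg : F.AreLocalGenerators L S g) :
    ∀ p ∈ F.toricIdeal L k, F.chartHom L k hg p = 0 := by
  suffices F.toricIdeal L k ≤ RingHom.ker (F.chartHom L k hg) from this
  rw [toricIdeal, Ideal.span_le]
  rintro _ ⟨u, v, hi, hd, rfl⟩
  change F.totalInc L u = F.totalInc L v at hi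
  change F.totalDiv L u = F.totalDiv L v at hd
  rw [SetLike.mem_coe, RingHom.mem_ker, map_sub, chartHom_monomial, chartHom_monomial, sub_eq_zero]
  congr 1
  ext
  rw [coe_localExponent, coe_localExponent, hi, P.totalChar_eq hi hd]

/-- The map that `chartHom` induces on the coordinate ring of `𝕍(I_Q)`. -/
def quotHom {S : Finset ι} {g : Fin (l + 1) → M} (hg : F.AreLocalGenerators L S g) :
    (MvPolynomial (F.Arrow L) k ⧸ F.toricIdeal L k) →+* F.chartRing k S :=
  Ideal.Quotient.lift _ (F.chartHom L k hg) (P.toricIdeal_le_ker k hg)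

/-- The ring of semi-invariants on `𝕍(I_Q)` by degree. -/
abbrev imagePieces (F : SmoothFan M ι) (L : Fin (l + 1) → ι → ℤ) (k : Type u) [Field k] :=
  quotPieces (F.thetaPieces L k) (F.toricIdeal L k)

/-- The function on `𝕍(I_Q)` given by the monomial of the paths. -/
def treeQuot (j : J) : sectionRing (imagePieces F L k) :=
  restrictSections (F.thetaPieces L k) (F.toricIdeal L k) (P.treeSection k j)

lemma treeQuot_mem (j : J) : P.treeQuot k j ∈ sectionGrading (imagePieces F L k) 1 :=
  (restrictSections (F.thetaPieces L k) (F.toricIdeal L k)).2 (P.treeSection_mem k j)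

lemma quotHom_mk {S : Finset ι} {g : Fin (l + 1) → M} (hg : F.AreLocalGenerators L S g)
    (p : MvPolynomial (F.Arrow L) k) :
    P.quotHom k hg (Ideal.Quotient.mk _ p) = F.chartHom L k hg p := Ideal.Quotient.lift_mk ..

lemma evalOne_treeQuot (j : J) : evalOne (imagePieces F L k) (P.treeQuot k j) =
    Ideal.Quotient.mk _ (MvPolynomial.monomial (P.tree j) 1) := by
  rw [treeQuot, evalOne_restrictSections, evalOne_treeSection]

lemma quotHom_treeQuot {S : Finset ι} {g : Fin (l + 1) → M} (hg : F.AreLocalGenerators L S g)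
    (j : J) : (P.quotHom k hg).comp (evalOne (imagePieces F L k)) (P.treeQuot k j) =
      AddMonoidAlgebra.single (F.localExponent L hg (P.tree j)) 1 := by
  rw [RingHom.comp_apply, evalOne_treeQuot, quotHom_mk, chartHom_monomial]

lemma isUnit_quotHom_tree (j : J) {S : Finset ι} (hS : S ⊆ P.cone j) {g : Fin (l + 1) → M}
    (hg : F.AreLocalGenerators L S g) :
    IsUnit ((P.quotHom k hg).comp (evalOne (imagePieces F L k)) (P.treeQuot k j)) := by
  rw [RingHom.comp_apply, evalOne_treeQuot, quotHom_mk]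
  exact P.isUnit_chartHom_tree k j hS hg

lemma quotHom_change_theta {S : Finset ι} {g g' : Fin (l + 1) → M}
    (hg : F.AreLocalGenerators L S g) (hg' : F.AreLocalGenerators L S g')
    (n : ℕ) {x : sectionRing (imagePieces F L k)}
    (hx : x ∈ sectionGrading (imagePieces F L k) n) :
    (P.quotHom k hg').comp (evalOne (imagePieces F L k)) x =
      (unitChar k (∑ i, theta l i • (g i - g' i)) (ray_sub_localGenerators hg hg' _) :
        F.chartRing k S) ^ n * (P.quotHom k hg).comp (evalOne (imagePieces F L k)) x := by
  obtain ⟨p, hp, hpx⟩ := evalOne_mem _ hx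
  rw [RingHom.comp_apply, RingHom.comp_apply, ← hpx]
  change P.quotHom k hg' (Ideal.Quotient.mk _ p) = _ * P.quotHom k hg (Ideal.Quotient.mk _ p)
  rw [quotHom_mk, quotHom_mk, chartHom_change_theta k hg hg' n hp]

/-- The morphism from the chart of a cone `S ⊆ cone j` to `𝕍(I_Q) //_ϑ T_Q`. -/
def chartToImage (j : J) {S : Finset ι} (hS : S ⊆ P.cone j) :
    Spec (CommRingCat.of (F.chartRing k S)) ⟶ F.toricImage L k :=
  specToProj (sectionGrading (imagePieces F L k))
    ((P.quotHom k ((P.isGen j).mono hS)).comp (evalOne (imagePieces F L k))) one_pos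
    (P.treeQuot_mem k j) (P.isUnit_quotHom_tree k j hS _)

/-- The trivializations chosen for i and for j differ in degree n by the n-th power of a unit, which
Proj does not see. Hence the chart maps glue. -/
lemma chartToImage_eq {i j : J} {S : Finset ι} (hi : S ⊆ P.cone i) (hj : S ⊆ P.cone j) :
    P.chartToImage k i hi = P.chartToImage k j hj :=
  specToProj_twist _ _ (fun n _ hx => P.quotHom_change_theta k ((P.isGen i).mono hi)
    ((P.isGen j).mono hj) n hx) ..

lemma faceMap_comp_quotHom {S T : Finset ι} (h : S ⊆ T) {g : Fin (l + 1) → M}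
    (hg : F.AreLocalGenerators L T g) :
    (F.faceMap k h).comp (P.quotHom k hg) = P.quotHom k (hg.mono h) := by
  refine Ideal.Quotient.ringHom_ext (RingHom.ext fun p => ?_)
  simp only [RingHom.comp_apply, quotHom_mk]
  rw [← RingHom.comp_apply, faceMap_comp_chartHom]

lemma faceMap_chartToImage (j : J) {S T : Finset ι} (h : S ⊆ T) (hT : T ⊆ P.cone j) :
    Spec.map (CommRingCat.ofHom (F.faceMap k h)) ≫ P.chartToImage k j hT =
      P.chartToImage k j (h.trans hT) := by
  refine (specMap_specToProj ..).trans ?_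
  unfold chartToImage
  congr 1
  rw [← RingHom.comp_assoc, faceMap_comp_quotHom]

/-- A maximal cone of the data containing the given cone. -/
def maxIndex (S : F.cones) : J := (P.exists_le S.1 S.2).choose

lemma le_maxIndex (S : F.cones) : S.1 ⊆ P.cone (P.maxIndex S) := (P.exists_le S.1 S.2).choose_spec

/-- The morphism from the toric variety to `𝕍(I_Q) //_ϑ T_Q`. -/
def toImage : F.toricVariety k ⟶ F.toricImage L k :=
  colimit.desc (F.charts k)
    { pt := F.toricImage L k
      ι :=
        { app := fun S => P.chartToImage k (P.maxIndex S) (P.le_maxIndex S)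
          naturality := fun S T h => by
            refine Eq.trans ?_ (Category.comp_id _).symm
            refine (P.faceMap_chartToImage k _ (leOfHom h) _).trans ?_
            exact P.chartToImage_eq k _ _ } }

lemma chartι_toImage (S : F.cones) {j : J} (hS : S.1 ⊆ P.cone j) :
    F.chartι k S ≫ P.toImage k = P.chartToImage k j hS :=
  (colimit.ι_desc _ S).trans (P.chartToImage_eq k (P.le_maxIndex S) hS)

/-- The maximal cone with index `j`. -/
def coneOf (j : J) : F.cones := ⟨P.cone j, P.cone_mem j⟩

lemma localExponent_injective (j : J) (u : F.Arrow L →₀ ℕ) {m : F.dualMonoid (P.cone j)}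
    (h : ∀ q ∈ P.cone j, (F.totalDiv L u q : ℤ) = F.ray q (m : M)) :
    F.localExponent L (P.isGen j) u = m := by
  ext
  rw [← sub_eq_zero]
  refine P.ray_injective j _ fun q hq => ?_
  rw [map_sub, ray_localExponent (P.isGen j) u hq, h q hq, sub_self]

lemma localExponent_tree (j : J) : F.localExponent L (P.isGen j) (P.tree j) = 0 :=
  P.localExponent_injective j _ fun q hq => by
    rw [(P.div_tree j q).2 hq]; simp

lemma quotHom_treeQuot_self (j : J) :
    (P.quotHom k (P.isGen j)).comp (evalOne (imagePieces F L k)) (P.treeQuot k j) = 1 := by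
  rw [quotHom_treeQuot, localExponent_tree, AddMonoidAlgebra.one_def]

/-- Injectivity in a fixed degree. There all monomials have the same weight, so equal characters
force equal divisors along all rays, not only those of the cone. The kernel therefore consists of
combinations of binomials of the toric ideal. -/
lemma eq_zero_of_quotHom_eq_zero (j : J) {n : ℕ} {x : sectionRing (imagePieces F L k)}
    (hx : x ∈ sectionGrading (imagePieces F L k) n)
    (h : (P.quotHom k (P.isGen j)).comp (evalOne (imagePieces F L k)) x = 0) : x = 0 := by
  obtain ⟨p, hp, hpx⟩ := evalOne_mem _ hx
  have hpx' : Ideal.Quotient.mk _ p = evalOne (imagePieces F L k) x := hpx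
  rw [RingHom.comp_apply, ← hpx', quotHom_mk] at h
  have hw : ∀ u ∈ p.support, F.totalInc L u = n • theta l :=
    fun u hu => hp (MvPolynomial.mem_support_iff.1 hu)
  have hI : p ∈ F.toricIdeal L k := by
    refine F.mem_toricIdeal_of_mapDomain_eq_zero L k (F.localExponent L (P.isGen j)) p ?_ ?_
    · intro u hu v hv huv
      have hi : F.totalInc L u = F.totalInc L v := (hw u hu).trans (hw v hv).symm
      refine ⟨hi, funext fun q => ?_⟩
      have hc := congrArg (fun m : F.dualMonoid (P.cone j) => F.ray q (m : M)) huv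
      simp only [coe_localExponent, map_sub, ray_totalChar, hi, sub_left_inj] at hc
      exact_mod_cast hc
    · rw [p.as_sum, map_sum] at h
      simpa only [chartHom_monomial] using h
  rw [← monomial_evalOne _ hx]
  have h0 : evalOne (imagePieces F L k) x = 0 := by
    rw [← hpx']; exact Ideal.Quotient.eq_zero_iff_mem.2 hI
  apply Subtype.ext
  change Polynomial.monomial n (evalOne (imagePieces F L k) x) = 0
  rw [h0, Polynomial.monomial_zero_right]

/-- With its own generators the tree maps to 1, so a fraction x / tree ^ n maps to the image of x.
Injectivity is then `eq_zero_of_quotHom_eq_zero`, and `exists_ratio` reaches every character of the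
chart. -/
lemma bijective_awayLift (j : J) : Function.Bijective
    (awayLift (sectionGrading (imagePieces F L k))
      ((P.quotHom k (P.isGen j)).comp (evalOne (imagePieces F L k)))
      (P.isUnit_quotHom_tree k j subset_rfl (P.isGen j))) := by
  have key : ∀ n x (hx : x ∈ sectionGrading (imagePieces F L k) (n • 1)),
      awayLift (sectionGrading (imagePieces F L k))
        ((P.quotHom k (P.isGen j)).comp (evalOne (imagePieces F L k)))
        (P.isUnit_quotHom_tree k j subset_rfl (P.isGen j))
        (HomogeneousLocalization.Away.mk _ (P.treeQuot_mem k j) n x hx) =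
      (P.quotHom k (P.isGen j)).comp (evalOne (imagePieces F L k)) x := fun n x hx => by
    have h := pow_mul_awayLift_mk (sectionGrading (imagePieces F L k))
      ((P.quotHom k (P.isGen j)).comp (evalOne (imagePieces F L k)))
      (P.isUnit_quotHom_tree k j subset_rfl (P.isGen j)) (P.treeQuot_mem k j) n x hx
    rwa [quotHom_treeQuot_self, one_pow, one_mul] at h
  constructor
  · rw [injective_iff_map_eq_zero]
    intro z hz
    obtain ⟨n, x, hx, rfl⟩ := HomogeneousLocalization.Away.mk_surjective _ (P.treeQuot_mem k j) z
    rw [key] at hz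
    have := P.eq_zero_of_quotHom_eq_zero k j hx hz
    subst this
    apply HomogeneousLocalization.val_injective
    rw [HomogeneousLocalization.Away.val_mk, HomogeneousLocalization.val_zero,
      Localization.mk_zero]
  · intro z
    induction z using AddMonoidAlgebra.induction_linear with
    | zero => exact ⟨0, map_zero _⟩
    | add f g hf hg =>
      obtain ⟨a, rfl⟩ := hf
      obtain ⟨b, rfl⟩ := hg
      exact ⟨a + b, map_add _ _ _⟩
    | single m c =>
      obtain ⟨n, u, hu, hm⟩ := P.exists_ratio j m.1 m.2
      refine ⟨HomogeneousLocalization.Away.mk _ (P.treeQuot_mem k j) n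
        (restrictSections (F.thetaPieces L k) (F.toricIdeal L k)
          (thetaMonomial k n u c hu)) ?_, ?_⟩
      · rw [smul_eq_mul, mul_one]
        exact (restrictSections (F.thetaPieces L k) (F.toricIdeal L k)).2
          (thetaMonomial_mem k _ _ _ _)
      · rw [key, RingHom.comp_apply, evalOne_restrictSections, evalOne_thetaMonomial, quotHom_mk,
          chartHom_monomial, P.localExponent_injective j u hm]

lemma chartToImage_isOpenImmersion (j : J) : IsOpenImmersion (P.chartToImage k j subset_rfl) :=
  specToProj_isOpenImmersion _ _ _ _ _ (P.bijective_awayLift k j)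

/-- The open subset of `𝕍(I_Q) //_ϑ T_Q` where the monomial of the paths does not vanish. -/
def imageOpen (j : J) : (F.toricImage L k).Opens :=
  Proj.basicOpen (sectionGrading (imagePieces F L k)) (P.treeQuot k j)

lemma range_chartToImage (j : J) : Set.range (P.chartToImage k j subset_rfl) =
    (P.imageOpen k j : Set (F.toricImage L k)) :=
  range_specToProj _ _ _ _ _ (P.bijective_awayLift k j)

/-- By `exists_factor` some power of the monomial is a multiple of a tree modulo the toric ideal,
and a homogeneous prime containing all trees contains it. -/
lemma restrict_thetaMonomial_mem {x : F.toricImage L k}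
    (H : ∀ j, P.treeQuot k j ∈ x.asHomogeneousIdeal) {n : ℕ} (hn : 0 < n) (u : F.Arrow L →₀ ℕ)
    (c : k) (hu : F.totalInc L u = n • theta l) :
    restrictSections (F.thetaPieces L k) (F.toricIdeal L k) (thetaMonomial k n u c hu) ∈
      x.asHomogeneousIdeal := by
  obtain ⟨N, hN, j, v, hi, hd⟩ := P.exists_factor n hn u hu
  -- The tree uses up one ϑ of the weight N * n * ϑ. The subtraction is honest because N and n are
  -- positive.
  have hv : F.totalInc L v = (N * n - 1) • theta l := by
    have h1 : F.totalInc L v = (N * n) • theta l - theta l := by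
      rw [map_nsmul, hu, map_add] at hi
      rw [eq_sub_iff_add_eq', mul_smul, hi, ← P.inc_tree j]
      rfl
    rw [h1, sub_nsmul _ (Nat.mul_pos hN hn), one_nsmul, sub_eq_add_neg]
  have hmul : restrictSections (F.thetaPieces L k) (F.toricIdeal L k) (thetaMonomial k n u c hu) ^ N
      = P.treeQuot k j * restrictSections (F.thetaPieces L k) (F.toricIdeal L k)
        (thetaMonomial k (N * n - 1) v (c ^ N) hv) := by
    refine eq_of_evalOne_eq (n := N • n) _ (SetLike.pow_mem_graded _
      ((restrictSections (F.thetaPieces L k) (F.toricIdeal L k)).2 (thetaMonomial_mem k _ _ _ _))) ?_ ?_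
    · have : N • n = 1 + (N * n - 1) := by
        have := Nat.mul_pos hN hn
        rw [smul_eq_mul]; omega
      rw [this]
      exact SetLike.mul_mem_graded (P.treeQuot_mem k j)
        ((restrictSections (F.thetaPieces L k) (F.toricIdeal L k)).2 (thetaMonomial_mem k _ _ _ _))
    · rw [map_pow, map_mul, evalOne_treeQuot]
      simp only [evalOne_restrictSections, evalOne_thetaMonomial]
      rw [← map_pow, ← map_mul, MvPolynomial.monomial_pow, MvPolynomial.monomial_mul, one_mul,
        Ideal.Quotient.eq]
      exact monomial_sub_mem_toricIdeal k hi hd _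
  refine x.isPrime.mem_of_pow_mem N ?_
  rw [hmul]
  exact Ideal.mul_mem_right _ _ (H j)

/-- A point outside all these sets would contain every monomial of positive degree, hence the
irrelevant ideal. -/
lemma iSup_imageOpen : ⨆ j, P.imageOpen k j = ⊤ := by
  refine top_le_iff.1 fun x _ => Opens.mem_iSup.2 ?_
  by_contra! H
  have H' : ∀ j, P.treeQuot k j ∈ x.asHomogeneousIdeal := fun j => by
    by_contra h
    exact H j h
  refine x.not_irrelevant_le ?_
  rw [HomogeneousIdeal.irrelevant_le]
  intro n hn y hy
  obtain ⟨p, hp, hpy⟩ := evalOne_mem _ hy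
  have hw : ∀ u ∈ p.support, F.totalInc L u = n • theta l :=
    fun u hu => hp (MvPolynomial.mem_support_iff.1 hu)
  have hsum : y = ∑ u ∈ p.support.attach, restrictSections (F.thetaPieces L k) (F.toricIdeal L k)
      (thetaMonomial k n u.1 (p.coeff u.1) (hw u.1 u.2)) := by
    refine eq_of_evalOne_eq _ hy (Submodule.sum_mem _ fun u _ =>
      (restrictSections (F.thetaPieces L k) (F.toricIdeal L k)).2 (thetaMonomial_mem k _ _ _ _)) ?_
    rw [map_sum, ← hpy]
    simp only [evalOne_restrictSections, evalOne_thetaMonomial]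
    rw [← map_sum, Finset.sum_attach p.support fun u => MvPolynomial.monomial u (p.coeff u),
      ← p.as_sum]
    rfl
  rw [hsum]
  exact Ideal.sum_mem _ fun u _ => P.restrict_thetaMonomial_mem k H' hn u.1 _ _

/-- On the chart of cone i, the tree of j vanishes along every ray outside cone j. It is therefore
divisible by a character cutting out the common face, and where it is nonzero the point lies in the
chart of that face. -/
lemma mem_range_chartι {i j : J} (y : PrimeSpectrum (F.chartRing k (P.cone i)))
    (hy : F.chartHom L k (P.isGen i) (MvPolynomial.monomial (P.tree j) 1) ∉ y.asIdeal) :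
    F.chartι k (P.coneOf i) y ∈ Set.range (F.chartι k (P.coneOf j)) := by
  obtain ⟨m, hm0, hm1⟩ := exists_faceElement' (P.cone_mem i)
    (Finset.inter_subset_left : P.cone i ∩ P.cone j ⊆ P.cone i)
  have hm : AddMonoidAlgebra.single m (1 : k) ∉ y.asIdeal := by
    intro h
    apply hy
    -- The face character m has order exactly 1 along the rays outside cone j, where the tree has
    -- order at least 1, and order 0 along the others.
    have hsub : (F.localExponent L (P.isGen i) (P.tree j) : M) - m ∈ F.dualMonoid (P.cone i) := by
      intro q hq
      rw [map_sub, ray_localExponent (P.isGen i) _ hq]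
      by_cases hq' : q ∈ P.cone j
      · rw [hm0 q (Finset.mem_inter.2 ⟨hq, hq'⟩)]; simp
      · rw [hm1 q hq (by simp [hq'])]
        have := mt (P.div_tree j q).1 hq'
        omega
    have hmul : F.chartHom L k (P.isGen i) (MvPolynomial.monomial (P.tree j) 1) =
        AddMonoidAlgebra.single m (1 : k) * AddMonoidAlgebra.single ⟨_, hsub⟩ (1 : k) := by
      rw [chartHom_monomial, AddMonoidAlgebra.single_mul_single, one_mul]
      congr 1
      ext; simp
    rw [hmul]
    exact Ideal.mul_mem_right _ _ h
  obtain ⟨z, hz⟩ := (range_faceMap k Finset.inter_subset_left hm0 hm1 y).2 hm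
  let I : F.cones := ⟨P.cone i ∩ P.cone j, F.face_mem _ (P.cone_mem i) _ Finset.inter_subset_left⟩
  let z' : (F.charts k).obj I := z
  let fi : I ⟶ P.coneOf i := homOfLE Finset.inter_subset_left
  let fj : I ⟶ P.coneOf j := homOfLE Finset.inter_subset_right
  refine ⟨(F.charts k).map fj z', ?_⟩
  have hz' : (F.charts k).map fi z' = y := hz
  rw [← Scheme.Hom.comp_apply, map_chartι, ← hz', ← Scheme.Hom.comp_apply, map_chartι]

lemma exists_chart (x : F.toricVariety k) : ∃ j, ∃ y, F.chartι k (P.coneOf j) y = x := by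
  obtain ⟨S, y, hy⟩ := Scheme.IsLocallyDirected.ι_jointly_surjective (F.charts k) x
  let h : S ⟶ P.coneOf (P.maxIndex S) := homOfLE (P.le_maxIndex S)
  refine ⟨P.maxIndex S, (F.charts k).map h y, ?_⟩
  rw [← Scheme.Hom.comp_apply, map_chartι]
  exact hy

lemma chartι_coneOf_toImage (j : J) :
    F.chartι k (P.coneOf j) ≫ P.toImage k = P.chartToImage k j subset_rfl :=
  P.chartι_toImage k (P.coneOf j) subset_rfl

/-- Equality, not mere inclusion, is needed: it identifies the restriction of `toImage` over
`imageOpen` with the map of one chart. -/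
lemma range_chartι (j : J) : Set.range (F.chartι k (P.coneOf j)) =
    (P.toImage k ⁻¹ᵁ P.imageOpen k j : Set (F.toricVariety k)) := by
  ext x
  constructor
  · rintro ⟨y, rfl⟩
    change P.toImage k (F.chartι k (P.coneOf j) y) ∈ P.imageOpen k j
    rw [← Scheme.Hom.comp_apply, chartι_coneOf_toImage]
    exact opensRange_specToProj_le (sectionGrading (imagePieces F L k)) _ one_pos
      (P.treeQuot_mem k j) (P.isUnit_quotHom_tree k j subset_rfl (P.isGen j)) y
  · intro hx
    obtain ⟨i, y, rfl⟩ := P.exists_chart k x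
    refine P.mem_range_chartι k y ?_
    have hx' : P.toImage k (F.chartι k (P.coneOf i) y) ∈ P.imageOpen k j := hx
    rw [← Scheme.Hom.comp_apply, chartι_coneOf_toImage] at hx'
    have h := specToProj_preimage_basicOpen (sectionGrading (imagePieces F L k))
      ((P.quotHom k (P.isGen i)).comp (evalOne (imagePieces F L k))) one_pos
      (P.treeQuot_mem k i) (P.isUnit_quotHom_tree k i subset_rfl _) one_pos (P.treeQuot_mem k j)
    have hy : y ∈ PrimeSpectrum.basicOpen ((P.quotHom k (P.isGen i)).comp
        (evalOne (imagePieces F L k)) (P.treeQuot k j)) := by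
      rw [← h]; exact hx'
    rw [quotHom_treeQuot] at hy
    rw [chartHom_monomial]
    exact hy

lemma _root_.SpecialMcKay.isIso_morphismRestrict {W X Y : Scheme.{u}} (e : X ⟶ Y) (U : Y.Opens)
    (c : W ⟶ X) [IsOpenImmersion c] (g : W ⟶ Y) (hgi : IsOpenImmersion g) (hg : c ≫ e = g)
    (h1 : Set.range c = (e ⁻¹ᵁ U : Set X)) (h2 : Set.range g = (U : Set Y)) : IsIso (e ∣_ U) := by
  have h : e ∣_ U = (IsOpenImmersion.isoOfRangeEq c (e ⁻¹ᵁ U).ι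
      (by rw [h1, Scheme.Opens.range_ι])).inv ≫
      (IsOpenImmersion.isoOfRangeEq g U.ι (by rw [h2, Scheme.Opens.range_ι])).hom := by
    rw [← cancel_mono U.ι, Category.assoc, IsOpenImmersion.isoOfRangeEq_hom_fac, ← hg,
      IsOpenImmersion.isoOfRangeEq_inv_fac_assoc, morphismRestrict_ι]
  rw [h]
  infer_instance

/-- Being an isomorphism is local on the target. Over the open set of the j-th tree, both source and
target are the chart of the j-th cone. -/
instance isIso_toImage : IsIso (P.toImage k) := by
  refine (IsZariskiLocalAtTarget.iff_of_iSup_eq_top (P := MorphismProperty.isomorphisms Scheme)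
    (P.imageOpen k) (P.iSup_imageOpen k)).2 fun j => ?_
  exact isIso_morphismRestrict (P.toImage k) (P.imageOpen k j) (F.chartι k (P.coneOf j))
    (P.chartToImage k j subset_rfl) (P.chartToImage_isOpenImmersion k j) (P.chartι_coneOf_toImage k j) (P.range_chartι k j) (P.range_chartToImage k j)

end ChartData
end SmoothFan

/-! ### Closed immersions between quotients, and maps into the semistable locus -/

lemma morphismRestrict_eq {W W' X Y : Scheme.{u}} (e : X ⟶ Y) (U : Y.Opens)
    (c : W ⟶ X) [IsOpenImmersion c] (g : W' ⟶ Y) [IsOpenImmersion g] (h : W ⟶ W')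
    (hg : c ≫ e = h ≫ g) (h1 : Set.range c = (e ⁻¹ᵁ U : Set X))
    (h2 : Set.range g = (U : Set Y)) :
    e ∣_ U = (IsOpenImmersion.isoOfRangeEq c (e ⁻¹ᵁ U).ι
      (by rw [h1, Scheme.Opens.range_ι])).inv ≫ h ≫
      (IsOpenImmersion.isoOfRangeEq g U.ι (by rw [h2, Scheme.Opens.range_ι])).hom := by
  rw [← cancel_mono U.ι, Category.assoc, Category.assoc, IsOpenImmersion.isoOfRangeEq_hom_fac, ← hg,
    IsOpenImmersion.isoOfRangeEq_inv_fac_assoc, morphismRestrict_ι]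

section

variable {A B σ σ' : Type u} [CommRing A] [SetLike σ A] [AddSubgroupClass σ A] {𝒜 : ℕ → σ}
  [GradedRing 𝒜] [CommRing B] [SetLike σ' B] [AddSubgroupClass σ' B] {ℬ : ℕ → σ'} [GradedRing ℬ]

/-- A graded ring homomorphism that is surjective in each degree induces a closed immersion. -/
lemma isClosedImmersion_projMap (ψ : 𝒜 →+*ᵍ ℬ)
    (hψ : HomogeneousIdeal.irrelevant ℬ ≤ (HomogeneousIdeal.irrelevant 𝒜).map ψ)
    (hs : ∀ n, ∀ y ∈ ℬ n, ∃ x ∈ 𝒜 n, ψ x = y) : IsClosedImmersion (Proj.map ψ hψ) := by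
  let U : {ds : ℕ × A // 0 < ds.1 ∧ ds.2 ∈ 𝒜 ds.1} → (Proj 𝒜).Opens :=
    fun i => Proj.basicOpen 𝒜 i.1.2
  have hU : ⨆ i, U i = ⊤ := by
    refine top_le_iff.1 fun x _ => Opens.mem_iSup.2 ?_
    by_contra! H
    refine x.not_irrelevant_le ?_
    rw [HomogeneousIdeal.irrelevant_le]
    intro n hn y hy
    by_contra h
    exact H ⟨(n, y), hn, hy⟩ h
  refine (IsZariskiLocalAtTarget.iff_of_iSup_eq_top (P := @IsClosedImmersion) U hU).2 ?_
  rintro ⟨⟨d, s⟩, hd, hsd⟩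
  -- Only numerators need lifting, since the denominators are powers of ψ s.
  have hsurj : Function.Surjective (HomogeneousLocalization.Away.map ψ s) := by
    intro z
    obtain ⟨n, y, hy, rfl⟩ := HomogeneousLocalization.Away.mk_surjective ℬ (ψ.2 hsd) z
    obtain ⟨x, hx, rfl⟩ := hs _ y hy
    exact ⟨HomogeneousLocalization.Away.mk 𝒜 hsd n x hx,
      HomogeneousLocalization.Away.map_mk ..⟩
  have hc : IsClosedImmersion (Spec.map (CommRingCat.ofHom (HomogeneousLocalization.Away.map ψ s))) :=
    IsClosedImmersion.spec_of_surjective _ hsurj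
  rw [morphismRestrict_eq (Proj.map ψ hψ) (Proj.basicOpen 𝒜 s) (Proj.awayι ℬ (ψ s) (ψ.2 hsd) hd)
    (Proj.awayι 𝒜 s hsd hd) _ (Proj.awayι_comp_map ψ hψ hd s hsd)
    (congrArg (fun U : (Proj ℬ).Opens => (U : Set (Proj ℬ)))
      (Proj.opensRange_awayι ℬ (ψ s) (ψ.2 hsd) hd))
    (congrArg (fun U : (Proj 𝒜).Opens => (U : Set (Proj 𝒜))) (Proj.opensRange_awayι 𝒜 s hsd hd))]
  infer_instance

end

section GIT

variable {k : Type u} [Field k] {R : Type u} [CommRing R] [Algebra k R]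
  (𝒮 : ℕ → Submodule k R) [SetLike.GradedMonoid 𝒮]

lemma isClosedImmersion_gitClosed (I : Ideal R) : IsClosedImmersion (gitClosed 𝒮 I) := by
  refine isClosedImmersion_projMap _ _ fun n y hy => ?_
  obtain ⟨p, hp, hpy⟩ := evalOne_mem _ hy
  have hm := sectionRing.monomial_mem 𝒮 n ⟨p, hp⟩
  refine ⟨sectionRing.monomial 𝒮 n ⟨p, hp⟩, hm,
    eq_of_evalOne_eq _ ((restrictSections 𝒮 I).2 hm) hy ?_⟩
  rw [evalOne_restrictSections, evalOne_monomial, ← hpy]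
  rfl

lemma pullbackFun_gitFun {B : Type u} [CommRing B]
    (h : Spec (CommRingCat.of B) ⟶ (semistableLocus 𝒮).toScheme) (g : R →+* B)
    (hg : h ≫ (semistableLocus 𝒮).ι = Spec.map (CommRingCat.ofHom g)) :
    (pullbackFun h).comp (gitFun 𝒮) = g.comp (evalOne 𝒮) := by
  have h1 : (pullbackFun h).comp ((semistableLocus 𝒮).ι.appTop.hom.comp
      (Scheme.ΓSpecIso (CommRingCat.of R)).inv.hom) = g := by
    have h2 : (Scheme.ΓSpecIso (CommRingCat.of R)).inv ≫ (semistableLocus 𝒮).ι.appTop ≫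
        h.appTop ≫ (Scheme.ΓSpecIso (CommRingCat.of B)).hom = CommRingCat.ofHom g := by
      rw [← Scheme.Hom.comp_appTop_assoc, hg, Scheme.ΓSpecIso_naturality, Iso.inv_hom_id_assoc]
    exact congrArg CommRingCat.Hom.hom h2
  rw [gitFun, ← RingHom.comp_assoc, h1]

/-- All computations with the quotient map reduce to this: on an affine scheme carrying an
invertible semi-invariant, the quotient map is the restriction of g to the semi-invariants. -/
lemma comp_gitMap {B : Type u} [CommRing B]
    (h : Spec (CommRingCat.of B) ⟶ (semistableLocus 𝒮).toScheme) (g : R →+* B)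
    (hg : h ≫ (semistableLocus 𝒮).ι = Spec.map (CommRingCat.ofHom g)) {d : ℕ} (hd : 0 < d)
    {t : sectionRing 𝒮} (ht : t ∈ sectionGrading 𝒮 d) (hu : IsUnit (g.comp (evalOne 𝒮) t)) :
    h ≫ gitMap 𝒮 = specToProj (sectionGrading 𝒮) (g.comp (evalOne 𝒮)) hd ht hu := by
  have e := pullbackFun_gitFun 𝒮 h g hg
  have hu' : IsUnit ((pullbackFun h).comp (gitFun 𝒮) t) := by rw [e]; exact hu
  refine (comp_toProj (sectionGrading 𝒮) (gitFun 𝒮) (gitFun_cover 𝒮) hd ht h hu').trans ?_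
  congr 1

omit [SetLike.GradedMonoid 𝒮] in
lemma mem_semistableLocus {d : ℕ} (hd : 0 < d) {s : R} (hs : s ∈ 𝒮 d)
    (x : Spec (CommRingCat.of R)) (hx : s ∉ x.asIdeal) : x ∈ semistableLocus 𝒮 :=
  Opens.mem_iSup.2 ⟨⟨d, s, hd, hs⟩, hx⟩

omit [SetLike.GradedMonoid 𝒮] in
lemma range_specMap_le_semistableLocus {B : Type u} [CommRing B] (g : R →+* B) {d : ℕ}
    (hd : 0 < d) {s : R} (hs : s ∈ 𝒮 d) (hu : IsUnit (g s)) :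
    Set.range (Spec.map (CommRingCat.ofHom g)) ⊆ Set.range (semistableLocus 𝒮).ι := by
  rw [Scheme.Opens.range_ι]
  rintro _ ⟨x, rfl⟩
  refine mem_semistableLocus 𝒮 hd hs _ fun h => ?_
  exact x.2.ne_top (Ideal.eq_top_of_isUnit_mem _ h hu)

/-- The morphism to the semistable locus given by a ring homomorphism that maps a semi-invariant
to a unit. -/
def toSemistable {B : Type u} [CommRing B] (g : R →+* B) {d : ℕ} (hd : 0 < d) {s : R}
    (hs : s ∈ 𝒮 d) (hu : IsUnit (g s)) :
    Spec (CommRingCat.of B) ⟶ (semistableLocus 𝒮).toScheme :=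
  IsOpenImmersion.lift (semistableLocus 𝒮).ι (Spec.map (CommRingCat.ofHom g))
    (range_specMap_le_semistableLocus 𝒮 g hd hs hu)

omit [SetLike.GradedMonoid 𝒮] in
lemma toSemistable_ι {B : Type u} [CommRing B] (g : R →+* B) {d : ℕ} (hd : 0 < d) {s : R}
    (hs : s ∈ 𝒮 d) (hu : IsUnit (g s)) :
    toSemistable 𝒮 g hd hs hu ≫ (semistableLocus 𝒮).ι = Spec.map (CommRingCat.ofHom g) :=
  IsOpenImmersion.lift_fac ..

end GIT

/-! ### The closed immersion as the unique descent from the Cox construction -/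

namespace SmoothFan

variable {M : Type} [AddCommGroup M] {ι : Type} [DecidableEq ι] {F : SmoothFan M ι}
  {l : ℕ} {L : Fin (l + 1) → ι → ℤ}

section

variable (F) (k : Type u) [Field k]

/-- The open immersion of the chart of a cone, as a morphism from the spectrum of the chart. -/
def specChartι (S : F.cones) : Spec (CommRingCat.of (F.chartRing k S.1)) ⟶ F.toricVariety k :=
  F.chartι k S

instance specChartι_isOpenImmersion (S : F.cones) : IsOpenImmersion (F.specChartι k S) :=
  F.chartι_isOpenImmersion k S

lemma specMap_faceMap_specChartι {S T : F.cones} (h : S.1 ⊆ T.1) :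
    Spec.map (CommRingCat.ofHom (F.faceMap k h)) ≫ F.specChartι k T = F.specChartι k S :=
  F.map_chartι k (homOfLE h : S ⟶ T)

variable {F k} in
lemma toricVariety_hom_ext {Y : Scheme.{u}} {φ ψ : F.toricVariety k ⟶ Y}
    (h : ∀ S, F.specChartι k S ≫ φ = F.specChartι k S ≫ ψ) : φ = ψ :=
  colimit.hom_ext h

lemma exists_specChartι_eq (x : F.toricVariety k) :
    ∃ S : F.cones, ∃ y, F.specChartι k S y = x := by
  obtain ⟨S, y, hy⟩ := Scheme.IsLocallyDirected.ι_jointly_surjective (F.charts k) x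
  exact ⟨S, y, hy⟩

lemma specChartι_coxQuotient (S : F.coxFan.cones) :
    F.coxFan.specChartι k S ≫ F.coxQuotient k = Spec.map (CommRingCat.ofHom
      (AddMonoidAlgebra.mapDomainRingHom k (F.coxExponent S.1))) ≫ F.specChartι k ⟨S.1, S.2⟩ :=
  colimit.ι_desc _ S

lemma specChartι_coxToAffine (S : F.coxFan.cones) :
    F.coxFan.specChartι k S ≫ F.coxToAffine k =
      Spec.map (CommRingCat.ofHom (F.coxInclusion k S.1)) :=
  colimit.ι_desc _ S

end

namespace ChartData

variable {J : Type} (P : F.ChartData L J) (k : Type u) [Field k]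

/-- The morphism `X ⟶ |L|`. -/
def toSeries : F.toricVariety k ⟶ F.linearSeries L k := P.toImage k ≫ F.toricImageι L k

instance isClosedImmersion_toSeries : IsClosedImmersion (P.toSeries k) := by
  have h : IsClosedImmersion (F.toricImageι L k) := isClosedImmersion_gitClosed _ _
  have h' : IsClosedImmersion (P.toImage k) := inferInstance
  unfold toSeries
  exact IsClosedImmersion.comp _ _

lemma isUnit_chartHom_treeSection (j : J) {S : Finset ι} (hS : S ⊆ P.cone j)
    {g : Fin (l + 1) → M} (hg : F.AreLocalGenerators L S g) :
    IsUnit ((F.chartHom L k hg).comp (evalOne (F.thetaPieces L k)) (P.treeSection k j)) := by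
  rw [RingHom.comp_apply, evalOne_treeSection]
  exact P.isUnit_chartHom_tree k j hS hg

/-- The morphism from the chart of a cone to the multigraded linear series. -/
def chartToSeries (j : J) {S : Finset ι} (hS : S ⊆ P.cone j) {g : Fin (l + 1) → M}
    (hg : F.AreLocalGenerators L S g) :
    Spec (CommRingCat.of (F.chartRing k S)) ⟶ F.linearSeries L k :=
  specToProj (sectionGrading (F.thetaPieces L k))
    ((F.chartHom L k hg).comp (evalOne (F.thetaPieces L k))) one_pos
    (P.treeSection_mem k j) (P.isUnit_chartHom_treeSection k j hS hg)

/-- The generators g are arbitrary, not only those of the chart data. This freedom is used to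
compare with trivializations chosen on smaller cones, in particular on the torus. -/
lemma specChartι_toSeries (S : F.cones) {j : J} (hS : S.1 ⊆ P.cone j) {g : Fin (l + 1) → M}
    (hg : F.AreLocalGenerators L S.1 g) :
    F.specChartι k S ≫ P.toSeries k = P.chartToSeries k j hS hg := by
  have h : F.specChartι k S ≫ P.toImage k = P.chartToImage k j hS := P.chartι_toImage k S hS
  rw [toSeries, ← Category.assoc, h]
  have e : ((P.quotHom k ((P.isGen j).mono hS)).comp
      (evalOne (quotPieces (F.thetaPieces L k) (F.toricIdeal L k)))).comp
      ((restrictSections (F.thetaPieces L k) (F.toricIdeal L k) :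
        sectionRing (F.thetaPieces L k) →+* _)) =
      (F.chartHom L k ((P.isGen j).mono hS)).comp (evalOne (F.thetaPieces L k)) := by
    refine RingHom.ext fun x => ?_
    change P.quotHom k _ (evalOne _ (restrictSections _ _ x)) = _
    rw [evalOne_restrictSections, quotHom_mk]
    rfl
  have hu := P.isUnit_chartHom_treeSection k j hS ((P.isGen j).mono hS)
  refine (specToProj_map (sectionGrading (imagePieces F L k))
    (restrictSections (F.thetaPieces L k) (F.toricIdeal L k))
    (restrictSections_irrelevant _ _) _ one_pos (P.treeSection_mem k j) _ _
    (by rw [e]; exact hu)).trans ?_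
  -- Passing from the generators of the chart data to g is a rescaling by powers of a unit.
  refine specToProj_twist _ (unitChar k (∑ i, theta l i • (P.gen j i - g i))
    (ray_sub_localGenerators ((P.isGen j).mono hS) hg (theta l))) (fun n x hx => ?_) ..
  rw [e]
  exact chartHom_change_theta k ((P.isGen j).mono hS) hg n (evalOne_mem _ hx)

variable (F) in
/-- The exponent of the Cox monomial of the divisor of `y^u`. -/
def divExponent (L : Fin (l + 1) → ι → ℤ) (S : Finset ι) :
    (F.Arrow L →₀ ℕ) →+ F.coxFan.dualMonoid S where
  toFun u := ⟨fun q => F.totalDiv L u q, fun _ _ => Int.natCast_nonneg _⟩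
  map_zero' := by ext; simp
  map_add' u v := by ext; simp

section

variable [Fintype ι]

lemma coxInclusion_labelMap (S : Finset ι) (u : F.Arrow L →₀ ℕ) (c : k) :
    F.coxInclusion k S (F.labelMap L k (MvPolynomial.monomial u c)) =
      AddMonoidAlgebra.single (divExponent F L S u) c := by
  have h : (F.coxInclusion k S).comp (F.labelMap L k) =
      AddMonoidAlgebra.mapDomainRingHom k (divExponent F L S) := by
    refine MvPolynomial.ringHom_ext (fun c => ?_) fun a => ?_
    · have h1 : F.labelMap L k (MvPolynomial.C c) = MvPolynomial.C c :=
        MvPolynomial.aeval_C _ c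
      rw [RingHom.comp_apply, h1, coxInclusion, MvPolynomial.coe_eval₂Hom, MvPolynomial.eval₂_C]
      refine Eq.trans ?_ (AddMonoidAlgebra.mapDomain_single ..).symm
      rw [map_zero]
      rfl
    · have h1 : F.labelMap L k (MvPolynomial.X a) =
          ∏ i, (MvPolynomial.X i : MvPolynomial ι k) ^ a.div i := MvPolynomial.aeval_X _ a
      rw [RingHom.comp_apply, h1, map_prod]
      simp only [map_pow, coxInclusion, MvPolynomial.coe_eval₂Hom, MvPolynomial.eval₂_X]
      refine Eq.trans ?_ (AddMonoidAlgebra.mapDomain_single ..).symm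
      simp only [AddMonoidAlgebra.single_pow, one_pow]
      change ∏ i, AddMonoidAlgebra.of k (F.coxFan.dualMonoid S) (Multiplicative.ofAdd _) =
        AddMonoidAlgebra.of k (F.coxFan.dualMonoid S) (Multiplicative.ofAdd _)
      rw [← map_prod, ← ofAdd_sum]
      congr 2
      ext q
      simp [totalDiv, Finsupp.weight_single, Pi.single_apply]
  refine (RingHom.congr_fun h (MvPolynomial.monomial u c)).trans ?_
  exact AddMonoidAlgebra.mapDomain_single ..

-- The divisor L i + div(g i) of the section given by g i is supported outside S, so the Cox
-- monomial with this ϑ-weighted exponent is invertible on the chart.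
omit [Fintype ι] in
lemma ray_coxUnit {S : Finset ι} {g : Fin (l + 1) → M} (hg : F.AreLocalGenerators L S g)
    (q : ι) (hq : q ∈ S) :
    F.coxFan.ray q (fun q => ∑ i, theta l i * (L i q + F.ray q (g i))) = 0 := by
  change ∑ i, theta l i * (L i q + F.ray q (g i)) = 0
  refine Finset.sum_eq_zero fun i _ => ?_
  rw [hg i q hq, add_neg_cancel, mul_zero]

/-- In degree n, the label in the Cox ring and the pullback of the trivialized function differ by
the n-th power of the unit from `ray_coxUnit`. So both give the same map to Proj. -/
lemma cox_change {S : Finset ι} {g : Fin (l + 1) → M} (hg : F.AreLocalGenerators L S g) (n : ℕ)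
    {p : MvPolynomial (F.Arrow L) k} (hp : p ∈ F.thetaPieces L k n) :
    F.coxInclusion k S (F.labelMap L k p) =
      (unitChar k _ (ray_coxUnit hg) : F.coxFan.chartRing k S) ^ n *
      AddMonoidAlgebra.mapDomainRingHom k (F.coxExponent S) (F.chartHom L k hg p) := by
  have h0 : ∀ q ∈ S, F.coxFan.ray q
      (n • fun q => ∑ i, theta l i * (L i q + F.ray q (g i))) = 0 := fun q hq => by
    rw [map_nsmul, ray_coxUnit hg q hq, smul_zero]
  rw [unitChar_pow k _ (ray_coxUnit hg) n _ h0 rfl, p.as_sum]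
  simp only [map_sum]
  rw [Finset.mul_sum]
  refine Finset.sum_congr rfl fun u hu => ?_
  have hw : F.totalInc L u = n • theta l := hp (MvPolynomial.mem_support_iff.1 hu)
  rw [chartHom_monomial, coxInclusion_labelMap]
  have h1 : AddMonoidAlgebra.mapDomainRingHom k (F.coxExponent S)
      (AddMonoidAlgebra.single (F.localExponent L hg u) (p.coeff u)) =
      AddMonoidAlgebra.single (F.coxExponent S (F.localExponent L hg u)) (p.coeff u) :=
    AddMonoidAlgebra.mapDomain_single ..
  rw [h1, unitChar, AddMonoidAlgebra.single_mul_single, one_mul]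
  congr 1
  ext q
  change (F.totalDiv L u q : ℤ) = n • (∑ i, theta l i * (L i q + F.ray q (g i))) +
    F.ray q (F.totalChar L u - ∑ i, F.totalInc L u i • g i)
  rw [map_sub, ray_totalChar, map_sum, hw]
  simp only [Pi.smul_apply, map_zsmul, smul_eq_mul, nsmul_eq_mul, mul_add, Finset.sum_add_distrib,
    Finset.mul_sum, mul_assoc]
  ring

-- By smoothness the rays of a maximal cone have a dual family e, and `ray_injective` makes it a
-- basis of M. Hence v ↦ Σ v_i e_i is a retraction of m ↦ div(χ^m).
omit [Fintype ι] in
lemma exists_cox_section (j : J) : ∃ s : F.coxFan.dualMonoid (P.cone j) →+ F.dualMonoid (P.cone j),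
    ∀ m, s (F.coxExponent (P.cone j) m) = m := by
  choose! e he he' using F.smooth (P.cone j) (P.cone_mem j)
  have hray : ∀ (v : ι → ℤ) (q : ι), q ∈ P.cone j →
      F.ray q (∑ i ∈ P.cone j, v i • e i) = v q := fun v q hq => by
    rw [map_sum, Finset.sum_eq_single q]
    · rw [map_zsmul, he q hq, smul_eq_mul, mul_one]
    · intro i hi hiq
      rw [map_zsmul, he' i hi q hq hiq.symm, smul_zero]
    · exact fun h => absurd hq h
  refine ⟨{ toFun := fun v => ⟨∑ i ∈ P.cone j, v.1 i • e i, fun q hq => ?_⟩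
            map_zero' := ?_
            map_add' := ?_ }, fun m => ?_⟩
  · rw [hray v.1 q hq]; exact v.2 q hq
  · ext; simp
  · intro v w
    ext
    simp [add_smul, Finset.sum_add_distrib]
  · ext
    rw [← sub_eq_zero]
    refine P.ray_injective j _ fun q hq => ?_
    rw [map_sub, sub_eq_zero]
    exact hray (fun q => F.ray q m) q hq

-- The retraction on exponents gives a section of the Cox quotient over each maximal chart, and
-- these charts cover. This is what makes the descent unique.
include P in
omit [Fintype ι] in
lemma cancel_coxQuotient {Y : Scheme.{u}} {φ ψ : F.toricVariety k ⟶ Y}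
    (h : F.coxQuotient k ≫ φ = F.coxQuotient k ≫ ψ) : φ = ψ := by
  have hj : ∀ j, F.specChartι k (P.coneOf j) ≫ φ = F.specChartι k (P.coneOf j) ≫ ψ := fun j => by
    obtain ⟨s, hs⟩ := P.exists_cox_section j
    let S : F.coxFan.cones := ⟨P.cone j, P.cone_mem j⟩
    have hsec : (AddMonoidAlgebra.mapDomainRingHom k s).comp
        (AddMonoidAlgebra.mapDomainRingHom k (F.coxExponent S.1)) = RingHom.id _ := by
      refine RingHom.ext fun f => ?_
      induction f using AddMonoidAlgebra.induction_linear with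
      | zero => simp
      | add f g hf hg => rw [map_add, map_add, hf, hg]
      | single m x =>
        rw [RingHom.comp_apply, AddMonoidAlgebra.mapDomainRingHom_apply,
          AddMonoidAlgebra.mapDomainRingHom_apply, AddMonoidAlgebra.mapDomain_single,
          AddMonoidAlgebra.mapDomain_single, hs]
        rfl
    let σ : Spec (CommRingCat.of (F.chartRing k (P.coneOf j).1)) ⟶
        Spec (CommRingCat.of (F.coxFan.chartRing k S.1)) :=
      Spec.map (CommRingCat.ofHom (AddMonoidAlgebra.mapDomainRingHom k s))
    have hc : F.specChartι k (P.coneOf j) = σ ≫ F.coxFan.specChartι k S ≫ F.coxQuotient k := by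
      change _ = Spec.map (CommRingCat.ofHom (AddMonoidAlgebra.mapDomainRingHom k s)) ≫
        F.coxFan.specChartι k S ≫ F.coxQuotient k
      rw [specChartι_coxQuotient, ← Category.assoc, ← Spec.map_comp, ← CommRingCat.ofHom_comp, hsec]
      exact ((congrArg (· ≫ _) (Spec.map_id _)).trans (Category.id_comp _)).symm
    have hσ : ∀ χ : F.toricVariety k ⟶ Y, (σ ≫ F.coxFan.specChartι k S ≫ F.coxQuotient k) ≫ χ =
        σ ≫ F.coxFan.specChartι k S ≫ F.coxQuotient k ≫ χ := fun χ => by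
      rw [Category.assoc, Category.assoc]
    rw [hc, hσ, hσ, h]
  refine toricVariety_hom_ext fun S => ?_
  rw [← specMap_faceMap_specChartι F k (T := P.coneOf (P.maxIndex S)) (P.le_maxIndex S),
    Category.assoc, Category.assoc, hj]

/-- On each chart both composites come from ring homomorphisms on the semi-invariants, and
`cox_change` says that these differ by powers of a unit. -/
lemma isDescent_toSeries : F.IsDescent L k (P.toSeries k) := by
  have hchart : ∀ S : F.coxFan.cones, F.coxFan.specChartι k S ≫ F.coxToAffine k ≫
      Spec.map (CommRingCat.ofHom (F.labelMap L k)) =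
      Spec.map (CommRingCat.ofHom ((F.coxInclusion k S.1).comp (F.labelMap L k))) := fun S => by
    rw [← Category.assoc, specChartι_coxToAffine, CommRingCat.ofHom_comp, Spec.map_comp]
  have hunit : ∀ (S : F.coxFan.cones) j, S.1 ⊆ P.cone j →
      IsUnit ((F.coxInclusion k S.1).comp (F.labelMap L k)
        (MvPolynomial.monomial (P.tree j) 1)) := fun S j hj => by
    rw [RingHom.comp_apply, coxInclusion_labelMap]
    refine isUnit_single k _ fun q hq => ?_
    exact Nat.cast_eq_zero.2 ((P.div_tree j q).2 (hj hq))
  have htree : ∀ j, MvPolynomial.monomial (P.tree j) (1 : k) ∈ F.thetaPieces L k 1 :=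
    fun j => monomial_mem_weightPiece k _ _ (P.inc_tree' j)
  -- The tree of a maximal cone containing S becomes a Cox monomial without zeroes on the chart of
  -- S, so the chart lands in the semistable locus.
  have hrange : Set.range (F.coxToAffine k ≫ Spec.map (CommRingCat.ofHom (F.labelMap L k))) ⊆
      Set.range (semistableLocus (F.thetaPieces L k)).ι := by
    rintro _ ⟨x, rfl⟩
    obtain ⟨S, y, rfl⟩ := F.coxFan.exists_specChartι_eq k x
    obtain ⟨j, hj⟩ := P.exists_le S.1 S.2
    refine range_specMap_le_semistableLocus (F.thetaPieces L k) _ one_pos (htree j) (hunit S j hj)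
      ⟨y, ?_⟩
    rw [← hchart S, Scheme.Hom.comp_apply]
  refine ⟨IsOpenImmersion.lift _ _ hrange, IsOpenImmersion.lift_fac _ _ _, ?_⟩
  refine toricVariety_hom_ext fun S => ?_
  obtain ⟨j, hj⟩ := P.exists_le S.1 S.2
  have hg : AreLocalGenerators (F := F) (L := L) S.1 (P.gen j) := (P.isGen j).mono hj
  have e1 := comp_gitMap (F.thetaPieces L k)
    (F.coxFan.specChartι k S ≫ IsOpenImmersion.lift _ _ hrange)
    ((F.coxInclusion k S.1).comp (F.labelMap L k))
    (by rw [Category.assoc, IsOpenImmersion.lift_fac, hchart S]) one_pos (P.treeSection_mem k j)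
    (by rw [RingHom.comp_apply, evalOne_treeSection]; exact hunit S j hj)
  have e2 : F.coxFan.specChartι k S ≫ F.coxQuotient k ≫ P.toSeries k =
      Spec.map (CommRingCat.ofHom (AddMonoidAlgebra.mapDomainRingHom k (F.coxExponent S.1))) ≫
        P.chartToSeries k j hj hg := by
    rw [← Category.assoc, specChartι_coxQuotient, Category.assoc,
      P.specChartι_toSeries k ⟨S.1, S.2⟩ hj hg]
  refine (Category.assoc _ _ _).symm.trans (e1.trans (Eq.trans ?_ e2.symm))
  refine Eq.trans ?_ (specMap_specToProj ..).symm
  refine (specToProj_twist _ (unitChar k _ (ray_coxUnit hg)) (fun n x hx => ?_) ..).symm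
  exact cox_change k hg n (evalOne_mem _ hx)

/-- The lift to the semistable locus is unique, as its inclusion is a monomorphism; then the Cox
quotient is cancelled. -/
lemma eq_toSeries_of_isDescent (ψ : F.toricVariety k ⟶ F.linearSeries L k)
    (h : F.IsDescent L k ψ) : ψ = P.toSeries k := by
  obtain ⟨Φ, h1, h2⟩ := h
  obtain ⟨Φ', h1', h2'⟩ := P.isDescent_toSeries k
  have e : Φ = Φ' := by rw [← cancel_mono (semistableLocus (F.thetaPieces L k)).ι, h1, h1']
  refine P.cancel_coxQuotient k ?_
  rw [← h2, ← h2', e]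

end

end ChartData
end SmoothFan

/-! ### Recognizing the pullback of a sheaf of modules by local frames -/

section Pullback

open Opposite

variable {X Y : Scheme.{u}}

/-- Restriction of the sections of a sheaf of modules. -/
def resMod (K : X.Modules) {U V : X.Opens} (h : U ≤ V) : Γ(K, V) →+ Γ(K, U) :=
  (K.presheaf.map (homOfLE h).op).hom

/-- Restriction of functions. -/
def resFun {U V : X.Opens} (h : U ≤ V) : Γ(X, V) →+* Γ(X, U) :=
  (X.presheaf.map (homOfLE h).op).hom

lemma resMod_resMod (K : X.Modules) {U V W : X.Opens} (h : U ≤ V) (h' : V ≤ W) (s : Γ(K, W)) :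
    resMod K h (resMod K h' s) = resMod K (h.trans h') s := by
  change (K.presheaf.map (homOfLE h).op) ((K.presheaf.map (homOfLE h').op) s) = _
  rw [← ConcreteCategory.comp_apply, ← Functor.map_comp]
  rfl

lemma resFun_resFun {U V W : X.Opens} (h : U ≤ V) (h' : V ≤ W) (s : Γ(X, W)) :
    resFun h (resFun h' s) = resFun (h.trans h') s := by
  change (X.presheaf.map (homOfLE h).op) ((X.presheaf.map (homOfLE h').op) s) = _
  rw [← ConcreteCategory.comp_apply, ← Functor.map_comp]
  rfl

lemma resMod_smul (K : X.Modules) {U V : X.Opens} (h : U ≤ V) (r : Γ(X, V)) (s : Γ(K, V)) :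
    resMod K h (r • s) = resFun h r • resMod K h s :=
  Scheme.Modules.map_smul K (homOfLE h) r s

lemma app_resMod {K K' : X.Modules} (γ : K ⟶ K') {U V : X.Opens} (h : U ≤ V) (s : Γ(K, V)) :
    γ.app U (resMod K h s) = resMod K' h (γ.app V s) :=
  CategoryTheory.congr_fun (γ.mapPresheaf.naturality (homOfLE h).op) s

lemma eq_of_locally_eq (K : X.Modules) {U : X.Opens} (s t : Γ(K, U))
    (h : ∀ x ∈ U, ∃ (V : X.Opens) (hV : V ≤ U), x ∈ V ∧ resMod K hV s = resMod K hV t) :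
    s = t := by
  choose V hV hx he using h
  refine TopCat.Sheaf.eq_of_locally_eq' ⟨K.presheaf, K.isSheaf⟩ (fun x : U => V x x.2) U
    (fun x => homOfLE (hV x x.2)) ?_ s t fun x => he x x.2
  exact fun x hxU => Opens.mem_iSup.2 ⟨⟨x, hxU⟩, hx x hxU⟩

lemma exists_gluing (K : X.Modules) {U : X.Opens} {I : Type u} (V : I → X.Opens)
    (hV : ∀ i, V i ≤ U) (hU : ∀ x ∈ U, ∃ i, x ∈ V i) (s : ∀ i, Γ(K, V i))
    (h : ∀ i j, resMod K (inf_le_left : V i ⊓ V j ≤ V i) (s i) =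
      resMod K (inf_le_right : V i ⊓ V j ≤ V j) (s j)) :
    ∃ t : Γ(K, U), ∀ i, resMod K (hV i) t = s i :=
  (TopCat.Sheaf.existsUnique_gluing' ⟨K.presheaf, K.isSheaf⟩ V U (fun i => homOfLE (hV i))
    (fun x hx => Opens.mem_iSup.2 (hU x hx)) s h).exists

/-- A morphism of sheaves of modules from a natural family of linear maps on sections. -/
def modulesHomMk {K K' : X.Modules} (f : ∀ U : X.Opens, Γ(K, U) →+ Γ(K', U))
    (hs : ∀ U (r : Γ(X, U)) s, f U (r • s) = r • f U s)
    (hr : ∀ (U V : X.Opens) (h : U ≤ V) s, f U (resMod K h s) = resMod K' h (f V s)) :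
    K ⟶ K' :=
  ⟨PresheafOfModules.homMk
    { app := fun U => AddCommGrpCat.ofHom (f U.unop)
      naturality := fun U V i => by
        ext s
        exact hr V.unop U.unop (leOfHom i.unop) s }
    fun U r s => hs U.unop r s⟩

variable (φ : X ⟶ Y)

/-- The restriction to `W` of the section of `K` that corresponds to a global section of `N`. -/
def transported {N : Y.Modules} {K : X.Modules} (β : N ⟶ (Scheme.Modules.pushforward φ).obj K)
    (V : Y.Opens) (n : Γ(N, V)) (W : X.Opens) (h : W ≤ φ ⁻¹ᵁ V) : Γ(K, W) :=
  resMod K h (β.app V n)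

variable {φ}

lemma resMod_transported {N : Y.Modules} {K : X.Modules}
    (β : N ⟶ (Scheme.Modules.pushforward φ).obj K) {V : Y.Opens} (n : Γ(N, V)) {W W' : X.Opens}
    (h : W ≤ φ ⁻¹ᵁ V) (h' : W' ≤ W) :
    resMod K h' (transported φ β V n W h) = transported φ β V n W' (h'.trans h) :=
  resMod_resMod ..

lemma transported_resMod {N : Y.Modules} {K : X.Modules}
    (β : N ⟶ (Scheme.Modules.pushforward φ).obj K) {V V' : Y.Opens} (hV : V' ≤ V) (n : Γ(N, V))
    {W : X.Opens} (h : W ≤ φ ⁻¹ᵁ V') :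
    transported φ β V' (resMod N hV n) W h =
      transported φ β V n W (h.trans fun _ hx => hV hx) := by
  unfold transported
  rw [app_resMod]
  exact resMod_resMod K h (fun _ hx => hV hx) _

lemma transported_smul {N : Y.Modules} {K : X.Modules}
    (β : N ⟶ (Scheme.Modules.pushforward φ).obj K) {V : Y.Opens} (r : Γ(Y, V)) (n : Γ(N, V))
    {W : X.Opens} (h : W ≤ φ ⁻¹ᵁ V) :
    transported φ β V (r • n) W h =
      resFun h (φ.app V r : Γ(X, φ ⁻¹ᵁ V)) • transported φ β V n W h := by
  unfold transported
  rw [Scheme.Modules.Hom.app_smul]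
  exact resMod_smul K h (φ.app V r : Γ(X, φ ⁻¹ᵁ V)) _

lemma transported_comp {N : Y.Modules} {B K : X.Modules}
    (α : N ⟶ (Scheme.Modules.pushforward φ).obj B) (γ : B ⟶ K) {V : Y.Opens} (n : Γ(N, V))
    {W : X.Opens} (h : W ≤ φ ⁻¹ᵁ V) :
    transported φ (α ≫ (Scheme.Modules.pushforward φ).map γ) V n W h =
      γ.app W (transported φ α V n W h) := by
  exact (app_resMod γ h (α.app V n : Γ(B, φ ⁻¹ᵁ V))).symm

/-- Global sections of `N` that generate it locally along `φ`, such that the corresponding sections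
of `B` are local bases of `B`. -/
structure LocalFrames {N : Y.Modules} {B : X.Modules}
    (α : N ⟶ (Scheme.Modules.pushforward φ).obj B) (J : Type) where
  opens : J → X.Opens
  section_ : J → Γ(N, ⊤)
  cover : ∀ x, ∃ j, x ∈ opens j
  generates : ∀ j x, x ∈ opens j → ∀ (V : Y.Opens) (n : Γ(N, V)), φ x ∈ V →
    ∃ (V' : Y.Opens) (h : V' ≤ V), φ x ∈ V' ∧ ∃ r : Γ(Y, V'),
      resMod N h n = r • resMod N le_top (section_ j)
  spans : ∀ j x, x ∈ opens j → ∀ (W : X.Opens) (s : Γ(B, W)), x ∈ W →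
    ∃ (W' : X.Opens) (h : W' ≤ W), x ∈ W' ∧ ∃ r : Γ(X, W'),
      resMod B h s = r • transported φ α ⊤ (section_ j) W' le_top
  free : ∀ j (W : X.Opens), W ≤ opens j → ∀ r : Γ(X, W),
    r • transported φ α ⊤ (section_ j) W le_top = 0 → r = 0

namespace LocalFrames

variable {N : Y.Modules} {B K : X.Modules} {α : N ⟶ (Scheme.Modules.pushforward φ).obj B}
  {J : Type} (P : LocalFrames α J) (β : N ⟶ (Scheme.Modules.pushforward φ).obj K)

/-- The restriction to `W` of the section of `K` corresponding to the `j`-th global section. -/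
def frame (j : J) (W : X.Opens) : Γ(K, W) := transported φ β ⊤ (P.section_ j) W le_top

lemma resMod_frame (j : J) {W W' : X.Opens} (h : W' ≤ W) :
    resMod K h (P.frame β j W) = P.frame β j W' := resMod_transported ..

/-- The coefficient relating two global sections is found in N on the target, so its pullback is the
same for α and for β. This is what makes the construction of `desc` independent of the frame. -/
lemma exists_transition (j j' : J) {x : X} (hx : x ∈ P.opens j) {W : X.Opens} (hxW : x ∈ W) :
    ∃ W' ≤ W, x ∈ W' ∧ ∃ ρ : Γ(X, W'), P.frame α j' W' = ρ • P.frame α j W' ∧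
      P.frame β j' W' = ρ • P.frame β j W' := by
  obtain ⟨V, hV, hxV, r, hr⟩ := P.generates j x hx ⊤ (P.section_ j') trivial
  refine ⟨W ⊓ φ ⁻¹ᵁ V, inf_le_left, ⟨hxW, hxV⟩,
    resFun inf_le_right (φ.app V r : Γ(X, φ ⁻¹ᵁ V)), ?_, ?_⟩
  · have h := congrArg (fun n => transported φ α V n (W ⊓ φ ⁻¹ᵁ V) inf_le_right) hr
    simp only [transported_smul, transported_resMod] at h
    exact h
  · have h := congrArg (fun n => transported φ β V n (W ⊓ φ ⁻¹ᵁ V) inf_le_right) hr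
    simp only [transported_smul, transported_resMod] at h
    exact h

/-- The section `t` of `K` corresponds to the section `s` of `B`. -/
def Rel (W : X.Opens) (s : Γ(B, W)) (t : Γ(K, W)) : Prop :=
  ∀ x ∈ W, ∃ (W' : X.Opens) (h : W' ≤ W), x ∈ W' ∧ ∃ j, W' ≤ P.opens j ∧ ∃ r : Γ(X, W'),
    resMod B h s = r • P.frame α j W' ∧ resMod K h t = r • P.frame β j W'

variable {P β}

/-- The index in `Rel` may be prescribed at a point, by passing to the other frame through a common
transition function. -/
lemma Rel.exists_index {W : X.Opens} {s : Γ(B, W)} {t : Γ(K, W)} (H : P.Rel β W s t) {x : X}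
    (hxW : x ∈ W) {j : J} (hj : x ∈ P.opens j) {W₀ : X.Opens} (hx₀ : x ∈ W₀) :
    ∃ (W' : X.Opens) (h : W' ≤ W), W' ≤ W₀ ∧ x ∈ W' ∧ W' ≤ P.opens j ∧ ∃ r : Γ(X, W'),
      resMod B h s = r • P.frame α j W' ∧ resMod K h t = r • P.frame β j W' := by
  obtain ⟨W₁, h₁, hx₁, j', hj', r, hs, ht⟩ := H x hxW
  obtain ⟨W₂, h₂, hx₂, ρ, hα, hβ⟩ := P.exists_transition β j j' hj
    (W := W₁ ⊓ W₀ ⊓ P.opens j) ⟨⟨hx₁, hx₀⟩, hj⟩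
  have h21 : W₂ ≤ W₁ := h₂.trans (inf_le_left.trans inf_le_left)
  refine ⟨W₂, h21.trans h₁, h₂.trans (inf_le_left.trans inf_le_right), hx₂,
    h₂.trans inf_le_right, resFun h21 r * ρ, ?_, ?_⟩
  · rw [← resMod_resMod B h21 h₁, hs, resMod_smul, resMod_frame, hα, mul_smul]
  · rw [← resMod_resMod K h21 h₁, ht, resMod_smul, resMod_frame, hβ, mul_smul]

/-- The frame of B is free, so s determines its coefficient, and the coefficient determines t
locally. -/
lemma Rel.unique {W : X.Opens} {s : Γ(B, W)} {t t' : Γ(K, W)} (H : P.Rel β W s t)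
    (H' : P.Rel β W s t') : t = t' := by
  refine eq_of_locally_eq K _ _ fun x hx => ?_
  obtain ⟨W₁, h₁, hx₁, j, hj, r, hs, ht⟩ := H x hx
  obtain ⟨W₂, h₂, h21, hx₂, hj₂, r', hs', ht'⟩ := H'.exists_index hx (hj hx₁) hx₁
  refine ⟨W₂, h₂, hx₂, ?_⟩
  have e : resFun h21 r - r' = 0 := by
    refine P.free j W₂ hj₂ _ ?_
    change (resFun h21 r - r') • P.frame α j W₂ = 0
    rw [sub_smul, ← hs', ← P.resMod_frame α j h21, ← resMod_smul, ← hs, resMod_resMod, sub_self]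
  rw [ht', ← resMod_resMod K h21 h₁, ht, resMod_smul, resMod_frame, sub_eq_zero.1 e]

lemma Rel.res {W W' : X.Opens} (h : W' ≤ W) {s : Γ(B, W)} {t : Γ(K, W)} (H : P.Rel β W s t) :
    P.Rel β W' (resMod B h s) (resMod K h t) := by
  intro x hx
  obtain ⟨W₁, h₁, hx₁, j, hj, r, hs, ht⟩ := H x (h hx)
  refine ⟨W₁ ⊓ W', inf_le_right, ⟨hx₁, hx⟩, j, inf_le_left.trans hj, resFun inf_le_left r, ?_, ?_⟩
  · rw [resMod_resMod, ← resMod_resMod B inf_le_left h₁, hs, resMod_smul, resMod_frame]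
  · rw [resMod_resMod, ← resMod_resMod K inf_le_left h₁, ht, resMod_smul, resMod_frame]

lemma Rel.add {W : X.Opens} {s s' : Γ(B, W)} {t t' : Γ(K, W)} (H : P.Rel β W s t)
    (H' : P.Rel β W s' t') : P.Rel β W (s + s') (t + t') := by
  intro x hx
  obtain ⟨W₁, h₁, hx₁, j, hj, r, hs, ht⟩ := H x hx
  obtain ⟨W₂, h₂, h21, hx₂, hj₂, r', hs', ht'⟩ := H'.exists_index hx (hj hx₁) hx₁
  refine ⟨W₂, h₂, hx₂, j, hj₂, resFun h21 r + r', ?_, ?_⟩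
  · rw [map_add, hs', ← resMod_resMod B h21 h₁, hs, resMod_smul, resMod_frame, add_smul]
  · rw [map_add, ht', ← resMod_resMod K h21 h₁, ht, resMod_smul, resMod_frame, add_smul]

lemma Rel.smul {W : X.Opens} {s : Γ(B, W)} {t : Γ(K, W)} (H : P.Rel β W s t) (a : Γ(X, W)) :
    P.Rel β W (a • s) (a • t) := by
  intro x hx
  obtain ⟨W₁, h₁, hx₁, j, hj, r, hs, ht⟩ := H x hx
  exact ⟨W₁, h₁, hx₁, j, hj, resFun h₁ a * r, by rw [resMod_smul, hs, mul_smul],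
    by rw [resMod_smul, ht, mul_smul]⟩

variable (P β)

lemma rel_smul_frame {j : J} {W : X.Opens} (h : W ≤ P.opens j) (r : Γ(X, W)) :
    P.Rel β W (r • P.frame α j W) (r • P.frame β j W) := by
  intro x hx
  refine ⟨W, le_rfl, hx, j, h, resFun le_rfl r, ?_, ?_⟩ <;> rw [resMod_smul, resMod_frame]

/-- Locally s is a multiple of a frame, and the corresponding multiples of the frame of K agree on
overlaps by `Rel.unique`, so they glue. -/
lemma exists_rel (W : X.Opens) (s : Γ(B, W)) : ∃ t, P.Rel β W s t := by
  have h : ∀ x : W, ∃ (W' : X.Opens) (h : W' ≤ W), x.1 ∈ W' ∧ ∃ j, W' ≤ P.opens j ∧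
      ∃ r : Γ(X, W'), resMod B h s = r • P.frame α j W' := fun x => by
    obtain ⟨j, hj⟩ := P.cover x.1
    obtain ⟨W₁, h₁, hx₁, r, hr⟩ := P.spans j x.1 hj W s x.2
    refine ⟨W₁ ⊓ P.opens j, inf_le_left.trans h₁, ⟨hx₁, hj⟩, j, inf_le_right,
      resFun inf_le_left r, ?_⟩
    rw [← resMod_resMod B inf_le_left h₁, hr, resMod_smul]
    exact congrArg _ (P.resMod_frame α j inf_le_left)
  choose V hV hx j hj r hr using h
  have hrel : ∀ x, P.Rel β (V x) (resMod B (hV x) s) (r x • P.frame β (j x) (V x)) := fun x => by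
    rw [hr x]
    exact P.rel_smul_frame β (hj x) (r x)
  obtain ⟨t, ht⟩ := exists_gluing K V hV (fun x hx' => ⟨⟨x, hx'⟩, hx ⟨x, hx'⟩⟩)
    (fun x => r x • P.frame β (j x) (V x)) fun x y => by
      have h1 := (hrel x).res (inf_le_left : V x ⊓ V y ≤ V x)
      have h2 := (hrel y).res (inf_le_right : V x ⊓ V y ≤ V y)
      rw [resMod_resMod] at h1 h2
      exact h1.unique h2
  refine ⟨t, fun x hxW => ⟨V ⟨x, hxW⟩, hV _, hx ⟨x, hxW⟩, j _, hj _, r _, hr _, ht _⟩⟩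

/-- The morphism `B ⟶ K` that corresponds to `β : N ⟶ φ_* K`. -/
def desc : B ⟶ K :=
  modulesHomMk (fun W => AddMonoidHom.mk' (fun s => (P.exists_rel β W s).choose) fun s s' =>
      (P.exists_rel β W (s + s')).choose_spec.unique
        ((P.exists_rel β W s).choose_spec.add (P.exists_rel β W s').choose_spec))
    (fun W r s => (P.exists_rel β W (r • s)).choose_spec.unique
      ((P.exists_rel β W s).choose_spec.smul r))
    (fun W W' h s => (P.exists_rel β W (resMod B h s)).choose_spec.unique
      ((P.exists_rel β W' s).choose_spec.res h))

lemma rel_desc (W : X.Opens) (s : Γ(B, W)) : P.Rel β W s ((P.desc β).app W s) :=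
  (P.exists_rel β W s).choose_spec

/-- A morphism out of B carries the frame for α to the frame for the composite; hence `desc`
recovers it. -/
lemma rel_app (γ : B ⟶ K) (W : X.Opens) (s : Γ(B, W)) :
    P.Rel (α ≫ (Scheme.Modules.pushforward φ).map γ) W s (γ.app W s) := by
  obtain ⟨t, ht⟩ := P.exists_rel (α ≫ (Scheme.Modules.pushforward φ).map γ) W s
  intro x hx
  obtain ⟨W₁, h₁, hx₁, j, hj, r, hs, -⟩ := ht x hx
  refine ⟨W₁, h₁, hx₁, j, hj, r, hs, ?_⟩
  rw [← app_resMod, hs, Scheme.Modules.Hom.app_smul]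
  exact congrArg _ (transported_comp α γ _ _).symm

/-- The coefficient with respect to the frame is pulled back from N for both α and β. This gives the
other inverse law in `corepresentableBy`. -/
lemma rel_transported (V : Y.Opens) (n : Γ(N, V)) :
    P.Rel β (φ ⁻¹ᵁ V) (transported φ α V n _ le_rfl) (transported φ β V n _ le_rfl) := by
  intro x hx
  obtain ⟨j, hj⟩ := P.cover x
  obtain ⟨V', h, hx', r, hr⟩ := P.generates j x hj V n hx
  refine ⟨φ ⁻¹ᵁ V' ⊓ P.opens j, inf_le_left.trans fun _ hx => h hx, ⟨hx', hj⟩, j, inf_le_right,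
    resFun inf_le_left (φ.app V' r : Γ(X, φ ⁻¹ᵁ V')), ?_, ?_⟩
  · have e := congrArg (fun n => transported φ α V' n (φ ⁻¹ᵁ V' ⊓ P.opens j) inf_le_left) hr
    simp only [transported_smul, transported_resMod] at e
    rw [resMod_transported]
    exact e
  · have e := congrArg (fun n => transported φ β V' n (φ ⁻¹ᵁ V' ⊓ P.opens j) inf_le_left) hr
    simp only [transported_smul, transported_resMod] at e
    rw [resMod_transported]
    exact e

/-- `B` has the universal property of the pullback of `N`. -/
def corepresentableBy : (Scheme.Modules.pushforward φ ⋙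
    coyoneda.obj (op N)).CorepresentableBy B where
  homEquiv {K} :=
    { toFun := fun γ => α ≫ (Scheme.Modules.pushforward φ).map γ
      invFun := fun β => P.desc β
      left_inv := fun γ => by
        refine Scheme.Modules.hom_ext _ _ fun W => ?_
        ext s
        exact (P.rel_desc _ W s).unique (P.rel_app γ W s)
      right_inv := fun β => by
        refine Scheme.Modules.hom_ext _ _ fun V => ?_
        ext n
        have h1 := P.rel_desc β (φ ⁻¹ᵁ V) (transported φ α V n _ le_rfl)
        have h2 := h1.unique (P.rel_transported β V n)
        rw [← transported_comp] at h2
        have h3 : ∀ β' : N ⟶ (Scheme.Modules.pushforward φ).obj K,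
            transported φ β' V n _ le_rfl = β'.app V n := fun β' => by
          change (K.presheaf.map (𝟙 (op (φ ⁻¹ᵁ V)))) (β'.app V n) = _
          rw [CategoryTheory.Functor.map_id]
          rfl
        rw [h3, h3] at h2
        exact h2 }
  homEquiv_comp {K K'} g f := by
    change α ≫ (Scheme.Modules.pushforward φ).map (f ≫ g) = (α ≫ _) ≫ _
    rw [Functor.map_comp, Category.assoc]

-- The pullback functor is a left adjoint, so it corepresents the same functor as B.
include P in
lemma nonempty_pullback_iso :
    Nonempty ((Scheme.Modules.pullback φ).obj N ≅ B) :=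
  ⟨((Scheme.Modules.pullbackPushforwardAdjunction φ).corepresentableBy N).uniqueUpToIso
    P.corepresentableBy⟩

end LocalFrames

end Pullback


/-! ### Pullback of functions along morphisms -/

section PullbackOfFunctions

variable {X Y Z : Scheme.{u}}

lemma le_preimage_top (h : X ⟶ Y) (V : X.Opens) : V ≤ h ⁻¹ᵁ ⊤ := fun _ _ => trivial

lemma le_preimage_of_le (h : X ⟶ Y) {V : X.Opens} {U U' : Y.Opens} (e : V ≤ h ⁻¹ᵁ U)
    (e' : U ≤ U') : V ≤ h ⁻¹ᵁ U' := fun _ hx => e' (e hx)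

/-- Pullback of functions along a morphism. -/
def pull (h : X ⟶ Y) {U : Y.Opens} {V : X.Opens} (e : V ≤ h ⁻¹ᵁ U) : Γ(Y, U) →+* Γ(X, V) :=
  (h.appLE U V e).hom

lemma pull_comp (f : X ⟶ Y) (g : Y ⟶ Z) {U : Z.Opens} {V : Y.Opens} {W : X.Opens}
    (e₁ : V ≤ g ⁻¹ᵁ U) (e₂ : W ≤ f ⁻¹ᵁ V) (e₃ : W ≤ (f ≫ g) ⁻¹ᵁ U) (s : Γ(Z, U)) :
    pull f e₂ (pull g e₁ s) = pull (f ≫ g) e₃ s :=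
  CategoryTheory.congr_fun (Scheme.Hom.appLE_comp_appLE f g U V W e₁ e₂) s

lemma pull_congr {f g : X ⟶ Y} (h : f = g) {U : Y.Opens} {V : X.Opens} (e : V ≤ f ⁻¹ᵁ U)
    (e' : V ≤ g ⁻¹ᵁ U) (s : Γ(Y, U)) : pull f e s = pull g e' s := by
  subst h; rfl

lemma resFun_pull (h : X ⟶ Y) {U : Y.Opens} {V V' : X.Opens} (e : V ≤ h ⁻¹ᵁ U) (e' : V' ≤ V)
    (s : Γ(Y, U)) : resFun e' (pull h e s) = pull h (e'.trans e) s :=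
  CategoryTheory.congr_fun (Scheme.Hom.appLE_map h e (homOfLE e').op) s

lemma pull_resFun (h : X ⟶ Y) {U U' : Y.Opens} {V : X.Opens} (e : V ≤ h ⁻¹ᵁ U) (e' : U ≤ U')
    (s : Γ(Y, U')) : pull h e (resFun e' s) = pull h (le_preimage_of_le h e e') s :=
  CategoryTheory.congr_fun (Scheme.Hom.map_appLE h e (homOfLE e').op) s

lemma app_eq_pull (h : X ⟶ Y) (U : Y.Opens) (s : Γ(Y, U)) :
    h.app U s = pull h (le_refl (h ⁻¹ᵁ U)) s :=
  CategoryTheory.congr_fun (Scheme.Hom.appLE_eq_app h).symm s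

lemma pull_bijective (h : X ⟶ Y) [IsOpenImmersion h] {U : Y.Opens} (hU : U ≤ h.opensRange) :
    Function.Bijective (pull h (le_refl (h ⁻¹ᵁ U))) := by
  have e : pull h (le_refl (h ⁻¹ᵁ U)) = (h.app U).hom := RingHom.ext fun s => (app_eq_pull h U s).symm
  have := Scheme.Hom.isIso_app h U hU
  rw [e]
  exact ConcreteCategory.bijective_of_isIso (h.app U)

lemma pull_restrictFun {A B : Type u} [CommRing A] [CommRing B] (f : A →+* B)
    {U : (Spec (CommRingCat.of A)).Opens} {V : (Spec (CommRingCat.of B)).Opens}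
    (e : V ≤ Spec.map (CommRingCat.ofHom f) ⁻¹ᵁ U) (a : A) :
    pull (Spec.map (CommRingCat.ofHom f)) e (restrictFun U a) = restrictFun V (f a) := by
  have h1 : restrictFun U a = resFun le_top ((Scheme.ΓSpecIso (CommRingCat.of A)).inv a) := rfl
  have h2 : restrictFun V (f a) =
    resFun le_top ((Scheme.ΓSpecIso (CommRingCat.of B)).inv (f a)) := rfl
  have h3 : (Scheme.ΓSpecIso (CommRingCat.of B)).inv (f a) =
      pull (Spec.map (CommRingCat.ofHom f)) (le_preimage_top _ ⊤)
        ((Scheme.ΓSpecIso (CommRingCat.of A)).inv a) :=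
    (CategoryTheory.congr_fun (Scheme.ΓSpecIso_inv_naturality (CommRingCat.ofHom f)) a).trans
      (app_eq_pull (Spec.map (CommRingCat.ofHom f)) ⊤ _)
  rw [h1, h2, h3, pull_resFun, resFun_pull]

lemma resFun_restrictFun {A : Type u} [CommRing A] {U V : (Spec (CommRingCat.of A)).Opens}
    (h : V ≤ U) (a : A) : resFun h (restrictFun U a) = restrictFun V a :=
  resFun_resFun h le_top _

/-- An injective ring map gives a scheme-theoretically dominant morphism, and this yields
injectivity over every open set, not only on global functions. -/
lemma pull_specMap_injective {A B : Type u} [CommRing A] [CommRing B] (f : A →+* B)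
    (hf : Function.Injective f) (U : (Spec (CommRingCat.of A)).Opens) :
    Function.Injective (pull (Spec.map (CommRingCat.ofHom f))
      (le_refl (Spec.map (CommRingCat.ofHom f) ⁻¹ᵁ U))) := by
  have h : IsSchemeTheoreticallyDominant (Spec.map (CommRingCat.ofHom f)) := by
    constructor
    rw [Scheme.ker_of_isAffine]
    have hi : Function.Injective (Spec.map (CommRingCat.ofHom f)).appTop := by
      intro a b hab
      have ha : ∀ a, (Scheme.ΓSpecIso (CommRingCat.of B)).hom
          ((Spec.map (CommRingCat.ofHom f)).appTop a) =
          f ((Scheme.ΓSpecIso (CommRingCat.of A)).hom a) :=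
        CategoryTheory.congr_fun (Scheme.ΓSpecIso_naturality (CommRingCat.ofHom f))
      refine (ConcreteCategory.bijective_of_isIso (Scheme.ΓSpecIso (CommRingCat.of A)).hom).1 (hf ?_)
      rw [← ha, ← ha, hab]
    rw [(RingHom.injective_iff_ker_eq_bot _).1 hi]
    ext U
    rw [Scheme.IdealSheafData.ofIdealTop_ideal, Ideal.map_bot, Scheme.IdealSheafData.ideal_bot]
    rfl
  have e : pull (Spec.map (CommRingCat.ofHom f))
      (le_refl (Spec.map (CommRingCat.ofHom f) ⁻¹ᵁ U)) =
      ((Spec.map (CommRingCat.ofHom f)).app U).hom := RingHom.ext fun s => (app_eq_pull _ U s).symm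
  rw [e]
  exact Scheme.Hom.app_injective _ U

section GIT

variable {k : Type u} [Field k] {R : Type u} [CommRing R] [Algebra k R]
  (𝒮 : ℕ → Submodule k R)

lemma resFun_semistableFun {U V : (semistableLocus 𝒮).toScheme.Opens} (h : V ≤ U) (p : R) :
    resFun h (semistableFun 𝒮 U p) = semistableFun 𝒮 V p :=
  resFun_resFun h le_top _

lemma pull_semistableFun {B : Type u} [CommRing B] {g : R →+* B}
    {h : Spec (CommRingCat.of B) ⟶ (semistableLocus 𝒮).toScheme}
    (hg : h ≫ (semistableLocus 𝒮).ι = Spec.map (CommRingCat.ofHom g))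
    {U : (semistableLocus 𝒮).toScheme.Opens} {V : (Spec (CommRingCat.of B)).Opens}
    (e : V ≤ h ⁻¹ᵁ U) (p : R) :
    pull h e (semistableFun 𝒮 U p) = restrictFun V (g p) := by
  have h1 : semistableFun 𝒮 U p = resFun le_top (pull (semistableLocus 𝒮).ι (le_preimage_top _ ⊤)
      (restrictFun ⊤ p)) := by
    have h2 : pull (semistableLocus 𝒮).ι (le_preimage_top _ ⊤) (restrictFun ⊤ p) =
        (semistableLocus 𝒮).ι.appTop (restrictFun ⊤ p) := (app_eq_pull _ ⊤ _).symm
    have h3 : restrictFun ⊤ p = (Scheme.ΓSpecIso (CommRingCat.of R)).inv p :=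
      CategoryTheory.congr_fun ((Spec (CommRingCat.of R)).presheaf.map_id _) _
    rw [h2, h3]
    rfl
  rw [h1, pull_resFun, pull_comp h _ _ _ (le_preimage_top _ V), pull_congr hg _ (le_preimage_top _ V),
    pull_restrictFun]

end GIT

end PullbackOfFunctions


/-! ### Subsheaves of functions generated by local sections -/

section SubsheafOfFunctions

variable {Y Z : Scheme.{u}} (f : Y ⟶ Z)

lemma preimage_mono {U V : Z.Opens} (h : U ≤ V) : f ⁻¹ᵁ U ≤ f ⁻¹ᵁ V := fun _ hx => h hx

lemma sectionAlong_smul {U : Z.Opens} (r : Γ(Z, U)) (s : Γ(Y, f ⁻¹ᵁ U)) :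
    r • sectionAlong f U s = sectionAlong f U (pull f le_rfl r * s) := by
  rw [← app_eq_pull]
  rfl

variable {f} {G : ∀ U : Z.Opens, Set Γ(functionsAlong f, U)}

/-- A section of a subsheaf of `f_* 𝒪_Y` as a function. -/
def subVal {U : Z.Opens} (s : Γ(generatedSubsheaf (functionsAlong f) G, U)) : Γ(Y, f ⁻¹ᵁ U) :=
  (show generatedSections (functionsAlong f) G U from s).1

lemma subVal_mem {U : Z.Opens} (s : Γ(generatedSubsheaf (functionsAlong f) G, U)) :
    sectionAlong f U (subVal s) ∈ generatedSections (functionsAlong f) G U :=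
  (show generatedSections (functionsAlong f) G U from s).2

/-- A function as a section of a subsheaf of `f_* 𝒪_Y`. -/
def subMk {U : Z.Opens} (s : Γ(Y, f ⁻¹ᵁ U))
    (hs : sectionAlong f U s ∈ generatedSections (functionsAlong f) G U) :
    Γ(generatedSubsheaf (functionsAlong f) G, U) :=
  (⟨sectionAlong f U s, hs⟩ : generatedSections (functionsAlong f) G U)

lemma subVal_injective {U : Z.Opens} {s t : Γ(generatedSubsheaf (functionsAlong f) G, U)}
    (h : subVal s = subVal t) : s = t :=
  Subtype.ext (p := (· ∈ generatedSections (functionsAlong f) G U)) h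

lemma subVal_add {U : Z.Opens} (s t : Γ(generatedSubsheaf (functionsAlong f) G, U)) :
    subVal (s + t) = subVal s + subVal t := rfl

lemma subVal_smul {U : Z.Opens} (r : Γ(Z, U))
    (s : Γ(generatedSubsheaf (functionsAlong f) G, U)) :
    subVal (r • s) = pull f le_rfl r * subVal s :=
  sectionAlong_smul f r (subVal s)

/-- If `e` generates a subsheaf of `f_* 𝒪_Y` near `z`, up to functions on `Z`, then each section is
a multiple of `e` near `z`. -/
lemma exists_eq_pull_mul {z : Z} (e : Γ(Y, f ⁻¹ᵁ ⊤))
    (hG : ∀ (V : Z.Opens) (t : Γ(Y, f ⁻¹ᵁ V)), sectionAlong f V t ∈ G V → z ∈ V →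
      ∃ (V' : Z.Opens) (h : V' ≤ V), z ∈ V' ∧ ∃ r : Γ(Z, V'),
        resFun (preimage_mono f h) t = pull f le_rfl r * resFun (le_preimage_top f _) e)
    {U : Z.Opens} (hU : z ∈ U) (s : Γ(Y, f ⁻¹ᵁ U))
    (hs : sectionAlong f U s ∈ generatedSections (functionsAlong f) G U) :
    ∃ (V' : Z.Opens) (h : V' ≤ U), z ∈ V' ∧ ∃ r : Γ(Z, V'),
      resFun (preimage_mono f h) s = pull f le_rfl r * resFun (le_preimage_top f _) e := by
  obtain ⟨V, hV, hzV, hspan⟩ := hs z hU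
  -- Being a multiple of e near z passes to the span, since finitely many neighbourhoods can be
  -- intersected.
  have key : ∀ t ∈ localSpan (functionsAlong f) G V,
      ∃ (V' : Z.Opens) (h : V' ≤ V), z ∈ V' ∧ ∃ r : Γ(Z, V'),
        resFun (preimage_mono f h) (show Γ(Y, f ⁻¹ᵁ V) from t) =
          pull f le_rfl r * resFun (le_preimage_top f _) e := by
    intro t ht
    induction ht using Submodule.span_induction with
    | mem t ht =>
      obtain ⟨W, hW, t, htG, rfl⟩ := ht
      obtain ⟨t, rfl⟩ : ∃ t' : Γ(Y, f ⁻¹ᵁ W), sectionAlong f W t' = t := ⟨t, rfl⟩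
      obtain ⟨V', h, hz, r, hr⟩ := hG W t htG (hW hzV)
      refine ⟨V' ⊓ V, inf_le_right, ⟨hz, hzV⟩, resFun inf_le_left r, ?_⟩
      have h1 := congrArg (resFun (preimage_mono f (inf_le_left : V' ⊓ V ≤ V'))) hr
      rw [resFun_resFun, map_mul, resFun_resFun, resFun_pull] at h1
      rw [pull_resFun]
      refine Eq.trans ?_ h1
      exact resFun_resFun (preimage_mono f inf_le_right) (preimage_mono f hW) t
    | zero =>
      refine ⟨V, le_rfl, hzV, 0, ?_⟩
      rw [map_zero, zero_mul]
      exact map_zero _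
    | add s t _ _ hs ht =>
      obtain ⟨V₁, h₁, hz₁, r₁, e₁⟩ := hs
      obtain ⟨V₂, h₂, hz₂, r₂, e₂⟩ := ht
      refine ⟨V₁ ⊓ V₂, inf_le_left.trans h₁, ⟨hz₁, hz₂⟩,
        resFun inf_le_left r₁ + resFun inf_le_right r₂, ?_⟩
      have h1 := congrArg (resFun (preimage_mono f (inf_le_left : V₁ ⊓ V₂ ≤ V₁))) e₁
      have h2 := congrArg (resFun (preimage_mono f (inf_le_right : V₁ ⊓ V₂ ≤ V₂))) e₂
      rw [resFun_resFun, map_mul, resFun_resFun, resFun_pull] at h1 h2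
      rw [map_add, pull_resFun, pull_resFun, add_mul, ← h1, ← h2]
      exact map_add (resFun (preimage_mono f (inf_le_left.trans h₁))) _ _
    | smul a s _ hs =>
      obtain ⟨V₁, h₁, hz₁, r₁, e₁⟩ := hs
      refine ⟨V₁, h₁, hz₁, resFun h₁ a * r₁, ?_⟩
      have h2 : resFun (preimage_mono f h₁) (pull f le_rfl a *
          (show Γ(Y, f ⁻¹ᵁ V) from s)) = pull f le_rfl (resFun h₁ a * r₁) *
            resFun (le_preimage_top f _) e := by
        rw [map_mul, e₁, map_mul, resFun_pull, pull_resFun, mul_assoc]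
      refine Eq.trans ?_ h2
      exact congrArg (resFun (preimage_mono f h₁)) (sectionAlong_smul f a _)
  obtain ⟨V', h, hz, r, hr⟩ := key _ hspan
  refine ⟨V', h.trans hV, hz, r, Eq.trans ?_ hr⟩
  exact (resFun_resFun (preimage_mono f h) (preimage_mono f hV) s).symm

lemma mem_generatedSections {U : Z.Opens} (s : Γ(Y, f ⁻¹ᵁ U))
    (h : ∀ z ∈ U, ∃ (V : Z.Opens) (hV : V ≤ U), z ∈ V ∧ ∃ (t : Γ(Y, f ⁻¹ᵁ V)) (r : Γ(Z, V)),
      sectionAlong f V t ∈ G V ∧ resFun (preimage_mono f hV) s = pull f le_rfl r * t) :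
    sectionAlong f U s ∈ generatedSections (functionsAlong f) G U := by
  intro z hz
  obtain ⟨V, hV, hzV, t, r, ht, hr⟩ := h z hz
  refine ⟨V, hV, hzV, ?_⟩
  have h1 : (functionsAlong f).presheaf.map (homOfLE hV).op (sectionAlong f U s) =
      r • sectionAlong f V t := by
    rw [sectionAlong_smul, ← hr]
    rfl
  rw [h1]
  refine Submodule.smul_mem _ _ (Submodule.subset_span ⟨V, le_rfl, _, ht, ?_⟩)
  exact (CategoryTheory.congr_fun ((functionsAlong f).presheaf.map_id _) _).symm

end SubsheafOfFunctions

/-! ### Functions on the semistable locus and on its quotient -/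

section GIT

variable {k : Type u} [Field k] {R : Type u} [CommRing R] [Algebra k R]
  (𝒮 : ℕ → Submodule k R)

lemma notMem_comp_iff {B : Type u} [CommRing B] {g : R →+* B}
    {h : Spec (CommRingCat.of B) ⟶ (semistableLocus 𝒮).toScheme}
    (hg : h ≫ (semistableLocus 𝒮).ι = Spec.map (CommRingCat.ofHom g))
    (w : Spec (CommRingCat.of B)) (p : R) :
    p ∉ PrimeSpectrum.asIdeal ((semistableLocus 𝒮).ι (h w)) ↔ g p ∉ w.asIdeal := by
  rw [← Scheme.Hom.comp_apply, hg]
  rfl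

lemma isUnit_algebraMap_away (b : R) : IsUnit (algebraMap R (Localization.Away b) b) :=
  IsLocalization.Away.algebraMap_isUnit b

/-- The open immersion of `D(b)` into the semistable locus. -/
def awayToSemistable {d : ℕ} (hd : 0 < d) {b : R} (hb : b ∈ 𝒮 d) :
    Spec (CommRingCat.of (Localization.Away b)) ⟶ (semistableLocus 𝒮).toScheme :=
  toSemistable 𝒮 (algebraMap R (Localization.Away b)) hd hb (isUnit_algebraMap_away b)

lemma awayToSemistable_ι {d : ℕ} (hd : 0 < d) {b : R} (hb : b ∈ 𝒮 d) :
    awayToSemistable 𝒮 hd hb ≫ (semistableLocus 𝒮).ι =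
      Spec.map (CommRingCat.ofHom (algebraMap R (Localization.Away b))) :=
  toSemistable_ι ..

instance {d : ℕ} (hd : 0 < d) {b : R} (hb : b ∈ 𝒮 d) :
    IsOpenImmersion (awayToSemistable 𝒮 hd hb) := by
  have : IsOpenImmersion (awayToSemistable 𝒮 hd hb ≫ (semistableLocus 𝒮).ι) := by
    rw [awayToSemistable_ι]
    exact IsOpenImmersion.of_isLocalization b
  exact IsOpenImmersion.of_comp _ (semistableLocus 𝒮).ι

lemma mem_opensRange_awayToSemistable {d : ℕ} (hd : 0 < d) {b : R} (hb : b ∈ 𝒮 d)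
    (z : (semistableLocus 𝒮).toScheme) : z ∈ (awayToSemistable 𝒮 hd hb).opensRange ↔
      b ∉ PrimeSpectrum.asIdeal ((semistableLocus 𝒮).ι z) := by
  constructor
  · rintro ⟨w, rfl⟩
    rw [notMem_comp_iff 𝒮 (awayToSemistable_ι 𝒮 hd hb)]
    exact fun h => w.2.ne_top (Ideal.eq_top_of_isUnit_mem _ h (isUnit_algebraMap_away b))
  · intro h
    have hr : (semistableLocus 𝒮).ι z ∈ Set.range
        (PrimeSpectrum.comap (algebraMap R (Localization.Away b))) := by
      rw [PrimeSpectrum.localization_away_comap_range _ b]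
      exact h
    obtain ⟨w, hw⟩ := hr
    let w' : Spec (CommRingCat.of (Localization.Away b)) := w
    refine ⟨w', (semistableLocus 𝒮).ι.isOpenEmbedding.injective ?_⟩
    rw [← Scheme.Hom.comp_apply, awayToSemistable_ι]
    exact hw

lemma isUnit_semistableFun {d : ℕ} (hd : 0 < d) {b : R} (hb : b ∈ 𝒮 d)
    {W : (semistableLocus 𝒮).toScheme.Opens} (hW : W ≤ (awayToSemistable 𝒮 hd hb).opensRange) :
    IsUnit (semistableFun 𝒮 W b) := by
  have hbij := pull_bijective (awayToSemistable 𝒮 hd hb) hW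
  refine (MulEquiv.isUnit_map (RingEquiv.ofBijective _ hbij)).1 ?_
  change IsUnit (pull (awayToSemistable 𝒮 hd hb) (le_refl _) (semistableFun 𝒮 W b))
  rw [pull_semistableFun 𝒮 (awayToSemistable_ι 𝒮 hd hb)]
  exact (isUnit_algebraMap_away b).map _

variable [SetLike.GradedMonoid 𝒮]

/-- Tested on an affine piece D(c) of the semistable locus containing the point, where the quotient
map is explicit. -/
lemma gitMap_mem_basicOpen {d : ℕ} (hd : 0 < d) {t : sectionRing 𝒮} (ht : t ∈ sectionGrading 𝒮 d)
    (z : (semistableLocus 𝒮).toScheme) : gitMap 𝒮 z ∈ Proj.basicOpen (sectionGrading 𝒮) t ↔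
      evalOne 𝒮 t ∉ PrimeSpectrum.asIdeal ((semistableLocus 𝒮).ι z) := by
  obtain ⟨⟨e, c, he, hc⟩, hz⟩ := Opens.mem_iSup.1 z.2
  obtain ⟨w, rfl⟩ := (mem_opensRange_awayToSemistable 𝒮 he hc z).2 hz
  have hm := sectionRing.monomial_mem 𝒮 e ⟨c, hc⟩
  have h := comp_gitMap 𝒮 (awayToSemistable 𝒮 he hc) _ (awayToSemistable_ι 𝒮 he hc) he hm
    (by rw [RingHom.comp_apply, evalOne_monomial]; exact isUnit_algebraMap_away c)
  rw [notMem_comp_iff 𝒮 (awayToSemistable_ι 𝒮 he hc), ← Scheme.Hom.comp_apply, h]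
  have h2 := specToProj_preimage_basicOpen (sectionGrading 𝒮)
    ((algebraMap R (Localization.Away c)).comp (evalOne 𝒮)) he hm
    (by rw [RingHom.comp_apply, evalOne_monomial]; exact isUnit_algebraMap_away c) hd ht
  exact iff_of_eq (congrArg (w ∈ ·) h2)

lemma preimage_basicOpen_le {d : ℕ} (hd : 0 < d) {b : R} (hb : b ∈ 𝒮 d) :
    gitMap 𝒮 ⁻¹ᵁ Proj.basicOpen (sectionGrading 𝒮) (sectionRing.monomial 𝒮 d ⟨b, hb⟩) ≤
      (awayToSemistable 𝒮 hd hb).opensRange := by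
  intro z hz
  rw [mem_opensRange_awayToSemistable]
  have := (gitMap_mem_basicOpen 𝒮 hd (sectionRing.monomial_mem 𝒮 d ⟨b, hb⟩) z).1 hz
  rwa [evalOne_monomial] at this

/-- The quotient of two semi-invariants of the same weight is a function on an open subset of
the quotient. -/
lemma exists_quotient {d : ℕ} (hd : 0 < d) {a b : R} (ha : a ∈ 𝒮 d) (hb : b ∈ 𝒮 d) :
    ∃ r : Γ(Proj (sectionGrading 𝒮),
      Proj.basicOpen (sectionGrading 𝒮) (sectionRing.monomial 𝒮 d ⟨b, hb⟩)),
      semistableFun 𝒮 _ b * pull (gitMap 𝒮) le_rfl r = semistableFun 𝒮 _ a := by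
  have hm := sectionRing.monomial_mem 𝒮 d ⟨b, hb⟩
  have hm' := sectionRing.monomial_mem 𝒮 d ⟨a, ha⟩
  have hu : IsUnit ((algebraMap R (Localization.Away b)).comp (evalOne 𝒮)
      (sectionRing.monomial 𝒮 d ⟨b, hb⟩)) := by
    rw [RingHom.comp_apply, evalOne_monomial]; exact isUnit_algebraMap_away b
  have h := comp_gitMap 𝒮 (awayToSemistable 𝒮 hd hb) _ (awayToSemistable_ι 𝒮 hd hb) hd hm hu
  let x : HomogeneousLocalization.Away (sectionGrading 𝒮) (sectionRing.monomial 𝒮 d ⟨b, hb⟩) :=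
    HomogeneousLocalization.Away.mk (sectionGrading 𝒮) hm 1 (sectionRing.monomial 𝒮 d ⟨a, ha⟩)
      (by rw [one_smul]; exact hm')
  have hx := pow_mul_awayLift_mk (sectionGrading 𝒮)
    ((algebraMap R (Localization.Away b)).comp (evalOne 𝒮)) hu hm 1
    (sectionRing.monomial 𝒮 d ⟨a, ha⟩) (by rw [one_smul]; exact hm')
  rw [pow_one, RingHom.comp_apply, RingHom.comp_apply, evalOne_monomial, evalOne_monomial] at hx
  -- The function r is the degree zero fraction a / b, transported along the affine chart D₊(b) of
  -- Proj.
  obtain ⟨r, hr⟩ := (pull_bijective (Proj.awayι (sectionGrading 𝒮) _ hm hd)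
    (Proj.opensRange_awayι (sectionGrading 𝒮) _ hm hd).ge).2 (restrictFun _ x)
  -- The preimage of D₊(b) lies in D(b), so the identity may be checked in the localization at b.
  refine ⟨r, (pull_bijective (awayToSemistable 𝒮 hd hb) (preimage_basicOpen_le 𝒮 hd hb)).1 ?_⟩
  have e0 : awayToSemistable 𝒮 hd hb ⁻¹ᵁ gitMap 𝒮 ⁻¹ᵁ Proj.basicOpen (sectionGrading 𝒮)
      (sectionRing.monomial 𝒮 d ⟨b, hb⟩) ≤ (awayToSemistable 𝒮 hd hb ≫ gitMap 𝒮) ⁻¹ᵁ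
        Proj.basicOpen (sectionGrading 𝒮) (sectionRing.monomial 𝒮 d ⟨b, hb⟩) := le_rfl
  rw [map_mul, pull_semistableFun 𝒮 (awayToSemistable_ι 𝒮 hd hb),
    pull_semistableFun 𝒮 (awayToSemistable_ι 𝒮 hd hb)]
  have e1 := pull_comp (awayToSemistable 𝒮 hd hb) (gitMap 𝒮) le_rfl le_rfl e0 r
  have e2 : pull (awayToSemistable 𝒮 hd hb ≫ gitMap 𝒮) e0 r = restrictFun _
      (awayLift (sectionGrading 𝒮) ((algebraMap R (Localization.Away b)).comp (evalOne 𝒮)) hu x) := by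
    have e0' := e0
    rw [h] at e0'
    refine (pull_congr h e0 e0' r).trans ?_
    refine (pull_comp _ _ le_rfl e0' _ r).symm.trans ?_
    rw [hr]
    exact pull_restrictFun ..
  rw [e1, e2, ← hx, map_mul]

end GIT


/-! ### Local generators of sheaves of semi-invariants -/

section GIT

variable {k : Type u} [Field k] {R : Type u} [CommRing R] [Algebra k R]
  (𝒮 : ℕ → Submodule k R)

lemma notMem_of_isUnit_semistableFun {U : (semistableLocus 𝒮).toScheme.Opens} {p : R}
    (h : IsUnit (semistableFun 𝒮 U p)) {z : (semistableLocus 𝒮).toScheme} (hz : z ∈ U) :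
    p ∉ PrimeSpectrum.asIdeal ((semistableLocus 𝒮).ι z) := by
  have h1 : z ∈ (semistableLocus 𝒮).toScheme.basicOpen (semistableFun 𝒮 U p) := by
    rw [Scheme.basicOpen_of_isUnit _ h]
    exact hz
  have h2 : semistableFun 𝒮 U p = (semistableLocus 𝒮).toScheme.presheaf.map (homOfLE le_top).op
      ((semistableLocus 𝒮).ι.appTop ((Scheme.ΓSpecIso (CommRingCat.of R)).inv p)) := rfl
  rw [h2, Scheme.basicOpen_res, ← Scheme.preimage_basicOpen_top, basicOpen_eq_of_affine'] at h1
  have h3 : (Scheme.ΓSpecIso (CommRingCat.of R)).hom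
      ((Scheme.ΓSpecIso (CommRingCat.of R)).inv p) = p := by simp
  have h4 := h1.2
  rw [h3] at h4
  exact h4

variable [SetLike.GradedMonoid 𝒮] (𝒯 : ℕ → Submodule k R)

/-- If `e * q` is a semi-invariant and multiplication by `q` maps `𝒯` to semi-invariants, then the
module of semi-invariants of weights `𝒯` is generated by `e` where `e * q` does not vanish. -/
lemma gitModule_generates {d : ℕ} (hd : 0 < d) {e q : R} (heq : e * q ∈ 𝒮 d)
    (hq : ∀ n, ∀ g ∈ 𝒯 n, g * q ∈ 𝒮 (n + d)) {z : (semistableLocus 𝒮).toScheme}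
    (hz : e * q ∉ PrimeSpectrum.asIdeal ((semistableLocus 𝒮).ι z)) {V : (gitQuotient 𝒮).Opens}
    (hV : gitMap 𝒮 z ∈ V) (n : Γ(gitModule 𝒮 𝒯, V)) :
    ∃ (V' : (gitQuotient 𝒮).Opens) (h : V' ≤ V), gitMap 𝒮 z ∈ V' ∧ ∃ r : Γ(gitQuotient 𝒮, V'),
      resFun (preimage_mono (gitMap 𝒮) h) (subVal n) =
        pull (gitMap 𝒮) le_rfl r * semistableFun 𝒮 (gitMap 𝒮 ⁻¹ᵁ V') e := by
  have key := exists_eq_pull_mul (z := gitMap 𝒮 z) (semistableFun 𝒮 (gitMap 𝒮 ⁻¹ᵁ ⊤) e) ?_ hV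
    (subVal n) (subVal_mem n)
  · obtain ⟨V', h, hz', r, hr⟩ := key
    exact ⟨V', h, hz', r, by rw [hr, resFun_semistableFun]⟩
  · rintro V t ⟨s', hs', n, f, hf, g, hg, hu, he⟩ hzV
    obtain rfl : t = s' := hs'
    -- The section g / f is e times (g q) / (f e q). Numerator and denominator are semi-invariants
    -- of the same degree n + d, so the factor is a function on the quotient.
    have hb : f * (e * q) ∈ 𝒮 (n + d) := SetLike.mul_mem_graded hf heq
    have hnd : 0 < n + d := by omega
    let D : (gitQuotient 𝒮).Opens := Proj.basicOpen (sectionGrading 𝒮)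
      (sectionRing.monomial 𝒮 (n + d) ⟨f * (e * q), hb⟩)
    obtain ⟨r, hr⟩ : ∃ r : Γ(gitQuotient 𝒮, D),
        semistableFun 𝒮 (gitMap 𝒮 ⁻¹ᵁ D) (f * (e * q)) * pull (gitMap 𝒮) le_rfl r =
          semistableFun 𝒮 (gitMap 𝒮 ⁻¹ᵁ D) (g * q) := exists_quotient 𝒮 hnd (hq n g hg) hb
    have hzD : gitMap 𝒮 z ∈ D := by
      refine (gitMap_mem_basicOpen 𝒮 hnd (sectionRing.monomial_mem 𝒮 (n + d) _) z).2 ?_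
      rw [evalOne_monomial]
      exact fun h => (((semistableLocus 𝒮).ι z).2.mem_or_mem h).elim
        (notMem_of_isUnit_semistableFun 𝒮 hu hzV) hz
    refine ⟨V ⊓ D, inf_le_left, ⟨hzV, hzD⟩, resFun inf_le_right r, ?_⟩
    have hunit : IsUnit (semistableFun 𝒮 (gitMap 𝒮 ⁻¹ᵁ (V ⊓ D)) (f * (e * q))) :=
      isUnit_semistableFun 𝒮 hnd hb
        ((preimage_mono (gitMap 𝒮) inf_le_right).trans (preimage_basicOpen_le 𝒮 hnd hb))
    have h1 := congrArg (resFun (preimage_mono (gitMap 𝒮) (inf_le_left : V ⊓ D ≤ V))) he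
    have h2 := congrArg (resFun (preimage_mono (gitMap 𝒮) (inf_le_right : V ⊓ D ≤ D))) hr
    rw [map_mul, resFun_semistableFun, resFun_semistableFun] at h1 h2
    refine hunit.mul_left_cancel ?_
    rw [pull_resFun, resFun_semistableFun]
    rw [resFun_pull] at h2
    refine Eq.trans ?_ ((congrArg (· * semistableFun 𝒮 _ e) h2.symm).trans (mul_assoc _ _ _))
    simp only [map_mul] at h1 ⊢
    linear_combination (semistableFun 𝒮 _ e * semistableFun 𝒮 _ q) * h1

/-- An element of `𝒯 0` as a global section. -/
lemma semistableFun_mem {e : R} (he : e ∈ 𝒯 0) (V : (gitQuotient 𝒮).Opens) :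
    ∃ n : Γ(gitModule 𝒮 𝒯, V), subVal n = semistableFun 𝒮 (gitMap 𝒮 ⁻¹ᵁ V) e := by
  refine ⟨subMk (semistableFun 𝒮 (gitMap 𝒮 ⁻¹ᵁ V) e) ?_, rfl⟩
  refine mem_generatedSections _ fun z hz => ⟨V, le_rfl, hz, semistableFun 𝒮 _ e, 1,
    ⟨_, rfl, 0, 1, SetLike.GradedOne.one_mem, e, he, ?_, ?_⟩, ?_⟩
  · rw [map_one]; exact isUnit_one
  · rw [map_one, one_mul]
  · rw [map_one, one_mul, resFun_semistableFun]

end GIT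

/-! ### Line bundles of divisors as sheaves of functions on the torus -/

namespace SmoothFan

variable {M : Type} [AddCommGroup M] {ι : Type} [DecidableEq ι] {F : SmoothFan M ι}
  {l : ℕ} {L : Fin (l + 1) → ι → ℤ}

section Torus

variable (F) (k : Type u) [Field k]

lemma torusι_eq (S : F.cones) : F.torusι k = Spec.map (CommRingCat.ofHom
    (F.faceMap k (Finset.empty_subset S.1))) ≫ F.specChartι k S :=
  (specMap_faceMap_specChartι F k (S := ⟨∅, F.zero_mem⟩) (Finset.empty_subset S.1)).symm

lemma character_mul (m n : M) (U : (Spec (CommRingCat.of (F.chartRing k ∅))).Opens) :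
    F.character k m U * F.character k n U = F.character k (m + n) U := by
  rw [character, character, character, ← map_mul, AddMonoidAlgebra.single_mul_single, one_mul]
  rfl

lemma character_zero (U : (Spec (CommRingCat.of (F.chartRing k ∅))).Opens) :
    F.character k 0 U = 1 := by
  rw [character, ← map_one (restrictFun U)]
  rfl

lemma isUnit_character (m : M) (U : (Spec (CommRingCat.of (F.chartRing k ∅))).Opens) :
    IsUnit (F.character k m U) :=
  IsUnit.of_mul_eq_one (F.character k (-m) U) (by
    rw [character_mul, add_neg_cancel, character_zero])

lemma resFun_character (m : M) {U V : (Spec (CommRingCat.of (F.chartRing k ∅))).Opens}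
    (h : V ≤ U) : resFun h (F.character k m U) = F.character k m V :=
  resFun_restrictFun h _

/-- The coordinate ring of a chart embeds in the group algebra of M, and injectivity persists over
open subsets. -/
lemma pull_torusι_injective (S : F.cones) {W : (F.toricVariety k).Opens}
    (hW : W ≤ (F.specChartι k S).opensRange) :
    Function.Injective (pull (F.torusι k) (le_refl (F.torusι k ⁻¹ᵁ W))) := by
  intro a b hab
  refine (pull_bijective (F.specChartι k S) hW).1
    (pull_specMap_injective _ (faceMap_injective F k (Finset.empty_subset S.1)) _ ?_)
  have e := F.torusι_eq k S
  have e0 : Spec.map (CommRingCat.ofHom (F.faceMap k (Finset.empty_subset S.1))) ⁻¹ᵁ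
      F.specChartι k S ⁻¹ᵁ W ≤ F.torusι k ⁻¹ᵁ W := by
    rw [e]
    exact le_rfl
  have e1 := e0
  rw [e] at e1
  have h := congrArg (resFun e0) hab
  rw [resFun_pull, resFun_pull] at h
  rw [pull_comp _ _ _ _ e1, pull_comp _ _ _ _ e1, pull_congr e.symm e1 e0, pull_congr e.symm e1 e0]
  exact h

/-- A character that is invertible on a chart is a function on the chart. -/
lemma exists_pull_torusι_eq_character (S : F.cones) (m : M) (hm : ∀ q ∈ S.1, F.ray q m = 0) :
    ∃ r : Γ(F.toricVariety k, (F.specChartι k S).opensRange),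
      pull (F.torusι k) le_rfl r = F.character k m _ := by
  let m' : F.dualMonoid S.1 := ⟨m, fun q hq => (hm q hq).ge⟩
  obtain ⟨r, hr⟩ := (pull_bijective (F.specChartι k S) le_rfl).2
    (restrictFun _ (AddMonoidAlgebra.single m' (1 : k)))
  refine ⟨r, ?_⟩
  have e := F.torusι_eq k S
  have e1 : F.torusι k ⁻¹ᵁ (F.specChartι k S).opensRange ≤ (Spec.map (CommRingCat.ofHom
      (F.faceMap k (Finset.empty_subset S.1))) ≫ F.specChartι k S) ⁻¹ᵁ
        (F.specChartι k S).opensRange := by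
    rw [e]
  rw [pull_congr e _ e1]
  have e2 : F.torusι k ⁻¹ᵁ (F.specChartι k S).opensRange ≤ Spec.map (CommRingCat.ofHom
      (F.faceMap k (Finset.empty_subset S.1))) ⁻¹ᵁ F.specChartι k S ⁻¹ᵁ
        (F.specChartι k S).opensRange := e1
  refine (pull_comp _ _ le_rfl e2 e1 r).symm.trans ?_
  rw [hr, pull_restrictFun, faceMap_single]
  rfl

lemma exists_common_face {S T : F.cones} {x : F.toricVariety k}
    (hS : x ∈ (F.specChartι k S).opensRange) (hT : x ∈ (F.specChartι k T).opensRange) :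
    ∃ I : F.cones, I.1 ⊆ S.1 ∧ I.1 ⊆ T.1 ∧ x ∈ (F.specChartι k I).opensRange := by
  obtain ⟨y, hy⟩ := hS
  obtain ⟨z, hz⟩ := hT
  obtain ⟨I, f, g, w, hw, -⟩ := (Scheme.IsLocallyDirected.ι_eq_ι_iff (F.charts k)).1
    (hy.trans hz.symm)
  refine ⟨I, leOfHom f, leOfHom g, w, ?_⟩
  have h : F.chartι k I w = F.chartι k S y := by
    rw [← hw, ← Scheme.Hom.comp_apply, map_chartι]
  exact h.trans hy

/-- A line bundle of a divisor is generated by a character on the chart of a cone. -/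
lemma lineBundle_generates {D : ι → ℤ} (S : F.cones) {m : M} (hm : F.IsLocalGenerator D S.1 m)
    {x : F.toricVariety k} (hx : x ∈ (F.specChartι k S).opensRange)
    {W : (F.toricVariety k).Opens} (hW : x ∈ W) (s : Γ(F.lineBundle k D, W)) :
    ∃ (W' : (F.toricVariety k).Opens) (h : W' ≤ W), x ∈ W' ∧ ∃ r : Γ(F.toricVariety k, W'),
      resFun (preimage_mono (F.torusι k) h) (subVal s) =
        pull (F.torusι k) le_rfl r * F.character k m _ := by
  have key := exists_eq_pull_mul (z := x) (F.character k m (F.torusι k ⁻¹ᵁ ⊤)) ?_ hW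
    (subVal s) (subVal_mem s)
  · obtain ⟨V', h, hz', r, hr⟩ := key
    exact ⟨V', h, hz', r, by rw [hr, resFun_character]⟩
  · rintro V t ⟨T, hT, m', hm', ht⟩ hxV
    obtain rfl : t = F.character k m' _ := ht
    -- Near x only the common face I matters. There m' and m generate the same sheaf, so their
    -- difference is an invertible function.
    obtain ⟨I, hIS, hIT, hxI⟩ := F.exists_common_face k hx (hT hxV)
    obtain ⟨r, hr⟩ := F.exists_pull_torusι_eq_character k I (m' - m) fun q hq => by
      rw [map_sub, hm q (hIS hq), hm' q (hIT hq), sub_self]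
    refine ⟨V ⊓ (F.specChartι k I).opensRange, inf_le_left, ⟨hxV, hxI⟩, resFun inf_le_right r, ?_⟩
    have h := congrArg (resFun (preimage_mono (F.torusι k)
      (inf_le_right : V ⊓ (F.specChartι k I).opensRange ≤ _))) hr
    rw [resFun_pull, resFun_character] at h
    rw [pull_resFun, resFun_character, resFun_character, h, character_mul, sub_add_cancel]

end Torus

end SmoothFan


/-! ### Pullback of the tautological bundles -/

namespace SmoothFan

variable {M : Type} [AddCommGroup M] {ι : Type} [DecidableEq ι] {F : SmoothFan M ι}
  {l : ℕ} {L : Fin (l + 1) → ι → ℤ}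

namespace ChartData

variable {J : Type} (P : F.ChartData L J) (k : Type u) [Field k]

/-- The quotient map from the semistable locus to the multigraded linear series. -/
def seriesMap (F : SmoothFan M ι) (L : Fin (l + 1) → ι → ℤ) (k : Type u) [Field k] :
    (semistableLocus (F.thetaPieces L k)).toScheme ⟶ F.linearSeries L k :=
  gitMap (F.thetaPieces L k)

/-- A section of a tautological bundle as a function on the semistable locus. -/
def tautVal {i : Fin (l + 1)} {V : (F.linearSeries L k).Opens}
    (n : Γ(F.tautologicalBundle L k i, V)) :
    Γ((semistableLocus (F.thetaPieces L k)).toScheme, seriesMap F L k ⁻¹ᵁ V) :=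
  subVal (f := gitMap (F.thetaPieces L k)) n

lemma tautVal_injective {i : Fin (l + 1)} {V : (F.linearSeries L k).Opens}
    {n n' : Γ(F.tautologicalBundle L k i, V)} (h : tautVal k n = tautVal k n') : n = n' :=
  subVal_injective (f := gitMap (F.thetaPieces L k)) h

lemma tautVal_add {i : Fin (l + 1)} {V : (F.linearSeries L k).Opens}
    (n n' : Γ(F.tautologicalBundle L k i, V)) :
    tautVal k (n + n') = tautVal k n + tautVal k n' :=
  subVal_add (f := gitMap (F.thetaPieces L k)) n n'

lemma tautVal_smul {i : Fin (l + 1)} {V : (F.linearSeries L k).Opens}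
    (r : Γ(F.linearSeries L k, V)) (n : Γ(F.tautologicalBundle L k i, V)) :
    tautVal k (r • n) = pull (seriesMap F L k) le_rfl r * tautVal k n :=
  subVal_smul (f := gitMap (F.thetaPieces L k)) r n

lemma tautVal_resMod {i : Fin (l + 1)} {V V' : (F.linearSeries L k).Opens} (h : V' ≤ V)
    (n : Γ(F.tautologicalBundle L k i, V)) :
    tautVal k (resMod _ h n) = resFun (preimage_mono (seriesMap F L k) h) (tautVal k n) := rfl

/-- A section of the line bundle of a divisor as a function on the torus. -/
def bundleVal {D : ι → ℤ} {W : (F.toricVariety k).Opens} (s : Γ(F.lineBundle k D, W)) :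
    Γ(Spec (CommRingCat.of (F.chartRing k ∅)), F.torusι k ⁻¹ᵁ W) :=
  subVal (f := F.torusι k) s

lemma bundleVal_injective {D : ι → ℤ} {W : (F.toricVariety k).Opens}
    {s s' : Γ(F.lineBundle k D, W)} (h : bundleVal k s = bundleVal k s') : s = s' :=
  subVal_injective (f := F.torusι k) h

lemma bundleVal_add {D : ι → ℤ} {W : (F.toricVariety k).Opens} (s s' : Γ(F.lineBundle k D, W)) :
    bundleVal k (s + s') = bundleVal k s + bundleVal k s' :=
  subVal_add (f := F.torusι k) s s'

lemma bundleVal_zero {D : ι → ℤ} {W : (F.toricVariety k).Opens} :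
    bundleVal k (0 : Γ(F.lineBundle k D, W)) = 0 := rfl

lemma bundleVal_smul {D : ι → ℤ} {W : (F.toricVariety k).Opens} (r : Γ(F.toricVariety k, W))
    (s : Γ(F.lineBundle k D, W)) :
    bundleVal k (r • s) = pull (F.torusι k) le_rfl r * bundleVal k s :=
  subVal_smul (f := F.torusι k) r s

lemma bundleVal_resMod {D : ι → ℤ} {W W' : (F.toricVariety k).Opens} (h : W' ≤ W)
    (s : Γ(F.lineBundle k D, W)) :
    bundleVal k (resMod _ h s) = resFun (preimage_mono (F.torusι k) h) (bundleVal k s) := rfl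

lemma exists_bundleVal_eq {D : ι → ℤ} {W : (F.toricVariety k).Opens}
    (s : Γ(Spec (CommRingCat.of (F.chartRing k ∅)), F.torusι k ⁻¹ᵁ W))
    (h : ∀ x ∈ W, ∃ (W' : (F.toricVariety k).Opens) (hW : W' ≤ W) (S : F.cones) (m : M)
      (r : Γ(F.toricVariety k, W')), x ∈ W' ∧ W' ≤ (F.specChartι k S).opensRange ∧
        F.IsLocalGenerator D S.1 m ∧ resFun (preimage_mono (F.torusι k) hW) s =
          pull (F.torusι k) le_rfl r * F.character k m _) :
    ∃ s' : Γ(F.lineBundle k D, W), bundleVal k s' = s := by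
  refine ⟨subMk (f := F.torusι k) s (mem_generatedSections _ fun x hx => ?_), rfl⟩
  obtain ⟨W', hW, S, m, r, hx', hS, hm, hr⟩ := h x hx
  exact ⟨W', hW, hx', F.character k m _, r, ⟨S, hS, m, hm, rfl⟩, hr⟩

/-- The morphism from the chart of a cone to the semistable locus that is given by generators of the
line bundles on the chart. -/
def localToSemistable (j : J) {S : Finset ι} (hS : S ⊆ P.cone j) {g : Fin (l + 1) → M}
    (hg : F.AreLocalGenerators L S g) :
    Spec (CommRingCat.of (F.chartRing k S)) ⟶ (semistableLocus (F.thetaPieces L k)).toScheme :=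
  toSemistable (F.thetaPieces L k) (F.chartHom L k hg) one_pos
    (monomial_mem_weightPiece k _ 1 (P.inc_tree' j)) (P.isUnit_chartHom_tree k j hS hg)

lemma localToSemistable_ι (j : J) {S : Finset ι} (hS : S ⊆ P.cone j) {g : Fin (l + 1) → M}
    (hg : F.AreLocalGenerators L S g) :
    P.localToSemistable k j hS hg ≫ (semistableLocus (F.thetaPieces L k)).ι =
      Spec.map (CommRingCat.ofHom (F.chartHom L k hg)) := toSemistable_ι ..

lemma localToSemistable_gitMap (j : J) {S : F.cones} (hS : S.1 ⊆ P.cone j) {g : Fin (l + 1) → M}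
    (hg : F.AreLocalGenerators L S.1 g) :
    P.localToSemistable k j hS hg ≫ seriesMap F L k =
      F.specChartι k S ≫ P.toSeries k :=
  (comp_gitMap (F.thetaPieces L k) (P.localToSemistable k j hS hg) (F.chartHom L k hg)
    (P.localToSemistable_ι k j hS hg) one_pos (P.treeSection_mem k j)
    (P.isUnit_chartHom_treeSection k j hS hg)).trans (P.specChartι_toSeries k S hS hg).symm

/-- The torus imposes no conditions, so the zero characters are a trivialization there. With them
y_a maps to its own character, without a twist. -/
lemma areLocalGenerators_empty : F.AreLocalGenerators L ∅ 0 :=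
  fun _ q hq => absurd hq (Finset.notMem_empty q)

/-- The morphism from the torus to the semistable locus, `y_a ↦ χ^m` with `m` the character of the
section of the arrow `a`. -/
def torusToSemistable : Spec (CommRingCat.of (F.chartRing k ∅)) ⟶
    (semistableLocus (F.thetaPieces L k)).toScheme :=
  P.localToSemistable k (P.maxIndex ⟨∅, F.zero_mem⟩) (Finset.empty_subset _)
    areLocalGenerators_empty

lemma torusToSemistable_gitMap : P.torusToSemistable k ≫ seriesMap F L k =
    F.torusι k ≫ P.toSeries k :=
  P.localToSemistable_gitMap k (P.maxIndex ⟨∅, F.zero_mem⟩) (S := ⟨∅, F.zero_mem⟩)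
    (Finset.empty_subset _) areLocalGenerators_empty

lemma torus_preimage_le (V : (F.linearSeries L k).Opens) :
    F.torusι k ⁻¹ᵁ P.toSeries k ⁻¹ᵁ V ≤
      P.torusToSemistable k ⁻¹ᵁ seriesMap F L k ⁻¹ᵁ V := by
  intro x hx
  change (P.torusToSemistable k ≫ seriesMap F L k) x ∈ V
  rw [torusToSemistable_gitMap]
  exact hx

/-- The character of the section of `L i` given by the `j`-th path to `i`. -/
def pathChar (j : J) (i : Fin (l + 1)) : M := F.totalChar L (P.path j i)

/-- The path starts at the trivial bundle, so its divisor is div(χ) + L i; it has no zeroes along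
the cone. -/
lemma isLocalGenerator_pathChar (hL : L 0 = 0) (j : J) (i : Fin (l + 1)) :
    F.IsLocalGenerator (L i) (P.cone j) (P.pathChar j i) := by
  intro q hq
  rw [pathChar, ray_totalChar, P.div_path j i q hq, P.inc_path]
  simp [sub_mul, Finset.sum_sub_distrib, Pi.single_apply, hL]

lemma pull_torusToSemistable (j : J) (i : Fin (l + 1))
    {U : (semistableLocus (F.thetaPieces L k)).toScheme.Opens}
    {V : (Spec (CommRingCat.of (F.chartRing k ∅))).Opens}
    (e : V ≤ P.torusToSemistable k ⁻¹ᵁ U) :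
    pull (P.torusToSemistable k) e (semistableFun (F.thetaPieces L k) U
      (MvPolynomial.monomial (P.path j i) 1)) = F.character k (P.pathChar j i) V := by
  refine (pull_semistableFun (F.thetaPieces L k) (P.localToSemistable_ι k _ _ _) e _).trans ?_
  rw [chartHom_monomial, character]
  congr 2
  ext
  rw [coe_localExponent]
  simp [pathChar]

/-- The image of a point of the chart of a cone, as the image of a point of the semistable locus
where the monomial of the paths does not vanish. -/
lemma exists_semistable_point (j : J) {x : F.toricVariety k}
    (hx : x ∈ (F.specChartι k (P.coneOf j)).opensRange) :
    ∃ z, seriesMap F L k z = P.toSeries k x ∧ MvPolynomial.monomial (P.tree j) (1 : k) ∉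
      PrimeSpectrum.asIdeal ((semistableLocus (F.thetaPieces L k)).ι z) := by
  obtain ⟨y, rfl⟩ := hx
  have hg : F.AreLocalGenerators L (P.coneOf j).1 (P.gen j) := P.isGen j
  have hS : (P.coneOf j).1 ⊆ P.cone j := subset_rfl
  refine ⟨P.localToSemistable k j hS hg y, ?_, ?_⟩
  · rw [← Scheme.Hom.comp_apply, ← Scheme.Hom.comp_apply,
      ← P.localToSemistable_gitMap k j hS hg]
  · rw [notMem_comp_iff _ (P.localToSemistable_ι k j hS hg)]
    exact fun h => y.2.ne_top (Ideal.eq_top_of_isUnit_mem _ h (P.isUnit_chartHom_tree k j hS hg))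

/-- Apply `gitModule_generates` with e the path to i and q the product of the other paths. Their
product is the tree, which does not vanish above the chart. -/
lemma tautologicalBundle_generates (i : Fin (l + 1)) (j : J) {x : F.toricVariety k}
    (hx : x ∈ (F.specChartι k (P.coneOf j)).opensRange) {V : (F.linearSeries L k).Opens}
    (hV : P.toSeries k x ∈ V) (n : Γ(F.tautologicalBundle L k i, V)) :
    ∃ (V' : (F.linearSeries L k).Opens) (h : V' ≤ V), P.toSeries k x ∈ V' ∧
      ∃ r : Γ(F.linearSeries L k, V'),
        resFun (preimage_mono (seriesMap F L k) h) (tautVal k n) =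
          pull (seriesMap F L k) le_rfl r * semistableFun (F.thetaPieces L k) _
            (MvPolynomial.monomial (P.path j i) 1) := by
  obtain ⟨z, hz, hzt⟩ := P.exists_semistable_point k j hx
  let q : F.Arrow L →₀ ℕ := ∑ p ∈ Finset.univ.erase i, P.path j p
  have hq : P.path j i + q = P.tree j := Finset.add_sum_erase _ _ (Finset.mem_univ i)
  have hmul : MvPolynomial.monomial (P.path j i) (1 : k) * MvPolynomial.monomial q 1 =
      MvPolynomial.monomial (P.tree j) 1 := by
    rw [MvPolynomial.monomial_mul, hq, one_mul]
  rw [← hz] at hV ⊢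
  refine gitModule_generates (F.thetaPieces L k) _ one_pos (q := MvPolynomial.monomial q 1)
    ?_ ?_ ?_ hV n
  · rw [hmul]
    exact monomial_mem_weightPiece k _ 1 (P.inc_tree' j)
  · intro n g hg
    have hqw : F.totalInc L q = theta l - (Pi.single i 1 - Pi.single 0 1) := by
      have h := P.inc_tree j
      rw [← hq, map_add, P.inc_path] at h
      exact eq_sub_of_add_eq' h
    have h := MvPolynomial.IsWeightedHomogeneous.mul hg
      (monomial_mem_weightPiece k q 1 hqw : _ ∈ F.weightPiece L k _)
    have hw : Pi.single i 1 - Pi.single 0 1 + n • theta l +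
        (theta l - (Pi.single i 1 - Pi.single 0 1)) = (n + 1) • theta l := by
      rw [add_smul, one_smul]; abel
    rw [hw] at h
    exact h
  · rw [hmul]
    exact hzt

lemma exists_mem_opensRange (x : F.toricVariety k) :
    ∃ j, x ∈ (F.specChartι k (P.coneOf j)).opensRange := by
  obtain ⟨j, y, hy⟩ := P.exists_chart k x
  exact ⟨j, y, hy⟩

lemma pull_seriesMap (V : (F.linearSeries L k).Opens) (r : Γ(F.linearSeries L k, V)) :
    pull (P.torusToSemistable k) (P.torus_preimage_le k V) (pull (seriesMap F L k) le_rfl r) =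
      pull (F.torusι k) le_rfl (pull (P.toSeries k) le_rfl r) := by
  have e : F.torusι k ⁻¹ᵁ P.toSeries k ⁻¹ᵁ V ≤
      (P.torusToSemistable k ≫ seriesMap F L k) ⁻¹ᵁ V := P.torus_preimage_le k V
  have e' : F.torusι k ⁻¹ᵁ P.toSeries k ⁻¹ᵁ V ≤ (F.torusι k ≫ P.toSeries k) ⁻¹ᵁ V := le_rfl
  rw [pull_comp _ _ le_rfl le_rfl e', pull_comp _ _ _ _ e]
  exact pull_congr (P.torusToSemistable_gitMap k) e e' r

/-- Locally a section of W_i is a function on the quotient times a path monomial. On the torus it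
becomes a regular function times a character that generates 𝒪(L i). -/
lemma exists_bundleVal_eq_pull (hL : L 0 = 0) (i : Fin (l + 1)) (V : (F.linearSeries L k).Opens)
    (n : Γ(F.tautologicalBundle L k i, V)) :
    ∃ s : Γ(F.lineBundle k (L i), P.toSeries k ⁻¹ᵁ V), bundleVal k s =
      pull (P.torusToSemistable k) (P.torus_preimage_le k V) (tautVal k n) := by
  refine exists_bundleVal_eq k _ fun x hx => ?_
  obtain ⟨j, hj⟩ := P.exists_mem_opensRange k x
  obtain ⟨V', h, hxV, r, hr⟩ := P.tautologicalBundle_generates k i j hj hx n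
  have h1 := congrArg (pull (P.torusToSemistable k) (P.torus_preimage_le k V')) hr
  rw [map_mul, pull_resFun, pull_torusToSemistable, pull_seriesMap] at h1
  have hW : P.toSeries k ⁻¹ᵁ V' ⊓ (F.specChartι k (P.coneOf j)).opensRange ≤
    P.toSeries k ⁻¹ᵁ V' := inf_le_left
  refine ⟨_, hW.trans (preimage_mono _ h), P.coneOf j, P.pathChar j i,
    resFun hW (pull (P.toSeries k) le_rfl r), ⟨hxV, hj⟩, inf_le_right,
    P.isLocalGenerator_pathChar hL j i, ?_⟩
  have h2 := congrArg (resFun (preimage_mono (F.torusι k) hW)) h1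
  rw [map_mul, resFun_character, resFun_pull, resFun_pull (F.torusι k)] at h2
  rw [pull_resFun, resFun_pull]
  exact h2

/-- The pullback of a semi-invariant function to the torus, as a section of a line bundle. -/
def bundleSection (hL : L 0 = 0) {i : Fin (l + 1)} {V : (F.linearSeries L k).Opens}
    (n : Γ(F.tautologicalBundle L k i, V)) : Γ(F.lineBundle k (L i), P.toSeries k ⁻¹ᵁ V) :=
  (P.exists_bundleVal_eq_pull k hL i V n).choose

lemma bundleVal_bundleSection (hL : L 0 = 0) {i : Fin (l + 1)} {V : (F.linearSeries L k).Opens}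
    (n : Γ(F.tautologicalBundle L k i, V)) : bundleVal k (P.bundleSection k hL n) =
      pull (P.torusToSemistable k) (P.torus_preimage_le k V) (tautVal k n) :=
  (P.exists_bundleVal_eq_pull k hL i V n).choose_spec

lemma bundleSection_add (hL : L 0 = 0) {i : Fin (l + 1)} {V : (F.linearSeries L k).Opens}
    (n n' : Γ(F.tautologicalBundle L k i, V)) :
    P.bundleSection k hL (n + n') = P.bundleSection k hL n + P.bundleSection k hL n' := by
  refine bundleVal_injective k ?_
  rw [bundleVal_add, bundleVal_bundleSection, bundleVal_bundleSection, bundleVal_bundleSection,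
    tautVal_add, map_add]

lemma bundleSection_smul (hL : L 0 = 0) {i : Fin (l + 1)} {V : (F.linearSeries L k).Opens}
    (r : Γ(F.linearSeries L k, V)) (n : Γ(F.tautologicalBundle L k i, V)) :
    P.bundleSection k hL (r • n) =
      (pull (P.toSeries k) le_rfl r : Γ(F.toricVariety k, _)) • P.bundleSection k hL n := by
  refine bundleVal_injective k ?_
  rw [bundleVal_smul, bundleVal_bundleSection, bundleVal_bundleSection, tautVal_smul, map_mul,
    pull_seriesMap]

lemma bundleSection_resMod (hL : L 0 = 0) {i : Fin (l + 1)} {V V' : (F.linearSeries L k).Opens}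
    (h : V' ≤ V) (n : Γ(F.tautologicalBundle L k i, V)) :
    P.bundleSection k hL (resMod _ h n) =
      resMod _ (preimage_mono (P.toSeries k) h) (P.bundleSection k hL n) := by
  refine bundleVal_injective k ?_
  rw [bundleVal_resMod, bundleVal_bundleSection, bundleVal_bundleSection, tautVal_resMod,
    pull_resFun, resFun_pull]

/-- The pullback of semi-invariant functions to the torus, as a morphism of sheaves of modules. -/
def bundleMap (hL : L 0 = 0) (i : Fin (l + 1)) : F.tautologicalBundle L k i ⟶
    (Scheme.Modules.pushforward (P.toSeries k)).obj (F.lineBundle k (L i)) :=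
  modulesHomMk (fun _ => AddMonoidHom.mk' (P.bundleSection k hL) (P.bundleSection_add k hL))
    (fun V r n => (P.bundleSection_smul k hL r n).trans
      (congrArg (fun a : Γ(F.toricVariety k, P.toSeries k ⁻¹ᵁ V) => a • P.bundleSection k hL n)
        (app_eq_pull (P.toSeries k) V r).symm))
    (fun _ _ h n => P.bundleSection_resMod k hL h n)

lemma path_mem (i : Fin (l + 1)) (j : J) : MvPolynomial.monomial (P.path j i) (1 : k) ∈
    F.weightPiece L k (Pi.single i 1 - Pi.single 0 1 + 0 • theta l) := by
  rw [zero_smul, add_zero]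
  exact monomial_mem_weightPiece k _ 1 (P.inc_path j i)

lemma exists_pathSection (i : Fin (l + 1)) (j : J) :
    ∃ n : Γ(F.tautologicalBundle L k i, ⊤), tautVal k n =
      semistableFun (F.thetaPieces L k) (seriesMap F L k ⁻¹ᵁ ⊤)
        (MvPolynomial.monomial (P.path j i) 1) :=
  semistableFun_mem (F.thetaPieces L k)
    (fun n => F.weightPiece L k (Pi.single i 1 - Pi.single 0 1 + n • theta l))
    (P.path_mem k i j) ⊤

/-- The section of a tautological bundle given by a path. -/
def pathSection (i : Fin (l + 1)) (j : J) : Γ(F.tautologicalBundle L k i, ⊤) :=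
  (P.exists_pathSection k i j).choose

lemma tautVal_pathSection (i : Fin (l + 1)) (j : J) :
    tautVal k (P.pathSection k i j) = semistableFun (F.thetaPieces L k) (seriesMap F L k ⁻¹ᵁ ⊤)
      (MvPolynomial.monomial (P.path j i) 1) :=
  (P.exists_pathSection k i j).choose_spec

lemma bundleVal_transported (hL : L 0 = 0) (i : Fin (l + 1)) (j : J)
    (W : (F.toricVariety k).Opens) (h : W ≤ P.toSeries k ⁻¹ᵁ ⊤) :
    bundleVal k (transported (P.toSeries k) (P.bundleMap k hL i) ⊤ (P.pathSection k i j) W h) =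
      F.character k (P.pathChar j i) _ := by
  have h1 : transported (P.toSeries k) (P.bundleMap k hL i) ⊤ (P.pathSection k i j) W h =
    resMod _ h (P.bundleSection k hL (P.pathSection k i j)) := rfl
  rw [h1, bundleVal_resMod, bundleVal_bundleSection, tautVal_pathSection, pull_torusToSemistable,
    resFun_character]

/-- The sections given by the paths are local frames of the tautological bundles and of the line
bundles on the toric variety. -/
def localFrames (hL : L 0 = 0) (i : Fin (l + 1)) : LocalFrames (P.bundleMap k hL i) J where
  opens j := (F.specChartι k (P.coneOf j)).opensRange
  section_ j := P.pathSection k i j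
  cover := P.exists_mem_opensRange k
  generates j x hx V n hV := by
    obtain ⟨V', h, hxV, r, hr⟩ := P.tautologicalBundle_generates k i j hx hV n
    refine ⟨V', h, hxV, r, tautVal_injective k ?_⟩
    rw [tautVal_resMod, tautVal_smul, tautVal_resMod, tautVal_pathSection, resFun_semistableFun, hr]
  spans j x hx W s hW := by
    obtain ⟨W', h, hxW, r, hr⟩ := F.lineBundle_generates k (P.coneOf j)
      (P.isLocalGenerator_pathChar hL j i) hx hW s
    refine ⟨W', h, hxW, r, bundleVal_injective k ?_⟩
    have h2 := P.bundleVal_transported k hL i j W' (le_preimage_top _ W')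
    rw [bundleVal_resMod, bundleVal_smul]
    exact hr.trans (congrArg (pull (F.torusι k) le_rfl r * ·) h2.symm)
  -- The frame is a character, hence a unit on the torus, and functions on the chart are determined
  -- by their restriction to the torus.
  free j W hW r hr := by
    have h1 := congrArg (bundleVal k) hr
    rw [bundleVal_smul, bundleVal_zero] at h1
    have h2 := P.bundleVal_transported k hL i j W (le_preimage_top _ W)
    replace h1 := (congrArg (pull (F.torusι k) le_rfl r * ·) h2.symm).trans h1
    refine F.pull_torusι_injective k (P.coneOf j) hW ?_
    rw [map_zero]
    exact (F.isUnit_character k _ _).mul_left_eq_zero.1 h1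

lemma nonempty_pullback_tautologicalBundle_iso (hL : L 0 = 0) (i : Fin (l + 1)) :
    Nonempty ((Scheme.Modules.pullback (P.toSeries k)).obj (F.tautologicalBundle L k i) ≅
      F.lineBundle k (L i)) :=
  (P.localFrames k hL i).nonempty_pullback_iso

end ChartData

end SmoothFan


/-! ### Arithmetic of the continued fraction and the rays -/

lemma hjFraction_cons (b : ℚ) {l : List ℚ} (hl : l ≠ []) :
    hjFraction (b :: l) = b - 1 / hjFraction l := by
  cases l with
  | nil => exact absurd rfl hl
  | cons b' l => rfl

namespace CyclicType

variable (τ : CyclicType)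

/-- The continued fraction `[c i, …, c 1]`. -/
def tailFraction (i : ℕ) : ℚ := hjFraction ((List.range i).map fun j => (τ.c (i - j) : ℚ))

lemma tailFraction_zero : τ.tailFraction 0 = 0 := rfl

lemma tailFraction_one : τ.tailFraction 1 = τ.c 1 := rfl

lemma tailFraction_succ {i : ℕ} (hi : 1 ≤ i) :
    τ.tailFraction (i + 1) = τ.c (i + 1) - 1 / τ.tailFraction i := by
  rw [tailFraction, List.range_succ_eq_map, List.map_cons, List.map_map, hjFraction_cons]
  · rw [tailFraction]
    congr 4
    funext j
    simp [Nat.succ_eq_add_one]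
  · simp only [ne_eq, List.map_eq_nil_iff, List.range_eq_nil]
    omega

lemma one_lt_tailFraction {i : ℕ} (hi : 1 ≤ i) (hi' : i ≤ τ.ℓ) : 1 < τ.tailFraction i := by
  induction i, hi using Nat.le_induction with
  | base =>
    rw [tailFraction_one]
    exact_mod_cast τ.two_le_c 1 le_rfl hi'
  | succ i hi ih =>
    have h1 := ih (by omega)
    have h2 : (2 : ℚ) ≤ τ.c (i + 1) := by exact_mod_cast τ.two_le_c (i + 1) (by omega) hi'
    have h3 : 1 / τ.tailFraction i < 1 := by
      rw [div_lt_one (by linarith)]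
      exact h1
    rw [τ.tailFraction_succ hi]
    linarith

lemma r_div_a : (τ.r : ℚ) / τ.a = τ.tailFraction τ.ℓ := τ.fraction

lemma one_le_ℓ : 1 ≤ τ.ℓ := by
  by_contra h
  have h0 : τ.ℓ = 0 := by omega
  have h1 := τ.r_div_a
  rw [h0, tailFraction_zero] at h1
  have h2 : (0 : ℚ) < τ.r := by exact_mod_cast τ.r_pos
  have h3 : (0 : ℚ) < τ.a := by exact_mod_cast τ.a_pos
  exact (div_pos h2 h3).ne' h1

lemma α_last : τ.α (τ.ℓ + 1) = τ.r := by simp [α, pairFromTop]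

lemma β_last : τ.β (τ.ℓ + 1) = 0 := by simp [β, pairFromTop]

lemma α_ℓ : τ.α τ.ℓ = τ.a := by simp [α, pairFromTop]

lemma β_ℓ : τ.β τ.ℓ = 1 := by simp [β, pairFromTop]

lemma pairFromTop_eq {i : ℕ} (hi : 1 ≤ i) (hi' : i ≤ τ.ℓ) :
    τ.pairFromTop (τ.ℓ + 1 - (i - 1)) =
      (τ.c i : ℤ) • τ.pairFromTop (τ.ℓ + 1 - i) - τ.pairFromTop (τ.ℓ + 1 - (i + 1)) := by
  have e1 : τ.ℓ + 1 - (i - 1) = (τ.ℓ - i) + 2 := by omega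
  have e2 : τ.ℓ + 1 - i = (τ.ℓ - i) + 1 := by omega
  have e3 : τ.ℓ + 1 - (i + 1) = τ.ℓ - i := by omega
  have e4 : τ.ℓ - (τ.ℓ - i) = i := by omega
  rw [e1, e2, e3, pairFromTop, e4]

lemma α_pred {i : ℕ} (hi : 1 ≤ i) (hi' : i ≤ τ.ℓ) :
    τ.α (i - 1) = τ.c i * τ.α i - τ.α (i + 1) := by
  simp [α, τ.pairFromTop_eq hi hi']

lemma β_pred {i : ℕ} (hi : 1 ≤ i) (hi' : i ≤ τ.ℓ) :
    τ.β (i - 1) = τ.c i * τ.β i - τ.β (i + 1) := by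
  simp [β, τ.pairFromTop_eq hi hi']

/-- Descending induction from α_{ℓ+1} / α_ℓ = r / a: the recursion for α peels off one entry of the
continued fraction at a time, and the tails exceed 1. -/
lemma α_pos_and_eq {i : ℕ} (hi : 1 ≤ i) (hi' : i ≤ τ.ℓ) :
    0 < τ.α i ∧ (τ.α (i + 1) : ℚ) = τ.tailFraction i * τ.α i := by
  induction hi' using Nat.decreasingInduction with
  | self =>
    have h3 : (0 : ℚ) < τ.a := by exact_mod_cast τ.a_pos
    rw [α_last, α_ℓ, ← r_div_a]
    refine ⟨by exact_mod_cast τ.a_pos, ?_⟩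
    push_cast
    field_simp
  | of_succ i hlt ih =>
    obtain ⟨h1, h2⟩ := ih (by omega)
    have h3 := τ.α_pred (i := i + 1) (by omega) hlt
    rw [Nat.add_sub_cancel] at h3
    have h4 := τ.tailFraction_succ hi
    have h5 := τ.one_lt_tailFraction hi hlt.le
    have h6 : (τ.α i : ℚ) = 1 / τ.tailFraction i * τ.α (i + 1) := by
      rw [h3]
      push_cast
      rw [h2, h4]
      ring
    have h7 : (0 : ℚ) < τ.α (i + 1) := by exact_mod_cast h1
    refine ⟨?_, ?_⟩
    · have : (0 : ℚ) < τ.α i := by rw [h6]; positivity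
      exact_mod_cast this
    · rw [h6]
      field_simp

lemma α_pos {i : ℕ} (hi : 1 ≤ i) (hi' : i ≤ τ.ℓ + 1) : 0 < τ.α i := by
  rcases hi'.lt_or_eq with h | rfl
  · exact (τ.α_pos_and_eq hi (by omega)).1
  · rw [α_last]; exact τ.r_pos

/-- The recursion closes up because the last tail of the continued fraction is c 1 itself. -/
lemma α_zero : τ.α 0 = 0 := by
  have h1 := τ.α_pred le_rfl τ.one_le_ℓ
  have h2 := (τ.α_pos_and_eq le_rfl τ.one_le_ℓ).2
  rw [tailFraction_one] at h2
  have h3 : (τ.α 2 : ℤ) = τ.c 1 * τ.α 1 := by exact_mod_cast h2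
  simp only [Nat.sub_self, Nat.reduceAdd] at h1
  omega

lemma α_lt_succ {i : ℕ} (hi : i ≤ τ.ℓ) : τ.α i < τ.α (i + 1) := by
  rcases Nat.eq_zero_or_pos i with rfl | h
  · rw [α_zero]; exact τ.α_pos le_rfl (by omega)
  · obtain ⟨h1, h2⟩ := τ.α_pos_and_eq h hi
    have h3 := τ.one_lt_tailFraction h hi
    have h4 : (0 : ℚ) < τ.α i := by exact_mod_cast h1
    have h5 : (τ.α i : ℚ) < τ.α (i + 1) := by rw [h2]; exact lt_mul_of_one_lt_left h4 h3
    exact_mod_cast h5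

lemma α_lt {i j : ℕ} (hij : i < j) (hj : j ≤ τ.ℓ + 1) : τ.α i < τ.α j := by
  induction j, hij using Nat.le_induction with
  | base => exact τ.α_lt_succ (by omega)
  | succ j hij ih => exact (ih (by omega)).trans (τ.α_lt_succ (by omega))

lemma α_nonneg {i : ℕ} (hi : i ≤ τ.ℓ + 1) : 0 ≤ τ.α i := by
  rcases Nat.eq_zero_or_pos i with rfl | h
  · exact τ.α_zero.ge
  · exact (τ.α_pos h hi).le

/-- Since c_i ≥ 2, the recursion makes β convex, and it starts with the values 0 and 1 at the top.
-/
lemma β_succ_lt_and_nonneg {i : ℕ} (hi : i ≤ τ.ℓ) : τ.β (i + 1) < τ.β i ∧ 0 ≤ τ.β (i + 1) := by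
  induction hi using Nat.decreasingInduction with
  | self => rw [β_last, β_ℓ]; exact ⟨one_pos, le_rfl⟩
  | of_succ i hlt ih =>
    have h1 := τ.β_pred (i := i + 1) (by omega) hlt
    rw [Nat.add_sub_cancel] at h1
    have h2 : (2 : ℤ) ≤ τ.c (i + 1) := by exact_mod_cast τ.two_le_c (i + 1) (by omega) hlt
    constructor <;> nlinarith

lemma β_lt {i j : ℕ} (hij : i < j) (hj : j ≤ τ.ℓ + 1) : τ.β j < τ.β i := by
  induction j, hij using Nat.le_induction with
  | base => exact (τ.β_succ_lt_and_nonneg (by omega)).1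
  | succ j hij ih => exact (τ.β_succ_lt_and_nonneg (by omega)).1.trans (ih (by omega))

lemma β_nonneg {i : ℕ} (hi : i ≤ τ.ℓ + 1) : 0 ≤ τ.β i := by
  rcases hi.lt_or_eq with h | rfl
  · have := τ.β_lt h le_rfl
    rw [β_last] at this
    exact this.le
  · exact τ.β_last.ge

lemma rayPairing_mul (i : ℕ) (m : τ.M) :
    τ.rayPairing i m * τ.r = τ.β i * m.1.1 + τ.α i * m.1.2 :=
  Int.ediv_mul_cancel (τ.dvd_pairing i m)

lemma rayPairing_ratio_mul (q i : ℕ) :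
    τ.rayPairing q (τ.ratio i) * τ.r = τ.β q * τ.α i - τ.α q * τ.β i := by
  rw [rayPairing_mul, ratio]
  ring

lemma rayPairing_ratio_self (i : ℕ) : τ.rayPairing i (τ.ratio i) = 0 :=
  τ.rayPairing_eq (by simp only [ratio]; ring)

lemma rayPairing_ratio_succ {i : ℕ} (hi : i ≤ τ.ℓ) : τ.rayPairing i (τ.ratio (i + 1)) = 1 :=
  τ.rayPairing_eq (by simp only [ratio]; linear_combination τ.det_eq hi)

lemma rayPairing_succ_ratio {i : ℕ} (hi : i ≤ τ.ℓ) : τ.rayPairing (i + 1) (τ.ratio i) = -1 :=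
  τ.rayPairing_eq (by simp only [ratio]; linear_combination -τ.det_eq hi)

/-- The generators turn monotonically: β decreases, α increases, and both are nonnegative. -/
lemma det_pos {q i : ℕ} (h : q < i) (hi : i ≤ τ.ℓ + 1) :
    0 < τ.β q * τ.α i - τ.α q * τ.β i := by
  have h1 := τ.β_lt h hi
  have h2 := τ.α_lt h hi
  have h3 := τ.β_nonneg hi
  have h4 := τ.α_nonneg (i := q) (by omega)
  nlinarith

lemma rayPairing_ratio_pos {q i : ℕ} (h : q < i) (hi : i ≤ τ.ℓ + 1) :
    0 < τ.rayPairing q (τ.ratio i) := by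
  have h1 := τ.det_pos h hi
  rw [← rayPairing_ratio_mul] at h1
  exact pos_of_mul_pos_left h1 τ.r_pos.le

lemma rayPairing_ratio_neg {q i : ℕ} (h : i < q) (hq : q ≤ τ.ℓ + 1) :
    τ.rayPairing q (τ.ratio i) < 0 := by
  have h1 := τ.det_pos h hq
  have h2 := τ.rayPairing_ratio_mul q i
  have h3 := τ.r_pos
  nlinarith

/-- Cramer's rule: adjacent rays have determinant r, which is nonzero. -/
lemma eq_zero_of_rayPairing_eq_zero {j : ℕ} (hj : j ≤ τ.ℓ) {m : τ.M} (h : τ.rayPairing j m = 0)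
    (h' : τ.rayPairing (j + 1) m = 0) : m = 0 := by
  have h1 := τ.rayPairing_mul j m
  have h2 := τ.rayPairing_mul (j + 1) m
  have h3 := τ.det_eq hj
  have h4 := τ.r_pos.ne'
  rw [h, zero_mul] at h1
  rw [h', zero_mul] at h2
  refine Subtype.ext (Prod.ext (mul_left_cancel₀ h4 ?_) (mul_left_cancel₀ h4 ?_))
  · simp only [ZeroMemClass.coe_zero, Prod.fst_zero, mul_zero]
    rw [← h3]
    linear_combination -τ.α (j + 1) * h1 + τ.α j * h2
  · simp only [ZeroMemClass.coe_zero, Prod.snd_zero, mul_zero]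
    rw [← h3]
    linear_combination τ.β (j + 1) * h1 - τ.β j * h2

lemma rayPairing_nonneg {q : ℕ} (hq : q ≤ τ.ℓ + 1) {m : τ.M} (h : 0 ≤ m.1.1) (h' : 0 ≤ m.1.2) :
    0 ≤ τ.rayPairing q m := by
  have h1 : 0 ≤ τ.rayPairing q m * τ.r := by
    rw [rayPairing_mul]
    exact add_nonneg (mul_nonneg (τ.β_nonneg hq) h) (mul_nonneg (τ.α_nonneg hq) h')
  exact nonneg_of_mul_nonneg_left h1 τ.r_pos

end CyclicType


/-! ### Sections as labels of paths -/

namespace SmoothFan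

variable {M : Type} [AddCommGroup M] {ι : Type} [DecidableEq ι] [Fintype ι] (F : SmoothFan M ι)
  {l : ℕ} {L : Fin (l + 1) → ι → ℤ}

/-- If the line bundles are pairwise distinct, every section is the label of a path. -/
lemma exists_totalDiv_eq (hL : ∀ i j, F.IsSection (L i) (L j) 0 → i = j) {i j : Fin (l + 1)}
    {d : ι → ℕ} (hd : F.IsSection (L i) (L j) d) :
    ∃ u, F.totalInc L u = Pi.single j 1 - Pi.single i 1 ∧ F.totalDiv L u = d := by
  -- Induction on the total degree of the divisor. A reducible section splits into two nonzero
  -- effective parts of smaller degree, and the hypothesis excludes a trivial section between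
  -- distinct vertices.
  induction hn : ∑ q, d q using Nat.strong_induction_on generalizing i j d with
  | _ n ih =>
    have hpos : ∀ e : ι → ℕ, e ≠ 0 → 0 < ∑ q, e q := fun e he => by
      obtain ⟨q, hq⟩ := Function.ne_iff.1 he
      exact Finset.sum_pos' (fun _ _ => Nat.zero_le _) ⟨q, Finset.mem_univ _, Nat.pos_of_ne_zero hq⟩
    by_cases h0 : d = 0
    · subst h0
      obtain rfl := hL i j hd
      exact ⟨0, by simp, by simp⟩
    · by_cases hirr : F.IsIrreducibleSection L i j d
      · refine ⟨Finsupp.single ⟨i, j, d, hirr⟩ 1, ?_, ?_⟩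
        · rw [totalInc, Finsupp.weight_single, one_smul, inc]
        · rw [totalDiv, Finsupp.weight_single, one_smul]
      · obtain ⟨v, d₁, d₂, h₁, h₂, hs, hne₁, hne₂⟩ : ∃ v d₁ d₂, F.IsSection (L i) (L v) d₁ ∧
            F.IsSection (L v) (L j) d₂ ∧ d₁ + d₂ = d ∧ d₁ ≠ 0 ∧ d₂ ≠ 0 := by
          by_contra! hcon
          refine hirr ⟨hd, h0, fun v d₁ d₂ h₁ h₂ hs => ?_⟩
          by_contra! hne
          exact hne.2 (hcon v d₁ d₂ h₁ h₂ hs hne.1)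
        have hsum : ∑ q, d₁ q + ∑ q, d₂ q = n := by
          rw [← hn, ← hs, ← Finset.sum_add_distrib]
          rfl
        have hp₁ := hpos d₁ hne₁
        have hp₂ := hpos d₂ hne₂
        obtain ⟨u₁, hi₁, hd₁⟩ := ih _ (by omega) h₁ rfl
        obtain ⟨u₂, hi₂, hd₂⟩ := ih _ (by omega) h₂ rfl
        refine ⟨u₁ + u₂, ?_, ?_⟩
        · rw [map_add, hi₁, hi₂]
          abel
        · rw [map_add, hd₁, hd₂, hs]

lemma exists_totalDiv_eq_ray (hL : ∀ i j, F.IsSection (L i) (L j) 0 → i = j) (i j : Fin (l + 1))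
    (m : M) (hm : ∀ q, 0 ≤ F.ray q m + L j q - L i q) :
    ∃ u, F.totalInc L u = Pi.single j 1 - Pi.single i 1 ∧
      ∀ q, (F.totalDiv L u q : ℤ) = F.ray q m + L j q - L i q := by
  obtain ⟨u, hu, hu'⟩ := F.exists_totalDiv_eq hL
    (d := fun q => (F.ray q m + L j q - L i q).toNat) ⟨m, fun q => Int.toNat_of_nonneg (hm q)⟩
  exact ⟨u, hu, fun q => by rw [hu']; exact Int.toNat_of_nonneg (hm q)⟩

end SmoothFan

/-! ### The line bundles dual to the exceptional curves -/

namespace CyclicType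

variable (τ : CyclicType)

/-- The quotient of the local generators of the line bundle dual to the `l`-th exceptional curve on
the two sides of this curve; it is trivial for `l = 0`, which stands for the structure sheaf. -/
def step (l : ℕ) : τ.M := if l = 0 then 0 else τ.ratio l

lemma step_zero : τ.step 0 = 0 := if_pos rfl

lemma step_of_pos {l : ℕ} (hl : 0 < l) : τ.step l = τ.ratio l := if_neg hl.ne'

lemma rayPairing_step_nonneg {q l : ℕ} (h : q ≤ l) (hl : l ≤ τ.ℓ + 1) :
    0 ≤ τ.rayPairing q (τ.step l) := by
  rcases Nat.eq_zero_or_pos l with rfl | hl'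
  · rw [step_zero, map_zero]
  · rw [step_of_pos τ hl']
    rcases h.lt_or_eq with h | rfl
    · exact (τ.rayPairing_ratio_pos h hl).le
    · exact (τ.rayPairing_ratio_self q).ge

lemma rayPairing_step_nonpos {q l : ℕ} (h : l ≤ q) (hq : q ≤ τ.ℓ + 1) :
    τ.rayPairing q (τ.step l) ≤ 0 := by
  rcases Nat.eq_zero_or_pos l with rfl | hl'
  · rw [step_zero, map_zero]
  · rw [step_of_pos τ hl']
    rcases h.lt_or_eq with h | rfl
    · exact (τ.rayPairing_ratio_neg h hq).le
    · exact (τ.rayPairing_ratio_self l).le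

/-- The order of the `l`-th line bundle along the `q`-th divisor, after normalization by a
character. -/
def order (l q : ℕ) : ℤ := max 0 (-τ.rayPairing q (τ.step l))

lemma order_nonneg (l q : ℕ) : 0 ≤ τ.order l q := le_max_left _ _

lemma order_eq_zero {l q : ℕ} (h : q ≤ l) (hl : l ≤ τ.ℓ + 1) : τ.order l q = 0 :=
  max_eq_left (neg_nonpos.2 (τ.rayPairing_step_nonneg h hl))

lemma order_eq_neg {l q : ℕ} (h : l ≤ q) (hq : q ≤ τ.ℓ + 1) :
    τ.order l q = -τ.rayPairing q (τ.step l) :=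
  max_eq_right (neg_nonneg.2 (τ.rayPairing_step_nonpos h hq))

lemma order_zero_left (q : ℕ) : τ.order 0 q = 0 := by simp [order, step_zero]

lemma order_pos {l q : ℕ} (hl : 0 < l) (h : l < q) (hq : q ≤ τ.ℓ + 1) : 0 < τ.order l q := by
  rw [τ.order_eq_neg h.le hq, step_of_pos τ hl]
  exact neg_pos.2 (τ.rayPairing_ratio_neg h hq)

lemma rayPairing_step_add_order_nonneg (l q : ℕ) : 0 ≤ τ.rayPairing q (τ.step l) + τ.order l q := by
  have := le_max_right 0 (-τ.rayPairing q (τ.step l))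
  rw [← order] at this
  linarith

lemma mem_maxCone {j : Fin (τ.ℓ + 1)} {q : Fin (τ.ℓ + 2)} :
    q ∈ τ.maxCone j ↔ (q : ℕ) = j ∨ (q : ℕ) = j + 1 := by
  simp [maxCone, Fin.ext_iff]

lemma exists_isLocalGenerator (D : Fin (τ.ℓ + 2) → ℤ) (j : Fin (τ.ℓ + 1)) :
    ∃ m, τ.fan.IsLocalGenerator D (τ.maxCone j) m := by
  have hj : (j : ℕ) ≤ τ.ℓ := by omega
  refine ⟨-D j.castSucc • τ.ratio (j + 1) + D j.succ • τ.ratio j, fun q hq => ?_⟩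
  have hq' : q = j.castSucc ∨ q = j.succ := by simpa [maxCone] using hq
  rcases hq' with rfl | rfl
  · change τ.rayPairing j _ = _
    rw [map_add, map_zsmul, map_zsmul, rayPairing_ratio_self, τ.rayPairing_ratio_succ hj]
    simp
  · change τ.rayPairing (j + 1) _ = _
    rw [map_add, map_zsmul, map_zsmul, rayPairing_ratio_self, τ.rayPairing_succ_ratio hj]
    simp

/-- The line bundles `L_0 = 𝒪`, `L_1, …, L_ℓ` dual to the exceptional curves, normalized by
characters. -/
lemma exists_eq_order (D : Fin (τ.ℓ + 1) → Fin (τ.ℓ + 2) → ℤ) (hD₀ : D 0 = 0)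
    (hD : ∀ i j : Fin τ.ℓ, τ.HasDegree (D i.succ) j (if i = j then 1 else 0)) :
    ∃ A : Fin (τ.ℓ + 1) → τ.M, ∀ l q, D l q = τ.order l q - τ.rayPairing q (A l) := by
  choose g hg using fun l j => τ.exists_isLocalGenerator (D l) j
  have hg0 : ∀ j, g 0 j = 0 := fun j => by
    refine τ.eq_zero_of_rayPairing_eq_zero (j := j) (by omega) ?_ ?_
    · exact (hg 0 j j.castSucc (τ.mem_maxCone.2 (Or.inl rfl))).trans (by simp [hD₀])
    · exact (hg 0 j j.succ (τ.mem_maxCone.2 (Or.inr rfl))).trans (by simp [hD₀])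
  -- Crossing a curve changes the local generator by the degree times the ratio at that curve. So
  -- the l-th bundle changes only at D_l, and the trivial bundle never does.
  have hstep : ∀ (l : Fin (τ.ℓ + 1)) (j : Fin τ.ℓ), g l j.succ =
      g l j.castSucc + if (l : ℕ) = j + 1 then τ.step l else 0 := by
    intro l j
    induction l using Fin.cases with
    | zero => simp [hg0]
    | succ l =>
      have h := hD l j _ _ (hg l.succ j.castSucc) (hg l.succ j.succ)
      rw [sub_eq_iff_eq_add'] at h
      rw [h]
      congr 1
      by_cases hl : l = j
      · subst hl; simp [step]
      · rw [if_neg hl, if_neg, zero_smul]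
        simpa [Fin.ext_iff] using hl
  have hgj : ∀ (l : Fin (τ.ℓ + 1)) (j : ℕ) (hj : j < τ.ℓ + 1), g l ⟨j, hj⟩ =
      g l 0 + if (l : ℕ) ≤ j then τ.step l else 0 := by
    intro l j
    induction j with
    | zero =>
      intro hj
      by_cases hl : (l : ℕ) = 0
      · rw [hl]; simp [step_zero]
      · rw [if_neg (by omega), add_zero]; rfl
    | succ j ih =>
      intro hj
      refine (hstep l ⟨j, by omega⟩).trans ?_
      have e := ih (by omega)
      change g l ⟨j, _⟩ + _ = _
      rw [e, add_assoc]
      congr 1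
      by_cases h1 : (l : ℕ) ≤ j
      · rw [if_pos h1, if_neg (by simp only; omega), if_pos (by omega), add_zero]
      · by_cases h2 : (l : ℕ) = j + 1
        · rw [if_neg h1, if_pos h2, if_pos h2.le, zero_add]
        · rw [if_neg h1, if_neg h2, if_neg (by omega), zero_add]
  -- The normalizing character is the generator on the first cone; after removing it the bundle has
  -- order zero up to its own curve.
  refine ⟨fun l => g l 0, fun l q => ?_⟩
  induction q using Fin.cases with
  | zero =>
    have h := hg l 0 0 (τ.mem_maxCone.2 (Or.inl rfl))
    change τ.rayPairing 0 (g l 0) = _ at h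
    rw [Fin.val_zero, h, τ.order_eq_zero (Nat.zero_le _) (by omega)]
    ring
  | succ j =>
    have h := hg l j j.succ (τ.mem_maxCone.2 (Or.inr rfl))
    change τ.rayPairing (j + 1) (g l j) = _ at h
    rw [hgj l j j.2, map_add] at h
    rw [Fin.val_succ]
    split_ifs at h with hl
    · rw [τ.order_eq_neg (by omega) (by omega)]
      linarith
    · rw [τ.order_eq_zero (by omega) (by omega)]
      rw [map_zero] at h
      linarith

section Order

variable {τ} {D : Fin (τ.ℓ + 1) → Fin (τ.ℓ + 2) → ℤ} {A : Fin (τ.ℓ + 1) → τ.M}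
  (hA : ∀ l q, D l q = τ.order l q - τ.rayPairing q (A l))

include hA

/-- An isomorphism makes the normalized orders equal up to a character, which must be trivial. The
vanishing of the orders then tells the vertices apart: for l > 0 they vanish exactly up to the ray
l, and for l = 0 everywhere. -/
lemma eq_of_isSection_zero {i j : Fin (τ.ℓ + 1)} (h : τ.fan.IsSection (D i) (D j) 0) : i = j := by
  obtain ⟨m, hm⟩ := h
  have hm' : ∀ q : ℕ, q ≤ τ.ℓ + 1 →
      τ.rayPairing q (m + A i - A j) = τ.order i q - τ.order j q := fun q hq => by
    have h : (0 : ℤ) = τ.rayPairing q m + D j ⟨q, by omega⟩ - D i ⟨q, by omega⟩ := hm ⟨q, by omega⟩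
    rw [hA, hA] at h
    rw [map_sub, map_add]
    simp only at h
    linarith
  -- All orders vanish on the first two rays. These span a maximal cone, so the comparing character
  -- is zero.
  have hone : ∀ l : Fin (τ.ℓ + 1), τ.order l 1 = 0 := fun l => by
    rcases Nat.eq_zero_or_pos (l : ℕ) with h | h
    · rw [h, order_zero_left]
    · exact τ.order_eq_zero h (by omega)
  have h0 : m + A i - A j = 0 := by
    refine τ.eq_zero_of_rayPairing_eq_zero (Nat.zero_le _) ?_ ?_
    · rw [hm' 0 (by omega), τ.order_eq_zero (Nat.zero_le _) (by omega),
        τ.order_eq_zero (Nat.zero_le _) (by omega), sub_zero]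
    · rw [hm' (0 + 1) (by omega), zero_add, hone, hone, sub_zero]
  have hord : ∀ q : ℕ, q ≤ τ.ℓ + 1 → τ.order i q = τ.order j q := fun q hq => by
    have := hm' q hq
    rw [h0, map_zero] at this
    linarith
  have key : ∀ i j : Fin (τ.ℓ + 1), i < j → (∀ q : ℕ, q ≤ τ.ℓ + 1 → τ.order i q = τ.order j q) →
      False := by
    intro i j hij h
    have hij' : (i : ℕ) < j := hij
    rcases Nat.eq_zero_or_pos (i : ℕ) with hi | hi
    · have h1 := h (τ.ℓ + 1) le_rfl
      have h2 := τ.order_pos (l := j) (q := τ.ℓ + 1) (by omega) (by omega) le_rfl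
      rw [hi, order_zero_left] at h1
      omega
    · have h1 := h j (by omega)
      have h2 := τ.order_pos hi hij' (by omega)
      rw [τ.order_eq_zero (l := j) le_rfl (by omega)] at h1
      omega
  rcases lt_trichotomy i j with h | h | h
  · exact (key i j h hord).elim
  · exact h
  · exact (key j i h fun q hq => (hord q hq).symm).elim

/-- Paths from `0` to `l`. -/
lemma exists_path (hD₀ : D 0 = 0) (l : Fin (τ.ℓ + 1)) (m : τ.M)
    (hm : ∀ q : ℕ, q ≤ τ.ℓ + 1 → 0 ≤ τ.rayPairing q m + τ.order l q) :
    ∃ u, τ.fan.totalInc D u = Pi.single l 1 - Pi.single 0 1 ∧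
      ∀ q, (τ.fan.totalDiv D u q : ℤ) = τ.rayPairing q m + τ.order l q := by
  have e : ∀ q : Fin (τ.ℓ + 2), τ.fan.ray q (m + A l) + D l q - D 0 q =
      τ.rayPairing q m + τ.order l q := fun q => by
    change τ.rayPairing q (m + A l) + D l q - D 0 q = _
    rw [hA, hD₀, map_add, Pi.zero_apply]
    ring
  obtain ⟨u, hu, hu'⟩ := τ.fan.exists_totalDiv_eq_ray (fun i j => eq_of_isSection_zero hA) 0 l
    (m + A l) fun q => by rw [e]; exact hm q (by omega)
  exact ⟨u, hu, fun q => (hu' q).trans (e q)⟩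

/-- The case of the vertex 0: invariant regular functions on X are labels of monomials of weight
zero. -/
lemma exists_loop (hD₀ : D 0 = 0) (m : τ.M)
    (hm : ∀ q : ℕ, q ≤ τ.ℓ + 1 → 0 ≤ τ.rayPairing q m) :
    ∃ u, τ.fan.totalInc D u = 0 ∧ ∀ q, (τ.fan.totalDiv D u q : ℤ) = τ.rayPairing q m := by
  obtain ⟨u, hu, hu'⟩ := exists_path hA hD₀ 0 m fun q hq => by
    rw [Fin.val_zero, order_zero_left, add_zero]; exact hm q hq
  refine ⟨u, by rw [hu, sub_self], fun q => ?_⟩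
  rw [hu', Fin.val_zero, order_zero_left, add_zero]

end Order

end CyclicType


/-! ### Chart data for the minimal resolution -/

namespace CyclicType

variable (τ : CyclicType)

/-- The character of the section of the `l`-th line bundle, normalized, that generates it on the
chart of the `j`-th maximal cone. -/
def genChar (j l : ℕ) : τ.M := if l ≤ j then τ.step l else 0

lemma genChar_add_order_nonneg (j l q : ℕ) : 0 ≤ τ.rayPairing q (τ.genChar j l) + τ.order l q := by
  rw [genChar]
  split_ifs
  · exact τ.rayPairing_step_add_order_nonneg l q
  · rw [map_zero, zero_add]
    exact τ.order_nonneg l q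

/-- A ray of the j-th cone has index at least l when l ≤ j, and at most l otherwise. The two
branches of the order match the two branches of `genChar`. -/
lemma genChar_add_order_eq_zero {j l q : ℕ} (hj : j ≤ τ.ℓ) (hl : l ≤ τ.ℓ)
    (hq : q = j ∨ q = j + 1) : τ.rayPairing q (τ.genChar j l) + τ.order l q = 0 := by
  rw [genChar]
  split_ifs
  · rw [τ.order_eq_neg (by omega) (by omega), add_neg_cancel]
  · rw [map_zero, zero_add]
    exact τ.order_eq_zero (by omega) (by omega)

/-- The character of the section of the product of the line bundles that generates it on the chart
of the `j`-th maximal cone. -/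
def corner (j : ℕ) : τ.M := ∑ l : Fin (τ.ℓ + 1), τ.genChar j l

/-- The order of the product of the line bundles along the `q`-th divisor. -/
def totalOrder (q : ℕ) : ℤ := ∑ l : Fin (τ.ℓ + 1), τ.order l q

lemma corner_zero : τ.corner 0 = 0 :=
  Finset.sum_eq_zero fun l _ => by
    rw [genChar]
    split_ifs with h
    · rw [Nat.le_zero.1 h, step_zero]
    · rfl

/-- Only the bundle of index j + 1 changes its generator between adjacent cones. Hence the edge
between the corners is `ratio (j + 1)`, of horizontal length α_{j+1}. -/
lemma corner_succ {j : ℕ} (hj : j < τ.ℓ) : τ.corner (j + 1) = τ.corner j + τ.ratio (j + 1) := by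
  have h : ∀ l : Fin (τ.ℓ + 1), τ.genChar (j + 1) l =
      τ.genChar j l + if l = ⟨j + 1, by omega⟩ then τ.ratio (j + 1) else 0 := fun l => by
    simp only [genChar, Fin.ext_iff]
    by_cases h1 : (l : ℕ) ≤ j
    · rw [if_pos h1, if_pos (by omega), if_neg (by omega), add_zero]
    · by_cases h2 : (l : ℕ) = j + 1
      · rw [if_neg h1, if_pos h2, if_pos h2.le, zero_add, h2, step_of_pos τ (Nat.succ_pos j)]
      · rw [if_neg h1, if_neg h2, if_neg (by omega), zero_add]
  simp only [corner, h, Finset.sum_add_distrib, Finset.sum_ite_eq', Finset.mem_univ, if_true]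

lemma rayPairing_corner {j q : ℕ} (hj : j ≤ τ.ℓ) (hq : q = j ∨ q = j + 1) :
    τ.rayPairing q (τ.corner j) = -τ.totalOrder q := by
  rw [eq_neg_iff_add_eq_zero, corner, totalOrder, map_sum, ← Finset.sum_add_distrib]
  exact Finset.sum_eq_zero fun l _ => τ.genChar_add_order_eq_zero hj (by omega) hq

/-- The exponent of `x` in an invariant Laurent monomial. -/
def xExponent : τ.M →+ ℤ := (AddMonoidHom.fst ℤ ℤ).comp τ.M.subtype

lemma rayPairing_mul_r (q : ℕ) (m : τ.M) :
    τ.rayPairing q m * τ.r = τ.β q * τ.xExponent m + τ.α q * m.1.2 := τ.rayPairing_mul q m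

/-- The x-term drops out of the pairing with the ray q and α_q > 0, so the y-exponent is
nonnegative. A monomial with nonnegative exponents is regular everywhere. -/
lemma rayPairing_nonneg_of {q : ℕ} (hq : 1 ≤ q) (hq' : q ≤ τ.ℓ + 1) {w : τ.M}
    (h : 0 ≤ τ.xExponent w) (h' : τ.β q * τ.xExponent w = 0) (hw : 0 ≤ τ.rayPairing q w) :
    ∀ i ≤ τ.ℓ + 1, 0 ≤ τ.rayPairing i w := fun i hi => by
  refine τ.rayPairing_nonneg hi h ?_
  have h1 := τ.rayPairing_mul_r q w
  rw [h', zero_add] at h1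
  refine nonneg_of_mul_nonneg_right (a := τ.α q) ?_ (τ.α_pos hq hq')
  rw [← h1]
  exact mul_nonneg hw τ.r_pos.le

/-- A multiple of a section of the `n`-th power of the product of the line bundles factors through
the sections that generate this power on the charts of two adjacent maximal cones. -/
lemma exists_corner_decomposition (n : ℕ) {m : τ.M}
    (hm : ∀ q ≤ τ.ℓ + 1, 0 ≤ τ.rayPairing q m + n * τ.totalOrder q) :
    ∃ N : ℕ, 0 < N ∧ ∃ (j j' : Fin (τ.ℓ + 1)) (a b : ℕ) (w : τ.M), a + b = N * n ∧
      (∀ q ≤ τ.ℓ + 1, 0 ≤ τ.rayPairing q w) ∧ N • m = a • τ.corner j + b • τ.corner j' + w := by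
  -- To the right of the last corner, n copies of that corner split off. The ray ℓ + 1 then bounds
  -- the y-exponent of the rest, as β_{ℓ+1} = 0.
  by_cases h : n * τ.xExponent (τ.corner τ.ℓ) ≤ τ.xExponent m
  · refine ⟨1, one_pos, Fin.last _, Fin.last _, n, 0, m - n • τ.corner τ.ℓ, by omega, ?_, ?_⟩
    · refine τ.rayPairing_nonneg_of (q := τ.ℓ + 1) (by omega) le_rfl ?_ ?_ ?_
      · rw [map_sub, map_nsmul, nsmul_eq_mul]; linarith
      · rw [β_last, zero_mul]
      · rw [map_sub, map_nsmul, nsmul_eq_mul, τ.rayPairing_corner le_rfl (Or.inr rfl)]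
        linarith [hm (τ.ℓ + 1) le_rfl]
    · rw [Fin.val_last, one_smul, zero_smul]; abel
  -- Otherwise the x-exponent lies between the n-fold multiples of two adjacent corners, found by
  -- minimality.
  · have hex : ∃ j, τ.xExponent m < n * τ.xExponent (τ.corner j) := ⟨τ.ℓ, not_le.1 h⟩
    classical
    have hle : Nat.find hex ≤ τ.ℓ := Nat.find_min' hex (not_le.1 h)
    have hspec := Nat.find_spec hex
    have hmin := fun j => Nat.find_min hex (m := j)
    rcases hfind : Nat.find hex with _ | j
    -- It cannot lie to the left of the first corner: along the ray 0 the total order is 0 and α_0 =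
    -- 0, so the x-exponent of m is nonnegative.
    · rw [hfind, corner_zero, map_zero, mul_zero] at hspec
      have h1 := τ.rayPairing_mul_r 0 m
      rw [α_zero, zero_mul, add_zero] at h1
      have h2 : τ.totalOrder 0 = 0 :=
        Finset.sum_eq_zero fun l _ => τ.order_eq_zero (Nat.zero_le _) (by omega)
      have h3 := hm 0 (by omega)
      rw [h2, mul_zero, add_zero] at h3
      have h4 := τ.β_lt (i := 0) (j := τ.ℓ + 1) (by omega) le_rfl
      rw [β_last] at h4
      nlinarith [τ.r_pos, mul_nonneg h3 τ.r_pos.le, mul_pos h4 (neg_pos.2 hspec)]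
    · rw [hfind] at hspec hle
      have hj : n * τ.xExponent (τ.corner j) ≤ τ.xExponent m := not_lt.1 (hmin j (by omega))
      have hα : 0 < τ.α (j + 1) := τ.α_pos (by omega) (by omega)
      have hx : τ.xExponent (τ.corner (j + 1)) = τ.xExponent (τ.corner j) + τ.α (j + 1) := by
        rw [τ.corner_succ hle, map_add]; rfl
      -- N is the horizontal length α_{j+1} of the edge. The distances b and a to its n-fold left
      -- and right ends are the barycentric weights, so that the remainder w has x-exponent 0.
      obtain ⟨N, hN⟩ := Int.eq_ofNat_of_zero_le hα.le
      obtain ⟨b, hb⟩ := Int.eq_ofNat_of_zero_le (sub_nonneg.2 hj)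
      obtain ⟨a, ha⟩ := Int.eq_ofNat_of_zero_le (sub_nonneg.2 hspec.le)
      rw [hx] at ha
      rw [hN] at ha hα hx
      have hab : (a : ℤ) + b = N * n := by rw [← ha, ← hb]; ring
      set w := N • m - (a • τ.corner j + b • τ.corner (j + 1)) with hw
      have hxw : τ.xExponent w = 0 := by
        rw [hw]
        simp only [map_sub, map_add, map_nsmul, nsmul_eq_mul, hx]
        rw [show τ.xExponent m = b + n * τ.xExponent (τ.corner j) by linarith]
        linear_combination -τ.xExponent (τ.corner j) * hab
      refine ⟨N, by exact_mod_cast hα, ⟨j, by omega⟩, ⟨j + 1, by omega⟩, a, b, w,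
        by exact_mod_cast hab, ?_, ?_⟩
      · refine τ.rayPairing_nonneg_of (q := j + 1) (by omega) (by omega) hxw.ge
          (by rw [hxw, mul_zero]) ?_
        have h1 := hm (j + 1) (by omega)
        -- The ray j + 1 belongs to both cones, so both corners have the extremal order along it.
        have h2 : τ.rayPairing (j + 1) w =
            N * (τ.rayPairing (j + 1) m + n * τ.totalOrder (j + 1)) := by
          rw [hw]
          simp only [map_sub, map_add, map_nsmul, nsmul_eq_mul,
            τ.rayPairing_corner (j := j) (by omega) (Or.inr rfl),
            τ.rayPairing_corner (j := j + 1) hle (Or.inl rfl)]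
          linear_combination τ.totalOrder (j + 1) * hab
        rw [h2]
        exact mul_nonneg (Nat.cast_nonneg _) h1
      · rw [hw]; abel

section ChartData

variable {τ} {D : Fin (τ.ℓ + 1) → Fin (τ.ℓ + 2) → ℤ} {A : Fin (τ.ℓ + 1) → τ.M}
  (hA : ∀ l q, D l q = τ.order l q - τ.rayPairing q (A l))

include hA

/-- A monomial of weight n • ϑ is a section of the n-th power of ⊗L_i; the entry −ℓ of ϑ does not
contribute because D 0 = 0. Subtracting the characters A i passes to normalized orders. -/
lemma exists_char (hD₀ : D 0 = 0) (n : ℕ) {u : τ.fan.Arrow D →₀ ℕ}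
    (hu : τ.fan.totalInc D u = n • SmoothFan.theta τ.ℓ) :
    ∃ m, ∀ q, (τ.fan.totalDiv D u q : ℤ) = τ.rayPairing q m + n * τ.totalOrder q := by
  refine ⟨τ.fan.totalChar D u - n • ∑ i, A i, fun q => ?_⟩
  have h := τ.fan.ray_totalChar D q u
  change τ.rayPairing q _ = _ at h
  rw [hu] at h
  have h1 : ∑ i, (n • SmoothFan.theta τ.ℓ) i * D i q = n * ∑ i, D i q := by
    rw [Finset.mul_sum]
    refine Finset.sum_congr rfl fun i _ => ?_
    by_cases hi : i = 0
    · subst hi; simp [hD₀]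
    · simp [SmoothFan.theta, hi]
  have h2 : ∑ i, D i q = τ.totalOrder q - τ.rayPairing q (∑ i, A i) := by
    rw [map_sum, totalOrder, ← Finset.sum_sub_distrib]
    exact Finset.sum_congr rfl fun i _ => hA i q
  rw [map_sub, map_nsmul, nsmul_eq_mul, h, h1, h2]
  ring

/-- The exponents with divisor one of the two rays of a maximal cone, up to other rays. -/
lemma exists_unit (hD₀ : D 0 = 0) (path : Fin (τ.ℓ + 1) → τ.fan.Arrow D →₀ ℕ)
    (hinc : ∀ i, τ.fan.totalInc D (path i) = Pi.single i 1 - Pi.single 0 1)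
    (S : Finset (Fin (τ.ℓ + 2))) (hdiv : ∀ i, ∀ q ∈ S, τ.fan.totalDiv D (path i) q = 0)
    (l : Fin (τ.ℓ + 1)) (m : τ.M) (hm : ∀ q : ℕ, q ≤ τ.ℓ + 1 → 0 ≤ τ.rayPairing q m + τ.order l q) :
    ∃ n : ℕ, ∃ u, τ.fan.totalInc D u = n • SmoothFan.theta τ.ℓ ∧
      ∀ q ∈ S, (τ.fan.totalDiv D u q : ℤ) = τ.rayPairing q m + τ.order l q := by
  obtain ⟨v, hv, hv'⟩ := exists_path hA hD₀ l m hm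
  -- In the tree the path to l is exchanged for v; the other paths have no zeroes along S.
  refine ⟨1, ∑ i ∈ Finset.univ.erase l, path i + v, ?_, fun q hq => ?_⟩
  · rw [map_add, map_sum, hv, ← hinc l]
    rw [Finset.sum_erase_add _ _ (Finset.mem_univ l), one_smul]
    simp only [hinc]
    exact SmoothFan.sum_single_sub _
  · rw [map_add, map_sum, Pi.add_apply, Finset.sum_apply,
      Finset.sum_eq_zero fun i _ => hdiv i q hq, zero_add, hv']

/-- The corner decomposition, read as an identity of divisors: corners are trees and the remainder w
is the label of a monomial of weight zero. Since a + b = N * n > 0, at least one tree occurs. -/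
lemma exists_factor (hD₀ : D 0 = 0) (T : Fin (τ.ℓ + 1) → τ.fan.Arrow D →₀ ℕ)
    (hT : ∀ j, τ.fan.totalInc D (T j) = SmoothFan.theta τ.ℓ)
    (hT' : ∀ j q, (τ.fan.totalDiv D (T j) q : ℤ) = τ.rayPairing q (τ.corner j) + τ.totalOrder q)
    {n : ℕ} (hn : 0 < n) {u : τ.fan.Arrow D →₀ ℕ}
    (hu : τ.fan.totalInc D u = n • SmoothFan.theta τ.ℓ) :
    ∃ N : ℕ, 0 < N ∧ ∃ j v, τ.fan.totalInc D (N • u) = τ.fan.totalInc D (T j + v) ∧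
      τ.fan.totalDiv D (N • u) = τ.fan.totalDiv D (T j + v) := by
  obtain ⟨m, hm⟩ := exists_char hA hD₀ n hu
  obtain ⟨N, hN, j, j', a, b, w, hab, hw, hsum⟩ := τ.exists_corner_decomposition n (m := m)
    fun q hq => (Int.natCast_nonneg _).trans_eq (hm ⟨q, by omega⟩)
  obtain ⟨v, hv, hv'⟩ := exists_loop hA hD₀ w hw
  have hinc : τ.fan.totalInc D (N • u) = τ.fan.totalInc D (a • T j + b • T j' + v) := by
    rw [map_add, map_add, map_nsmul, map_nsmul, map_nsmul, hT, hT, hu, hv, add_zero, ← add_smul,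
      hab, mul_smul]
  have hdiv : τ.fan.totalDiv D (N • u) = τ.fan.totalDiv D (a • T j + b • T j' + v) := by
    funext q
    have h1 := congrArg (τ.rayPairing q) hsum
    have h2 : (a : ℤ) + b = N * n := by exact_mod_cast hab
    zify
    simp only [map_add, map_nsmul, nsmul_eq_mul] at h1
    simp only [map_add, map_nsmul, Pi.add_apply, Pi.smul_apply, smul_eq_mul, Nat.cast_add,
      Nat.cast_mul, hm, hT', hv']
    linear_combination h1 - τ.totalOrder q * h2
  rcases Nat.eq_zero_or_pos a with ha | ha
  · have hb : 0 < b := by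
      have := Nat.mul_pos hN hn
      omega
    refine ⟨N, hN, j', a • T j + (b - 1) • T j' + v, ?_⟩
    have e : a • T j + b • T j' + v = T j' + (a • T j + (b - 1) • T j' + v) := by
      nth_rewrite 1 [← Nat.sub_add_cancel hb]
      rw [succ_nsmul]
      abel
    rw [← e]
    exact ⟨hinc, hdiv⟩
  · refine ⟨N, hN, j, (a - 1) • T j + b • T j' + v, ?_⟩
    have e : a • T j + b • T j' + v = T j + ((a - 1) • T j + b • T j' + v) := by
      nth_rewrite 1 [← Nat.sub_add_cancel ha]
      rw [succ_nsmul]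
      abel
    rw [← e]
    exact ⟨hinc, hdiv⟩

/-- The charts of the maximal cones and the paths from `0` that do not vanish there. -/
def chartData (hD₀ : D 0 = 0) : τ.fan.ChartData D (Fin (τ.ℓ + 1)) :=
  have hpath : ∀ j l : Fin (τ.ℓ + 1), ∃ u,
      τ.fan.totalInc D u = Pi.single l 1 - Pi.single 0 1 ∧
      ∀ q, (τ.fan.totalDiv D u q : ℤ) = τ.rayPairing q (τ.genChar j l) + τ.order l q := fun j l =>
    exists_path hA hD₀ l _ fun q _ => τ.genChar_add_order_nonneg j l q
  have hinc := fun j l => (hpath j l).choose_spec.1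
  have hdiv := fun j l => (hpath j l).choose_spec.2
  have hdiv0 : ∀ j l, ∀ q ∈ τ.maxCone j, τ.fan.totalDiv D (hpath j l).choose q = 0 :=
    fun j l q hq => by
      have h := hdiv j l q
      rw [τ.genChar_add_order_eq_zero (by omega) (by omega) (τ.mem_maxCone.1 hq)] at h
      exact_mod_cast h
  { cone := τ.maxCone
    cone_mem := fun j => ⟨j, Finset.Subset.refl _⟩
    exists_le := fun S hS => hS
    ray_injective := fun j m hm => τ.eq_zero_of_rayPairing_eq_zero (j := j) (by omega)
      (hm j.castSucc (τ.mem_maxCone.2 (Or.inl rfl))) (hm j.succ (τ.mem_maxCone.2 (Or.inr rfl)))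
    gen := fun j l => A l + τ.genChar j l
    isGen := fun j l q hq => by
      change τ.rayPairing q _ = _
      have h := τ.genChar_add_order_eq_zero (j := j) (l := l) (by omega) (by omega)
        (τ.mem_maxCone.1 hq)
      rw [map_add, hA]
      linarith
    path := fun j l => (hpath j l).choose
    inc_path := hinc
    div_path := hdiv0
    mem_cone := fun j q h => by
      by_contra hq
      rw [mem_maxCone, not_or] at hq
      have h' : ∀ l : Fin (τ.ℓ + 1), τ.rayPairing q (τ.genChar j l) + τ.order l q = 0 :=
        fun l => by rw [← hdiv j l q, h l, Nat.cast_zero]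
      -- A ray before the cone is detected by the path to j, a ray after it by the path to j + 1; in
      -- the latter case j + 1 ≤ ℓ.
      rcases lt_or_gt_of_ne hq.1 with h1 | h1
      · have h2 := h' j
        rw [genChar, if_pos le_rfl, τ.order_eq_zero h1.le (by omega), add_zero,
          step_of_pos τ (by omega)] at h2
        exact (τ.rayPairing_ratio_pos h1 (by omega)).ne' h2
      · have h2 := h' ⟨j + 1, by omega⟩
        rw [genChar, if_neg (by simp), map_zero, zero_add] at h2
        exact (τ.order_pos (l := j + 1) (by omega) (by omega) (by omega)).ne' h2
    exists_ratio := fun j m hm => by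
      have hj : (j : ℕ) ≤ τ.ℓ := by omega
      -- The dual basis of the cone, first element: `ratio (j + 1)` has order 1 along the ray j and
      -- 0 along the ray j + 1.
      have h1 : ∃ n : ℕ, ∃ u, τ.fan.totalInc D u = n • SmoothFan.theta τ.ℓ ∧
          ∀ q ∈ τ.maxCone j, (τ.fan.totalDiv D u q : ℤ) = τ.rayPairing q (τ.ratio (j + 1)) := by
        rcases hj.lt_or_eq with hlt | heq
        · obtain ⟨n, u, hu, hu'⟩ := exists_unit hA hD₀ _ (hinc j) _ (hdiv0 j) ⟨j + 1, by omega⟩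
            (τ.step (j + 1)) fun q _ => τ.rayPairing_step_add_order_nonneg _ q
          refine ⟨n, u, hu, fun q hq => (hu' q hq).trans ?_⟩
          have h := τ.mem_maxCone.1 hq
          rw [τ.order_eq_zero (by simp only; omega) (by simp only; omega), add_zero,
            step_of_pos τ (Nat.succ_pos _)]
        -- For j = ℓ there is no further bundle, but the ratio is the invariant function x^r.
        · obtain ⟨u, hu, hu'⟩ := exists_loop hA hD₀ (τ.ratio (j + 1)) fun q hq => by
            rw [heq]
            rcases hq.lt_or_eq with h | rfl
            · exact (τ.rayPairing_ratio_pos h le_rfl).le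
            · exact (τ.rayPairing_ratio_self _).ge
          exact ⟨0, u, by rw [hu, zero_smul], fun q _ => hu' q⟩
      -- Second element: `-ratio j` has order 0 along the ray j and 1 along the ray j + 1.
      have h2 : ∃ n : ℕ, ∃ u, τ.fan.totalInc D u = n • SmoothFan.theta τ.ℓ ∧
          ∀ q ∈ τ.maxCone j, (τ.fan.totalDiv D u q : ℤ) = -τ.rayPairing q (τ.ratio j) := by
        rcases Nat.eq_zero_or_pos (j : ℕ) with heq | hpos
        -- For j = 0 this is the invariant function y^{β_0}, because α_0 = 0.
        · obtain ⟨u, hu, hu'⟩ := exists_loop hA hD₀ (-τ.ratio 0) fun q hq => by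
            rw [map_neg, neg_nonneg]
            rcases Nat.eq_zero_or_pos q with rfl | h
            · exact (τ.rayPairing_ratio_self _).le
            · exact (τ.rayPairing_ratio_neg h hq).le
          exact ⟨0, u, by rw [hu, zero_smul], fun q _ => by rw [hu', map_neg, heq]⟩
        · obtain ⟨n, u, hu, hu'⟩ := exists_unit hA hD₀ _ (hinc j) _ (hdiv0 j) j 0
            fun q _ => by rw [map_zero, zero_add]; exact τ.order_nonneg _ _
          refine ⟨n, u, hu, fun q hq => (hu' q hq).trans ?_⟩
          have h := τ.mem_maxCone.1 hq
          rw [map_zero, zero_add, τ.order_eq_neg (by omega) (by omega), step_of_pos τ hpos]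
      obtain ⟨n₁, u₁, hi₁, hd₁⟩ := h1
      obtain ⟨n₂, u₂, hi₂, hd₂⟩ := h2
      -- The orders of m along the two rays are its coordinates in the dual basis, so products of
      -- powers of the two monomials realize it.
      obtain ⟨a, ha⟩ := Int.eq_ofNat_of_zero_le (hm j.castSucc (τ.mem_maxCone.2 (Or.inl rfl)))
      obtain ⟨b, hb⟩ := Int.eq_ofNat_of_zero_le (hm j.succ (τ.mem_maxCone.2 (Or.inr rfl)))
      change τ.rayPairing j m = a at ha
      change τ.rayPairing (j + 1) m = b at hb
      refine ⟨a * n₁ + b * n₂, a • u₁ + b • u₂, ?_, fun q hq => ?_⟩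
      · rw [map_add, map_nsmul, map_nsmul, hi₁, hi₂, add_smul, mul_smul, mul_smul]
      · change _ = τ.rayPairing q m
        rw [map_add, map_nsmul, map_nsmul, Pi.add_apply, Pi.smul_apply, Pi.smul_apply, smul_eq_mul,
          smul_eq_mul, Nat.cast_add, Nat.cast_mul, Nat.cast_mul, hd₁ q hq, hd₂ q hq]
        rcases τ.mem_maxCone.1 hq with h | h
        · rw [h, τ.rayPairing_ratio_succ hj, τ.rayPairing_ratio_self, ha]
          ring
        · rw [h, τ.rayPairing_succ_ratio hj, τ.rayPairing_ratio_self, hb]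
          ring
    exists_factor := fun n hn u hu => by
      have htree : ∀ j q, (τ.fan.totalDiv D (∑ i, (hpath j i).choose) q : ℤ) =
          τ.rayPairing q (τ.corner j) + τ.totalOrder q := fun j q => by
        rw [map_sum, Finset.sum_apply, Nat.cast_sum, corner, map_sum, totalOrder,
          ← Finset.sum_add_distrib]
        exact Finset.sum_congr rfl fun i _ => hdiv j i q
      have htree' : ∀ j, τ.fan.totalInc D (∑ i, (hpath j i).choose) = SmoothFan.theta τ.ℓ :=
        fun j => by
          rw [map_sum]
          simp only [hinc]
          exact SmoothFan.sum_single_sub _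
      exact exists_factor hA hD₀ _ htree' htree hn hu }

end ChartData

end CyclicType

end SpecialMcKay

end

theorem theorem3p3 (k : Type u) [Field k] [IsAlgClosed k] [CharZero k]
    (τ : SpecialMcKay.CyclicType)
    (D : Fin (τ.ℓ + 1) → Fin (τ.ℓ + 2) → ℤ) (hD₀ : D 0 = 0)
    (hD : ∀ i j : Fin τ.ℓ, τ.HasDegree (D i.succ) j (if i = j then 1 else 0)) :
    ∃ φ : τ.fan.toricVariety k ⟶ τ.fan.linearSeries D k,
      τ.fan.IsDescent D k φ ∧ (∀ ψ, τ.fan.IsDescent D k ψ → ψ = φ) ∧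
      IsClosedImmersion φ ∧
      (∃ e : τ.fan.toricVariety k ≅ τ.fan.toricImage D k, e.hom ≫ τ.fan.toricImageι D k = φ) ∧
      ∀ i, Nonempty ((Scheme.Modules.pullback φ).obj (τ.fan.tautologicalBundle D k i) ≅
        τ.fan.lineBundle k (D i)) := by
  obtain ⟨A, hA⟩ := τ.exists_eq_order D hD₀ hD
  let P := SpecialMcKay.CyclicType.chartData hA hD₀
  exact ⟨P.toSeries k, P.isDescent_toSeries k, fun ψ hψ => P.eq_toSeries_of_isDescent k ψ hψ,
    P.isClosedImmersion_toSeries k, ⟨asIso (P.toImage k), rfl⟩,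
    P.nonempty_pullback_tautologicalBundle_iso k hD₀⟩
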